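/- Let $N\ge 2$, $s\in(0,1)$, and let $$(-\Delta)^s u(x)=c_{N,s}\lim_{\varepsilon\to0^+}\int_{|x-y|\ge\varepsilon}\frac{u(x)-u(y)}{|x-y|^{N+2s}}\,dy,\qquad c_{N,s}=4^s\pi^{-N/2}\frac{\Gamma(\frac N2+s)}{\Gamma(2-s)}\,s(1-s).$$ For an open ball $B_R\subset\mathbb R^N$ of radius $R$ centred at the origin let $$\lambda_1^s(B_R)=\inf\left\{\frac{\frac{c_{N,s}}2\iint_{\mathbb R^N\times\mathbb R^N}\frac{|u(x)-u(y)|^2}{|x-y|^{N+2s}}\,dx\,dy}{\int_{\mathbb R^N}u^2\,dx}\;:\;0\ne u\in H^s(\mathbb R^N),\ u=0\text{ a.e. in }\mathbb R^N\setminus B_R\right\}$$ be the first Dirichlet eigenvalue of $(-\Delta)^s$ in $B_R$. In the following, "$(-\Delta)^sw=w$ pointwise in $D$" means that for every $x\in D$ the limit defining $(-\Delta)^sw(x)$ exists and equals $w(x)$; no further regularity of $w$ is assumed. (a) Let $R>0$ be such that $\lambda_1^s(B_R)<1$, let $x_0\in\mathbb R^N$, and let $w\in L^\infty(\mathbb R^N)$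 satisfy $w\ge0$ a.e. in $\mathbb R^N$ and $(-\Delta)^sw=w$ pointwise in $B_R(x_0)$. Then $w=0$ a.e. in $\mathbb R^N$, and $w(x)=0$ for every $x\in B_R(x_0)$. (b) If $w\in L^\infty(\mathbb R^N)$ satisfies $w\ge0$ a.e. in $\mathbb R^N$ and $(-\Delta)^sw=w$ pointwise in $\mathbb R^N$, then $w(x)=0$ for every $x\in\mathbb R^N$. (c) If $w\in L^\infty(\mathbb R^N)$ satisfies $w\ge0$ a.e. in $\mathbb R^N$ and $(-\Delta)^sw=w$ pointwise in $\mathbb R^N_+=\{x\in\mathbb R^N: x_N>0\}$, then $w(x)=0$ for every $x\in\mathbb R^N_+$. -/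

import Mathlib

open MeasureTheory Filter Topology

noncomputable section

/-- The normalizing constant `c_{N,s} = 4^s π^{-N/2} Γ(N/2 + s) / Γ(2 - s) · s (1 - s)`. -/
def fracLapConst (N : ℕ) (s : ℝ) : ℝ :=
  (4 : ℝ) ^ s * Real.pi ^ (-(N : ℝ) / 2) *
    (Real.Gamma ((N : ℝ) / 2 + s) / Real.Gamma (2 - s)) * (s * (1 - s))

/-- `(-Δ)^s u (x)` exists as a principal value (limit of the integrals over the complements of
the balls `B_ε(x)` as `ε → 0+`) and equals `l`. -/
def HasFracLaplacianAt {N : ℕ} (s : ℝ) (u : EuclideanSpace ℝ (Fin N) → ℝ)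
    (x : EuclideanSpace ℝ (Fin N)) (l : ℝ) : Prop :=
  (∀ ε : ℝ, 0 < ε →
    IntegrableOn (fun y => (u x - u y) / ‖x - y‖ ^ ((N : ℝ) + 2 * s)) (Metric.ball x ε)ᶜ) ∧
  Tendsto
    (fun ε : ℝ => fracLapConst N s *
      ∫ y in (Metric.ball x ε)ᶜ, (u x - u y) / ‖x - y‖ ^ ((N : ℝ) + 2 * s))
    (𝓝[>] 0) (𝓝 l)

/-- `u ∈ H^s(ℝ^N)`: `u ∈ L²` with square integrable Gagliardo quotient
`|u(x) - u(y)| / |x - y|^{N/2 + s}`. -/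
def MemFracSobolev {N : ℕ} (s : ℝ) (u : EuclideanSpace ℝ (Fin N) → ℝ) : Prop :=
  MemLp u 2 volume ∧
  MemLp (fun p : EuclideanSpace ℝ (Fin N) × EuclideanSpace ℝ (Fin N) =>
    (u p.1 - u p.2) / ‖p.1 - p.2‖ ^ ((N : ℝ) / 2 + s)) 2 volume

/-- `u ∈ 𝓗^s_0(Ω)`: `u ∈ H^s(ℝ^N)` and `u = 0` almost everywhere outside `Ω`. -/
def MemFracSobolevZero {N : ℕ} (s : ℝ) (Ω : Set (EuclideanSpace ℝ (Fin N)))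
    (u : EuclideanSpace ℝ (Fin N) → ℝ) : Prop :=
  MemFracSobolev s u ∧ ∀ᵐ x, x ∉ Ω → u x = 0

/-- The quadratic form of `(-Δ)^s`:
`(c_{N,s} / 2) ∬ |u(x) - u(y)|² / |x - y|^{N + 2s} dx dy`. -/
def fracEnergy {N : ℕ} (s : ℝ) (u : EuclideanSpace ℝ (Fin N) → ℝ) : ℝ :=
  fracLapConst N s / 2 *
    ∫ p : EuclideanSpace ℝ (Fin N) × EuclideanSpace ℝ (Fin N),
      (u p.1 - u p.2) ^ 2 / ‖p.1 - p.2‖ ^ ((N : ℝ) + 2 * s)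

/-- The first Dirichlet eigenvalue `λ_1^s(Ω)` of `(-Δ)^s` in `Ω`: the infimum of the Rayleigh
quotient over the nonzero elements of `𝓗^s_0(Ω)`. -/
def firstFracEigenvalue {N : ℕ} (s : ℝ) (Ω : Set (EuclideanSpace ℝ (Fin N))) : ℝ :=
  sInf {r : ℝ | ∃ u : EuclideanSpace ℝ (Fin N) → ℝ,
    MemFracSobolevZero s Ω u ∧ ¬ (u =ᵐ[volume] 0) ∧ r = fracEnergy s u / ∫ x, u x ^ 2}

end

noncomputable section

open MeasureTheory Filter Topology Set Module

set_option linter.unusedSectionVars false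

variable {E : Type*} [NormedAddCommGroup E] [InnerProductSpace ℝ E] [FiniteDimensional ℝ E]
  [MeasurableSpace E] [BorelSpace E]

/-- The Gauss–Weierstrass kernel. -/
def heatKernel (E : Type*) [NormedAddCommGroup E] [InnerProductSpace ℝ E] (τ : ℝ) (z : E) : ℝ :=
  (4 * Real.pi * τ) ^ (-(finrank ℝ E : ℝ) / 2) * Real.exp (-(1 / (4 * τ)) * ‖z‖ ^ 2)

/-- The heat semigroup. -/
def heat (τ : ℝ) (φ : E → ℝ) (x : E) : ℝ := ∫ y, heatKernel E τ (x - y) * φ y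

theorem heatKernel_neg (τ : ℝ) (z : E) : heatKernel E τ (-z) = heatKernel E τ z := by
  simp [heatKernel]

theorem heatKernel_sub_comm (τ : ℝ) (x y : E) : heatKernel E τ (x - y) = heatKernel E τ (y - x) := by
  rw [← heatKernel_neg, neg_sub]

theorem heatKernel_pos {τ : ℝ} (hτ : 0 < τ) (z : E) : 0 < heatKernel E τ z := by
  unfold heatKernel; positivity

theorem heatKernel_le {τ : ℝ} (hτ : 0 < τ) (z : E) :
    heatKernel E τ z ≤ (4 * Real.pi * τ) ^ (-(finrank ℝ E : ℝ) / 2) := by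
  unfold heatKernel
  apply mul_le_of_le_one_right (by positivity)
  rw [Real.exp_le_one_iff]
  have : 0 ≤ 1 / (4 * τ) * ‖z‖ ^ 2 := by positivity
  linarith

theorem measurable_heatKernel : Measurable (fun p : ℝ × E => heatKernel E p.1 p.2) := by
  unfold heatKernel; fun_prop

theorem continuous_heatKernel (τ : ℝ) : Continuous (heatKernel E τ) := by
  unfold heatKernel; fun_prop

theorem integrable_exp_neg_mul_sq_norm {b : ℝ} (hb : 0 < b) :
    Integrable (fun z : E => Real.exp (-b * ‖z‖ ^ 2)) := by
  have h := (GaussianFourier.integrable_cexp_neg_mul_sq_norm_add (V := E) (b := (b : ℂ))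
    (by simpa using hb) 0 0).re
  refine h.congr (ae_of_all _ fun z => ?_)
  simp only [zero_mul, add_zero]
  have : (-(b : ℂ) * (‖z‖ : ℂ) ^ 2) = ((-b * ‖z‖ ^ 2 : ℝ) : ℂ) := by push_cast; ring
  rw [this]
  exact Complex.exp_ofReal_re _

theorem integrable_heatKernel {τ : ℝ} (hτ : 0 < τ) : Integrable (heatKernel E τ) :=
  (integrable_exp_neg_mul_sq_norm (by positivity)).const_mul _

theorem integral_heatKernel {τ : ℝ} (hτ : 0 < τ) : ∫ z, heatKernel E τ z = 1 := by
  unfold heatKernel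
  rw [integral_const_mul, GaussianFourier.integral_rexp_neg_mul_sq_norm (by positivity)]
  have : Real.pi / (1 / (4 * τ)) = 4 * Real.pi * τ := by field_simp
  rw [this, ← Real.rpow_add (by positivity)]
  ring_nf
  exact Real.rpow_zero _

theorem heatKernel_mul_heatKernel {τ σ : ℝ} (hτ : 0 < τ) (hσ : 0 < σ) (x y : E) :
    heatKernel E τ (x - y) * heatKernel E σ y =
      heatKernel E (τ + σ) x * heatKernel E (τ * σ / (τ + σ)) (y - (σ / (τ + σ)) • x) := by
  unfold heatKernel
  rw [mul_mul_mul_comm, mul_mul_mul_comm (_ ^ _) (Real.exp _) (_ ^ _) (Real.exp _),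
    ← Real.exp_add, ← Real.exp_add, ← Real.mul_rpow (by positivity) (by positivity), ← Real.mul_rpow (by positivity) (by positivity)]
  congr 2
  · field_simp
  · rw [norm_sub_sq_real, norm_sub_sq_real, norm_smul, mul_pow, inner_smul_right,
      real_inner_comm y x, Real.norm_eq_abs, sq_abs]
    field_simp
    ring

theorem integral_heatKernel_mul_heatKernel {τ σ : ℝ} (hτ : 0 < τ) (hσ : 0 < σ) (x : E) :
    ∫ y, heatKernel E τ (x - y) * heatKernel E σ y = heatKernel E (τ + σ) x := by
  simp_rw [heatKernel_mul_heatKernel hτ hσ]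
  rw [integral_const_mul, integral_sub_right_eq_self (heatKernel E _) _,
    integral_heatKernel (by positivity), mul_one]

theorem sq_norm_mul_heatKernel_le {τ : ℝ} (hτ : 0 < τ) (z : E) :
    ‖z‖ ^ 2 * heatKernel E τ z ≤
      8 * 2 ^ ((finrank ℝ E : ℝ) / 2) * τ * heatKernel E (2 * τ) z := by
  unfold heatKernel
  have h1 : ‖z‖ ^ 2 / (8 * τ) ≤ Real.exp (‖z‖ ^ 2 / (8 * τ)) :=
    (by linarith : ‖z‖ ^ 2 / (8 * τ) ≤ ‖z‖ ^ 2 / (8 * τ) + 1).trans (Real.add_one_le_exp _)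
  have h2 : ‖z‖ ^ 2 ≤ 8 * τ * Real.exp (‖z‖ ^ 2 / (8 * τ)) := by
    rwa [div_le_iff₀' (by positivity)] at h1
  have h3 : Real.exp (‖z‖ ^ 2 / (8 * τ)) * Real.exp (-(1 / (4 * τ)) * ‖z‖ ^ 2) =
      Real.exp (-(1 / (4 * (2 * τ))) * ‖z‖ ^ 2) := by
    rw [← Real.exp_add]; congr 1; field_simp; ring
  have h4 : (4 * Real.pi * τ) ^ (-(finrank ℝ E : ℝ) / 2) =
      2 ^ ((finrank ℝ E : ℝ) / 2) * (4 * Real.pi * (2 * τ)) ^ (-(finrank ℝ E : ℝ) / 2) := by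
    rw [show 4 * Real.pi * (2 * τ) = 2 * (4 * Real.pi * τ) by ring,
      Real.mul_rpow (x := 2) (by positivity) (by positivity), ← mul_assoc, ← Real.rpow_add (by positivity)]
    ring_nf; simp
  rw [← h3, h4]
  calc _ ≤ (8 * τ * Real.exp (‖z‖ ^ 2 / (8 * τ))) * _ :=
        mul_le_mul_of_nonneg_right h2 (by positivity)
    _ = _ := by ring

theorem integrable_sq_norm_mul_heatKernel {τ : ℝ} (hτ : 0 < τ) :
    Integrable (fun z : E => ‖z‖ ^ 2 * heatKernel E τ z) := by
  refine ((integrable_heatKernel (E := E) (τ := 2 * τ) (by positivity)).const_mul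
    (8 * 2 ^ ((finrank ℝ E : ℝ) / 2) * τ)).mono'
    ((by fun_prop : Continuous fun z : E => ‖z‖ ^ 2).mul
      (continuous_heatKernel τ)).aestronglyMeasurable (ae_of_all _ fun z => ?_)
  rw [Real.norm_of_nonneg (mul_nonneg (by positivity) (heatKernel_pos hτ z).le)]
  exact sq_norm_mul_heatKernel_le hτ z

theorem integral_sq_norm_mul_heatKernel_le {τ : ℝ} (hτ : 0 < τ) :
    ∫ z : E, ‖z‖ ^ 2 * heatKernel E τ z ≤ 8 * 2 ^ ((finrank ℝ E : ℝ) / 2) * τ := by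
  refine (integral_mono (integrable_sq_norm_mul_heatKernel hτ)
    ((integrable_heatKernel (E := E) (τ := 2 * τ) (by positivity)).const_mul
    (8 * 2 ^ ((finrank ℝ E : ℝ) / 2) * τ)) (sq_norm_mul_heatKernel_le hτ)).trans ?_
  rw [integral_const_mul, integral_heatKernel (by positivity), mul_one]

theorem heat_eq (τ : ℝ) (φ : E → ℝ) (x : E) : heat τ φ x = ∫ z, heatKernel E τ z * φ (x - z) := by
  rw [heat, ← integral_sub_left_eq_self _ _ x]
  simp

theorem heat_eq' (τ : ℝ) (φ : E → ℝ) (x : E) : heat τ φ x = ∫ z, heatKernel E τ z * φ (x + z) := by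
  rw [heat_eq, ← integral_neg_eq_self]
  simp [heatKernel_neg]

theorem integrable_heatKernel_mul {τ : ℝ} (hτ : 0 < τ) {φ : E → ℝ} (hφ : AEStronglyMeasurable φ)
    {M : ℝ} (hM : ∀ x, |φ x| ≤ M) (x : E) : Integrable fun y => heatKernel E τ (x - y) * φ y :=
  ((integrable_heatKernel hτ).comp_sub_left x).mul_bdd (c := M) hφ (ae_of_all _ hM)

theorem integrable_heatKernel_mul_add {τ : ℝ} (hτ : 0 < τ) {φ : E → ℝ}
    (hφ : AEStronglyMeasurable φ)
    {M : ℝ} (hM : ∀ x, |φ x| ≤ M) (x : E) : Integrable fun z => heatKernel E τ z * φ (x + z) :=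
  (integrable_heatKernel hτ).mul_bdd (c := M)
    (hφ.comp_measurePreserving (measurePreserving_add_left volume x)) (ae_of_all _ fun _ => hM _)

theorem integrable_heatKernel_mul_of_integrable {τ : ℝ} (hτ : 0 < τ) {φ : E → ℝ}
    (hφ : Integrable φ) (x : E) : Integrable fun y => heatKernel E τ (x - y) * φ y :=
  hφ.bdd_mul (c := (4 * Real.pi * τ) ^ (-(finrank ℝ E : ℝ) / 2))
    ((continuous_heatKernel τ).comp (continuous_const.sub continuous_id)).aestronglyMeasurable
    (ae_of_all _ fun y => by
      rw [Real.norm_of_nonneg (heatKernel_pos hτ _).le]; exact heatKernel_le hτ _)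

theorem integral_heatKernel_sub {τ : ℝ} (hτ : 0 < τ) (x : E) :
    ∫ y, heatKernel E τ (x - y) = 1 := by
  rw [integral_sub_left_eq_self (heatKernel E τ), integral_heatKernel hτ]

theorem heat_const {τ : ℝ} (hτ : 0 < τ) (c : ℝ) (x : E) : heat τ (fun _ => c) x = c := by
  rw [heat, integral_mul_const, integral_heatKernel_sub hτ, one_mul]

theorem abs_heat_le {τ : ℝ} (hτ : 0 < τ) {φ : E → ℝ} {M : ℝ} (hM : ∀ x, |φ x| ≤ M) (x : E) :
    |heat τ φ x| ≤ M := by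
  refine (norm_integral_le_of_norm_le (f := fun y => heatKernel E τ (x - y) * φ y)
    (((integrable_heatKernel hτ).comp_sub_left x).mul_const M) (ae_of_all _ fun y => ?_)).trans ?_
  · rw [norm_mul, Real.norm_of_nonneg (heatKernel_pos hτ _).le]
    exact mul_le_mul_of_nonneg_left (hM y) (heatKernel_pos hτ _).le
  · rw [integral_mul_const, integral_heatKernel_sub hτ, one_mul]

theorem abs_heat_le_of_integrable {τ : ℝ} (hτ : 0 < τ) {φ : E → ℝ} (hφ : Integrable φ) (x : E) :
    |heat τ φ x| ≤ (4 * Real.pi * τ) ^ (-(finrank ℝ E : ℝ) / 2) * ∫ y, |φ y| := by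
  rw [← integral_const_mul]
  refine norm_integral_le_of_norm_le (f := fun y => heatKernel E τ (x - y) * φ y) (hφ.abs.const_mul _) (ae_of_all _ fun y => ?_)
  rw [norm_mul, Real.norm_of_nonneg (heatKernel_pos hτ _).le]
  exact mul_le_mul_of_nonneg_right (heatKernel_le hτ _) (abs_nonneg _)

theorem heat_nonneg {τ : ℝ} (hτ : 0 < τ) {φ : E → ℝ} (h : ∀ x, 0 ≤ φ x) (x : E) :
    0 ≤ heat τ φ x :=
  integral_nonneg fun y => mul_nonneg (heatKernel_pos hτ _).le (h y)

theorem stronglyMeasurable_heat {φ : E → ℝ} (hφ : Measurable φ) :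
    StronglyMeasurable fun p : ℝ × E => heat p.1 φ p.2 := by
  have : StronglyMeasurable (fun q : (ℝ × E) × E => heatKernel E q.1.1 (q.1.2 - q.2) * φ q.2) := by
    apply Measurable.stronglyMeasurable
    exact (measurable_heatKernel.comp (by fun_prop : Measurable
      (fun q : (ℝ × E) × E => (q.1.1, q.1.2 - q.2)))).mul (hφ.comp measurable_snd)
  exact this.integral_prod_right

theorem measurable_heat_left {φ : E → ℝ} (hφ : Measurable φ) (x : E) :
    Measurable fun τ => heat τ φ x :=
  (stronglyMeasurable_heat hφ).measurable.comp (measurable_id.prodMk measurable_const)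

theorem measurable_heat {φ : E → ℝ} (hφ : Measurable φ) (τ : ℝ) : Measurable (heat τ φ) :=
  (stronglyMeasurable_heat hφ).measurable.comp (measurable_const.prodMk measurable_id)

theorem continuous_heat_of_integrable {τ : ℝ} (hτ : 0 < τ) {φ : E → ℝ} (hφ : Integrable φ) :
    Continuous (heat τ φ) := by
  refine continuous_of_dominated (bound := fun y =>
    (4 * Real.pi * τ) ^ (-(finrank ℝ E : ℝ) / 2) * |φ y|) (fun x =>
      (integrable_heatKernel_mul_of_integrable hτ hφ x).aestronglyMeasurable)
    (fun x => ae_of_all _ fun y => ?_) (hφ.abs.const_mul _) (ae_of_all _ fun y => ?_)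
  · rw [norm_mul, Real.norm_of_nonneg (heatKernel_pos hτ _).le]
    exact mul_le_mul_of_nonneg_right (heatKernel_le hτ _) (abs_nonneg _)
  · exact ((continuous_heatKernel τ).comp (continuous_id.sub continuous_const)).mul continuous_const

theorem integrable_heatKernel_mul_prod {τ : ℝ} (hτ : 0 < τ) {η φ : E → ℝ}
    (hη : Integrable η) (hφ : AEStronglyMeasurable φ)
    {M : ℝ} (hM : ∀ x, |φ x| ≤ M) :
    Integrable (fun p : E × E => η p.1 * (heatKernel E τ (p.1 - p.2) * φ p.2))
      (volume.prod volume) := by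
  have h1 : Integrable (fun p : E × E => η p.1 * heatKernel E τ (p.1 - p.2))
      (volume.prod volume) := by
    have := (hη.convolution_integrand (ContinuousLinearMap.mul ℝ ℝ)
      (integrable_heatKernel (E := E) hτ)).swap
    refine this.congr (ae_of_all _ fun p => ?_)
    simp only [Function.comp, Prod.swap, ContinuousLinearMap.mul_apply']
    rw [heatKernel_sub_comm]
  have h2 := h1.mul_bdd (g := fun p : E × E => φ p.2) (c := M) hφ.comp_snd (ae_of_all _ fun p => hM _)
  exact h2.congr (ae_of_all _ fun p => by simp [mul_assoc])

theorem integral_mul_heat_comm {τ : ℝ} (hτ : 0 < τ) {η φ : E → ℝ}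
    (hη : Integrable η) (hφ : AEStronglyMeasurable φ)
    {M : ℝ} (hM : ∀ x, |φ x| ≤ M) :
    ∫ x, η x * heat τ φ x = ∫ x, heat τ η x * φ x := by
  unfold heat
  simp_rw [← integral_const_mul, ← integral_mul_const]
  rw [integral_integral_swap (integrable_heatKernel_mul_prod hτ hη hφ hM)]
  refine integral_congr_ae (ae_of_all _ fun y => integral_congr_ae (ae_of_all _ fun x => ?_))
  simp only
  rw [heatKernel_sub_comm]; ring

theorem heat_heat {τ σ : ℝ} (hτ : 0 < τ) (hσ : 0 < σ) {φ : E → ℝ} (hφ : AEStronglyMeasurable φ)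
    {M : ℝ} (hM : ∀ x, |φ x| ≤ M) (x : E) : heat τ (heat σ φ) x = heat (τ + σ) φ x := by
  have h := integrable_heatKernel_mul_prod hσ ((integrable_heatKernel hτ).comp_sub_left x) hφ hM
  unfold heat
  simp_rw [← integral_const_mul]
  rw [integral_integral_swap h]
  refine integral_congr_ae (ae_of_all _ fun y => ?_)
  simp only
  rw [show x - y = (x - y) by rfl, ← integral_heatKernel_mul_heatKernel hτ hσ (x - y),
    ← integral_mul_const, ← integral_sub_right_eq_self (fun z => heatKernel E τ (x - y - z) * _ * _) y]
  refine integral_congr_ae (ae_of_all _ fun z => ?_)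
  simp only
  rw [show x - y - (z - y) = x - z by abel]; ring

theorem integrable_heat {τ : ℝ} (hτ : 0 < τ) {η : E → ℝ} (hη : Integrable η) :
    Integrable (heat τ η) := by
  have h := (integrable_heatKernel_mul_prod hτ hη (φ := fun _ : E => (1 : ℝ))
    aestronglyMeasurable_const (M := 1) (by simp)).integral_prod_right
  refine h.congr (ae_of_all _ fun x => ?_)
  simp only [heat, mul_one]
  refine integral_congr_ae (ae_of_all _ fun y => ?_)
  simp only
  rw [heatKernel_sub_comm]; ring

end

noncomputable section

open MeasureTheory Filter Topology Set Module

set_option linter.unusedSectionVars false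

/-- The increment `(p - 1)₊^(β - 1) - p^(β - 1)`. -/
def powIncr (β p : ℝ) : ℝ := (if 1 < p then (p - 1) ^ (β - 1) else 0) - p ^ (β - 1)

theorem measurable_powIncr (β : ℝ) : Measurable (powIncr β) :=
  (Measurable.ite measurableSet_Ioi (by fun_prop) measurable_const).sub (by fun_prop)

theorem powIncr_of_le {β p : ℝ} (hp : p ≤ 1) : powIncr β p = -p ^ (β - 1) := by
  simp [powIncr, not_lt.2 hp]

theorem powIncr_of_lt {β p : ℝ} (hp : 1 < p) : powIncr β p = (p - 1) ^ (β - 1) - p ^ (β - 1) := by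
  simp [powIncr, hp]

theorem powIncr_nonneg {β p : ℝ} (hβ : β < 1) (hp : 1 < p) : 0 ≤ powIncr β p := by
  rw [powIncr_of_lt hp, sub_nonneg]
  exact Real.rpow_le_rpow_of_nonpos (by linarith) (by linarith) (by linarith)

theorem powIncr_le {β p : ℝ} (hβ0 : 0 < β) (hp : 2 < p) :
    powIncr β p ≤ 2 * p ^ (β - 2) := by
  have hp0 : 0 < p := by linarith
  rw [powIncr_of_lt (by linarith)]
  have h1 : (p - 1) ^ (β - 1) = p ^ (β - 1) * (1 - 1 / p) ^ (β - 1) := by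
    rw [← Real.mul_rpow hp0.le]
    · congr 1; field_simp
    · rw [sub_nonneg, div_le_one hp0]; linarith
  have hu : 0 < 1 - 1 / p := by rw [sub_pos, div_lt_one hp0]; linarith
  have h2 : (1 - 1 / p) ^ (β - 1) ≤ (1 - 1 / p) ^ (-1 : ℝ) :=
    Real.rpow_le_rpow_of_exponent_ge hu (by simp; positivity) (by linarith)
  have h3 : (1 - 1 / p) ^ (-1 : ℝ) ≤ 1 + 2 / p := by
    rw [Real.rpow_neg_one, inv_le_comm₀ hu (by positivity), inv_le_iff_one_le_mul₀ (by positivity)]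
    field_simp
    nlinarith
  have h4 : p ^ (β - 2) = p ^ (β - 1) / p := by
    rw [← Real.rpow_sub_one hp0.ne']; ring_nf
  rw [h1, h4]
  calc p ^ (β - 1) * (1 - 1 / p) ^ (β - 1) - p ^ (β - 1)
      ≤ p ^ (β - 1) * (1 + 2 / p) - p ^ (β - 1) := by gcongr; exact h2.trans h3
    _ = _ := by ring

theorem integrableOn_Ioc_rpow {r a : ℝ} (hr : -1 < r) (ha : 0 ≤ a) :
    IntegrableOn (fun p : ℝ => p ^ r) (Ioc 0 a) :=
  (intervalIntegrable_iff_integrableOn_Ioc_of_le ha).1 (intervalIntegral.intervalIntegrable_rpow' hr)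

theorem integrableOn_Ioc_sub_one_rpow {r a : ℝ} (hr : -1 < r) (ha : 1 ≤ a) :
    IntegrableOn (fun p : ℝ => (p - 1) ^ r) (Ioc 1 a) := by
  have := (intervalIntegral.intervalIntegrable_rpow' (a := 0) (b := a - 1) hr).comp_sub_right 1
  simp only [zero_add, sub_add_cancel] at this
  exact (intervalIntegrable_iff_integrableOn_Ioc_of_le ha).1 this

theorem integrableOn_powIncr_mul_rpow {β r : ℝ} (hβ0 : 0 < β) (hβ1 : β < 1) (hr : -β < r)
    (hr' : r < 1 - β) : IntegrableOn (fun p => powIncr β p * p ^ r) (Ioi 0) := by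
  have hm : Measurable fun p : ℝ => powIncr β p * p ^ r :=
    (measurable_powIncr β).mul (by fun_prop)
  have e1 : Ioi (0 : ℝ) = Ioc 0 1 ∪ (Ioc 1 2 ∪ Ioi 2) := by
    rw [Ioc_union_Ioi_eq_Ioi one_le_two, Ioc_union_Ioi_eq_Ioi zero_le_one]
  rw [e1]
  refine IntegrableOn.union ?_ (IntegrableOn.union ?_ ?_)
  · refine (integrableOn_Ioc_rpow (r := β - 1 + r) (by linarith) zero_le_one).neg.congr_fun ?_
      measurableSet_Ioc
    intro p hp
    simp only [Pi.neg_apply]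
    rw [powIncr_of_le hp.2, Real.rpow_add hp.1]; ring
  · have h1 : IntegrableOn (fun p : ℝ => ((p - 1) ^ (β - 1)) * p ^ r) (Ioc 1 2) := by
      refine (integrableOn_Ioc_sub_one_rpow (by linarith) one_le_two).mul_bdd (c := 2 ^ |r|)
        (by fun_prop) ?_
      filter_upwards [ae_restrict_mem measurableSet_Ioc] with p hp
      rw [Real.norm_of_nonneg (Real.rpow_nonneg (by linarith [hp.1]) _)]
      calc p ^ r ≤ p ^ |r| := Real.rpow_le_rpow_of_exponent_le hp.1.le (le_abs_self r)
        _ ≤ 2 ^ |r| := Real.rpow_le_rpow (by linarith [hp.1]) hp.2 (abs_nonneg _)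
    have h2 : IntegrableOn (fun p : ℝ => p ^ (β - 1 + r)) (Ioc 1 2) :=
      (integrableOn_Ioc_rpow (r := β - 1 + r) (by linarith) zero_le_two).mono_set
        (Ioc_subset_Ioc_left zero_le_one)
    refine (h1.sub h2).congr_fun ?_ measurableSet_Ioc
    intro p hp
    simp only [Pi.sub_apply]
    rw [powIncr_of_lt hp.1, Real.rpow_add (by linarith [hp.1])]; ring
  · refine ((integrableOn_Ioi_rpow_of_lt (a := β - 2 + r) (by linarith) zero_lt_two).const_mul
      2).mono' hm.aestronglyMeasurable ?_
    filter_upwards [ae_restrict_mem measurableSet_Ioi] with p hp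
    have hp0 : 0 < p := by simp only [mem_Ioi] at hp; linarith
    have hp1 : 1 < p := by simp only [mem_Ioi] at hp; linarith
    rw [Real.norm_of_nonneg (mul_nonneg (powIncr_nonneg hβ1 hp1) (by positivity)),
      Real.rpow_add hp0, ← mul_assoc]
    gcongr
    exact powIncr_le hβ0 hp

theorem integrableOn_powIncr {β : ℝ} (hβ0 : 0 < β) (hβ1 : β < 1) :
    IntegrableOn (powIncr β) (Ioi 0) := by
  simpa using integrableOn_powIncr_mul_rpow hβ0 hβ1 (r := 0) (by linarith) (by linarith)

theorem integral_powIncr_of_le {β x : ℝ} (hβ0 : 0 < β) (hx0 : 0 ≤ x) (hx1 : x ≤ 1) :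
    ∫ p in Ioc 0 x, powIncr β p = -(x ^ β / β) := by
  rw [setIntegral_congr_fun (g := fun p => -p ^ (β - 1)) measurableSet_Ioc
    fun p hp => powIncr_of_le (hp.2.trans hx1), integral_neg,
    ← intervalIntegral.integral_of_le hx0, integral_rpow (by left; linarith)]
  simp [Real.zero_rpow hβ0.ne']

theorem integral_powIncr_of_lt {β x : ℝ} (hβ0 : 0 < β) (hβ1 : β < 1) (hx : 1 < x) :
    ∫ p in Ioc 0 x, powIncr β p = ((x - 1) ^ β - x ^ β) / β := by
  have hI := integrableOn_powIncr hβ0 hβ1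
  have h1 : ∫ p in Ioc 1 x, powIncr β p = (x - 1) ^ β / β - (x ^ β - 1) / β := by
    rw [setIntegral_congr_fun (g := fun p => (p - 1) ^ (β - 1) - p ^ (β - 1)) measurableSet_Ioc
      fun p hp => powIncr_of_lt hp.1, integral_sub
      (integrableOn_Ioc_sub_one_rpow (by linarith) hx.le)
      ((integrableOn_Ioc_rpow (by linarith) (by linarith)).mono_set
        (Ioc_subset_Ioc_left zero_le_one)), ← intervalIntegral.integral_of_le hx.le,
      ← intervalIntegral.integral_of_le hx.le, integral_rpow (by left; linarith),
      intervalIntegral.integral_comp_sub_right (fun p : ℝ => p ^ (β - 1)),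
      integral_rpow (by left; linarith)]
    simp [Real.zero_rpow hβ0.ne']
  rw [← Ioc_union_Ioc_eq_Ioc zero_le_one hx.le, setIntegral_union
    (Ioc_disjoint_Ioc_of_le le_rfl) measurableSet_Ioc (hI.mono_set Ioc_subset_Ioi_self)
    (hI.mono_set (Ioc_subset_Ioi_self.trans (Ioi_subset_Ioi zero_le_one))),
    integral_powIncr_of_le hβ0 zero_le_one le_rfl, h1, Real.one_rpow]
  ring

theorem rpow_sub_rpow_sub_one_le {β x : ℝ} (hβ1 : β < 1) (hx : 1 < x) :
    x ^ β - (x - 1) ^ β ≤ x ^ (β - 1) := by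
  have hx0 : 0 < x := by linarith
  have hu : 0 ≤ 1 - 1 / x := by rw [sub_nonneg, div_le_one hx0]; linarith
  have h1 : (x - 1) ^ β = x ^ β * (1 - 1 / x) ^ β := by
    rw [← Real.mul_rpow hx0.le hu]
    congr 1; field_simp
  have h2 : (1 - 1 / x) ^ (1 : ℝ) ≤ (1 - 1 / x) ^ β :=
    Real.rpow_le_rpow_of_exponent_ge (by rw [sub_pos, div_lt_one hx0]; linarith)
      (by simp; positivity) hβ1.le
  rw [Real.rpow_one] at h2
  rw [h1, Real.rpow_sub_one hx0.ne']
  calc x ^ β - x ^ β * (1 - 1 / x) ^ β ≤ x ^ β - x ^ β * (1 - 1 / x) := by gcongr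
    _ = _ := by ring

theorem integral_powIncr {β : ℝ} (hβ0 : 0 < β) (hβ1 : β < 1) :
    ∫ p in Ioi 0, powIncr β p = 0 := by
  have h := intervalIntegral_tendsto_integral_Ioi 0 (integrableOn_powIncr hβ0 hβ1) tendsto_id
  refine tendsto_nhds_unique h ?_
  have h0 : Tendsto (fun x : ℝ => x ^ (β - 1) / β) atTop (𝓝 0) := by
    have := (tendsto_rpow_neg_atTop (y := 1 - β) (by linarith)).div_const β
    simpa using this
  refine squeeze_zero_norm' ?_ h0
  filter_upwards [eventually_gt_atTop 1] with x hx
  simp only [id]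
  rw [intervalIntegral.integral_of_le (by linarith), integral_powIncr_of_lt hβ0 hβ1 hx,
    norm_div, Real.norm_of_nonneg hβ0.le, norm_sub_rev, Real.norm_of_nonneg]
  · gcongr
    exact rpow_sub_rpow_sub_one_le hβ1 hx
  · rw [sub_nonneg]
    exact Real.rpow_le_rpow (by linarith) (by linarith) hβ0.le

theorem integral_powIncr_mul_rpow_pos {β s : ℝ} (hβ0 : 0 < β) (hs : 0 < s) (hsβ : β + s < 1) :
    0 < ∫ p in Ioi 0, powIncr β p * p ^ s := by
  have hβ1 : β < 1 := by linarith
  have hi := integrableOn_powIncr_mul_rpow hβ0 hβ1 (r := s) (by linarith) (by linarith)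
  have hi0 := integrableOn_powIncr hβ0 hβ1
  have e : ∫ p in Ioi 0, powIncr β p * p ^ s = ∫ p in Ioi 0, powIncr β p * (p ^ s - 1) := by
    simp_rw [mul_sub, mul_one]
    rw [integral_sub hi hi0, integral_powIncr hβ0 hβ1, sub_zero]
  have hi' : IntegrableOn (fun p => powIncr β p * (p ^ s - 1)) (Ioi 0) := by
    simp_rw [mul_sub, mul_one]; exact hi.sub hi0
  rw [e, setIntegral_pos_iff_support_of_nonneg_ae _ hi']
  · refine lt_of_lt_of_le ?_ (measure_mono (s := Ioo 0 1) ?_)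
    · simp
    · intro p hp
      refine ⟨?_, hp.1⟩
      rw [Function.mem_support, powIncr_of_le hp.2.le]
      have h1 := Real.rpow_pos_of_pos hp.1 (β - 1)
      have h2 := Real.rpow_lt_one hp.1.le hp.2 hs
      exact mul_ne_zero (by linarith) (by linarith)
  · filter_upwards [ae_restrict_mem measurableSet_Ioi] with p hp
    rcases le_or_gt p 1 with h | h
    · rw [powIncr_of_le h]
      have h1 := Real.rpow_nonneg (le_of_lt hp) (β - 1)
      have h2 := Real.rpow_le_one (le_of_lt hp) h hs.le
      exact mul_nonneg_of_nonpos_of_nonpos (by linarith) (by linarith)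
    · exact mul_nonneg (powIncr_nonneg hβ1 h)
        (sub_nonneg.2 (Real.one_le_rpow h.le hs.le))

/-- Difference of a fractional integral of `q` and the fractional integral of a shift of `q`. -/
theorem fracIntegral_sub_shift {β σ M : ℝ} (hβ0 : 0 < β) (hβ1 : β < 1) (hσ : 0 < σ) {q : ℝ → ℝ}
    (hq : Measurable q) (hM : ∀ τ, 0 < τ → |q τ| ≤ M)
    (hint : IntegrableOn (fun τ => τ ^ (β - 1) * q τ) (Ioi 0)) :
    (∫ τ in Ioi 0, τ ^ (β - 1) * q τ) - ∫ τ in Ioi 0, τ ^ (β - 1) * q (τ + σ) =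
      -(σ ^ β * ∫ p in Ioi 0, powIncr β p * q (σ * p)) := by
  have e1 : ∫ τ in Ioi 0, τ ^ (β - 1) * q τ = σ ^ β * ∫ p in Ioi 0, p ^ (β - 1) * q (σ * p) := by
    have := integral_comp_mul_left_Ioi (fun τ => τ ^ (β - 1) * q τ) 0 hσ
    rw [mul_zero, smul_eq_mul] at this
    rw [← mul_right_inj' (inv_ne_zero hσ.ne'), ← this, ← integral_const_mul, ← integral_const_mul]
    refine setIntegral_congr_fun measurableSet_Ioi fun p hp => ?_
    rw [Real.mul_rpow hσ.le (le_of_lt hp), Real.rpow_sub_one hσ.ne']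
    ring
  have e2 : ∫ τ in Ioi 0, τ ^ (β - 1) * q (τ + σ) =
      σ ^ β * ∫ p in Ioi 0, (if 1 < p then (p - 1) ^ (β - 1) else 0) * q (σ * p) := by
    have h1 : ∫ p in Ioi 0, (if 1 < p then (p - 1) ^ (β - 1) else 0) * q (σ * p) =
        ∫ p in Ioi 1, (p - 1) ^ (β - 1) * q (σ * p) := by
      rw [← integral_indicator measurableSet_Ioi, ← integral_indicator measurableSet_Ioi]
      refine integral_congr_ae (ae_of_all _ fun p => ?_)
      simp only [indicator, mem_Ioi]
      split_ifs <;> first | rfl | (exfalso; linarith) | simp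
    have h2 : ∫ p in Ioi 1, (p - 1) ^ (β - 1) * q (σ * p) =
        ∫ r in Ioi 0, r ^ (β - 1) * q (σ * (r + 1)) := by
      rw [← integral_indicator measurableSet_Ioi, ← integral_indicator measurableSet_Ioi,
        ← integral_add_right_eq_self _ (1 : ℝ)]
      refine integral_congr_ae (ae_of_all _ fun p => ?_)
      simp [indicator]
    have := integral_comp_mul_left_Ioi (fun τ => τ ^ (β - 1) * q (τ + σ)) 0 hσ
    rw [mul_zero, smul_eq_mul] at this
    rw [h1, h2, ← mul_right_inj' (inv_ne_zero hσ.ne'), ← this, ← integral_const_mul,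
      ← integral_const_mul]
    refine setIntegral_congr_fun measurableSet_Ioi fun p hp => ?_
    rw [Real.mul_rpow hσ.le (le_of_lt hp), Real.rpow_sub_one hσ.ne', mul_add, mul_one]
    ring
  have i1 : IntegrableOn (fun p => p ^ (β - 1) * q (σ * p)) (Ioi 0) := by
    have := ((integrableOn_Ioi_comp_mul_left_iff (fun τ => τ ^ (β - 1) * q τ) 0 hσ).2
      (by simpa using hint)).const_mul (σ ^ (β - 1))⁻¹
    refine IntegrableOn.congr_fun this (fun p hp => ?_) measurableSet_Ioi
    rw [Real.mul_rpow hσ.le (le_of_lt hp)]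
    field_simp
  have i2 : IntegrableOn (fun p => powIncr β p * q (σ * p)) (Ioi 0) := by
    refine (integrableOn_powIncr hβ0 hβ1).mul_bdd (c := M)
      (hq.comp (measurable_const_mul σ)).aestronglyMeasurable ?_
    filter_upwards [ae_restrict_mem measurableSet_Ioi] with p hp
    exact hM _ (mul_pos hσ hp)
  have i3 : IntegrableOn (fun p => (if 1 < p then (p - 1) ^ (β - 1) else 0) * q (σ * p))
      (Ioi 0) := by
    refine (i2.add i1).congr_fun (fun p _ => ?_) measurableSet_Ioi
    simp only [Pi.add_apply, powIncr]
    ring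
  have e3 : ∫ p in Ioi 0, powIncr β p * q (σ * p) =
      (∫ p in Ioi 0, (if 1 < p then (p - 1) ^ (β - 1) else 0) * q (σ * p)) -
        ∫ p in Ioi 0, p ^ (β - 1) * q (σ * p) := by
    rw [← integral_sub i3 i1]
    refine integral_congr_ae (ae_of_all _ fun p => ?_)
    simp only [powIncr]; ring
  rw [e1, e2, e3]; ring

theorem truncated_fracDiff_eq {β s δ M c : ℝ} (hβ0 : 0 < β) (hs : 0 < s) (hsβ : β + s < 1)
    (hδ : 0 < δ) {q : ℝ → ℝ} (hq : Measurable q) (hM : ∀ τ, 0 < τ → |q τ| ≤ M)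
    (hint : IntegrableOn (fun τ => τ ^ (β - 1) * q τ) (Ioi 0)) :
    ∫ σ in Ioi δ, σ ^ (-1 - (β + s)) *
        ((∫ τ in Ioi 0, τ ^ (β - 1) * q τ) - ∫ τ in Ioi 0, τ ^ (β - 1) * q (τ + σ)) =
      ∫ p in Ioi 0, powIncr β p * p ^ s * ∫ τ in Ioi (δ * p), τ ^ (-1 - s) * (c - q τ) := by
  have hβ1 : β < 1 := by linarith
  have hI := integrableOn_powIncr hβ0 hβ1
  have e1 : ∀ σ ∈ Ioi δ, σ ^ (-1 - (β + s)) *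
        ((∫ τ in Ioi 0, τ ^ (β - 1) * q τ) - ∫ τ in Ioi 0, τ ^ (β - 1) * q (τ + σ)) =
      ∫ p in Ioi 0, powIncr β p * (σ ^ (-1 - s) * (c - q (σ * p))) := by
    intro σ hσ
    have hσ0 : 0 < σ := hδ.trans hσ
    have i2 : IntegrableOn (fun p => powIncr β p * q (σ * p)) (Ioi 0) := by
      refine hI.mul_bdd (c := M) (hq.comp (measurable_const_mul σ)).aestronglyMeasurable ?_
      filter_upwards [ae_restrict_mem measurableSet_Ioi] with p hp
      exact hM _ (mul_pos hσ0 hp)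
    rw [fracIntegral_sub_shift hβ0 hβ1 hσ0 hq hM hint]
    have e2 : ∫ p in Ioi 0, powIncr β p * (σ ^ (-1 - s) * (c - q (σ * p))) =
        σ ^ (-1 - s) * (c * (∫ p in Ioi 0, powIncr β p) -
          ∫ p in Ioi 0, powIncr β p * q (σ * p)) := by
      rw [← integral_const_mul, ← integral_sub (hI.const_mul c) i2, ← integral_const_mul]
      refine integral_congr_ae (ae_of_all _ fun p => ?_)
      simp only; ring
    rw [e2, integral_powIncr hβ0 hβ1, show -1 - s = -1 - (β + s) + β by ring, Real.rpow_add hσ0]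
    ring
  rw [setIntegral_congr_fun measurableSet_Ioi e1, integral_integral_swap]
  · refine setIntegral_congr_fun measurableSet_Ioi fun p hp => ?_
    have hp0 : 0 < p := hp
    rw [integral_const_mul, mul_assoc]
    congr 1
    have := integral_comp_mul_left_Ioi (fun τ => τ ^ (-1 - s) * (c - q τ)) δ hp0
    rw [mul_comm δ p, ← mul_right_inj' (inv_ne_zero hp0.ne'), mul_left_comm p⁻¹ (p ^ s),
      ← smul_eq_mul p⁻¹ (∫ τ in Ioi (p * δ), _), ← this, ← integral_const_mul,
      ← integral_const_mul]
    refine setIntegral_congr_fun measurableSet_Ioi fun σ hσ => ?_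
    have hσ0 : 0 < σ := hδ.trans hσ
    rw [Real.mul_rpow hp0.le hσ0.le, sub_eq_add_neg (-1) s, Real.rpow_add hp0, Real.rpow_neg_one,
      Real.rpow_neg hp0.le, mul_comm p σ]
    field_simp
  · have h1 : Integrable (fun z : ℝ × ℝ => z.1 ^ (-1 - s) * powIncr β z.2)
        ((volume.restrict (Ioi δ)).prod (volume.restrict (Ioi 0))) :=
      (integrableOn_Ioi_rpow_of_lt (by linarith) hδ).mul_prod hI
    have h2 := h1.mul_bdd (g := fun z : ℝ × ℝ => c - q (z.1 * z.2)) (c := |c| + M)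
      (measurable_const.sub (hq.comp (measurable_fst.mul measurable_snd))).aestronglyMeasurable (by
        rw [Measure.prod_restrict]
        filter_upwards [ae_restrict_mem (measurableSet_Ioi.prod measurableSet_Ioi)] with z hz
        exact (abs_sub _ _).trans (add_le_add_right
          (hM _ (mul_pos (hδ.trans hz.1) hz.2)) _))
    refine h2.congr (ae_of_all _ fun z => ?_)
    simp only [Function.uncurry]
    ring

theorem tendsto_truncated_fracDiff {β s M B c L : ℝ} (hβ0 : 0 < β) (hs : 0 < s) (hsβ : β + s < 1)
    {q : ℝ → ℝ} (hq : Measurable q) (hM : ∀ τ, 0 < τ → |q τ| ≤ M)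
    (hint : IntegrableOn (fun τ => τ ^ (β - 1) * q τ) (Ioi 0))
    (hB : ∀ r, 0 < r → |∫ τ in Ioi r, τ ^ (-1 - s) * (c - q τ)| ≤ B)
    (hL : Tendsto (fun r => ∫ τ in Ioi r, τ ^ (-1 - s) * (c - q τ)) (𝓝[>] 0) (𝓝 L)) :
    Tendsto (fun δ => ∫ σ in Ioi δ, σ ^ (-1 - (β + s)) *
        ((∫ τ in Ioi 0, τ ^ (β - 1) * q τ) - ∫ τ in Ioi 0, τ ^ (β - 1) * q (τ + σ)))
      (𝓝[>] 0) (𝓝 ((∫ p in Ioi 0, powIncr β p * p ^ s) * L)) := by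
  have hi := integrableOn_powIncr_mul_rpow hβ0 (by linarith) (r := s) (by linarith) (by linarith)
  have hcongr : (fun δ => ∫ p in Ioi 0, powIncr β p * p ^ s *
        ∫ τ in Ioi (δ * p), τ ^ (-1 - s) * (c - q τ)) =ᶠ[𝓝[>] 0]
      (fun δ => ∫ σ in Ioi δ, σ ^ (-1 - (β + s)) *
        ((∫ τ in Ioi 0, τ ^ (β - 1) * q τ) - ∫ τ in Ioi 0, τ ^ (β - 1) * q (τ + σ))) := by
    filter_upwards [self_mem_nhdsWithin] with δ hδ
    exact (truncated_fracDiff_eq hβ0 hs hsβ hδ hq hM hint).symm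
  refine Tendsto.congr' hcongr ?_
  rw [← integral_mul_const]
  have hmeas : Measurable fun r => ∫ τ in Ioi r, τ ^ (-1 - s) * (c - q τ) := by
    have : StronglyMeasurable (fun z : ℝ × ℝ =>
        (Ioi z.1).indicator (fun τ => τ ^ (-1 - s) * (c - q τ)) z.2) := by
      apply Measurable.stronglyMeasurable
      exact Measurable.ite (measurableSet_lt measurable_fst measurable_snd)
        (by fun_prop) measurable_const
    have h2 := (this.integral_prod_right' (ν := volume)).measurable
    simpa only [integral_indicator measurableSet_Ioi] using h2
  refine tendsto_integral_filter_of_dominated_convergence (fun p => |powIncr β p * p ^ s| * B)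
    ?_ ?_ (hi.abs.mul_const B) ?_
  · exact Eventually.of_forall fun δ => (((measurable_powIncr β).mul (by fun_prop)).mul
      (hmeas.comp (measurable_const.mul measurable_id))).aestronglyMeasurable
  · filter_upwards [self_mem_nhdsWithin] with δ hδ
    filter_upwards [ae_restrict_mem measurableSet_Ioi] with p hp
    rw [norm_mul]
    exact mul_le_mul_of_nonneg_left (hB _ (mul_pos hδ hp)) (norm_nonneg _)
  · filter_upwards [ae_restrict_mem measurableSet_Ioi] with p hp
    refine tendsto_const_nhds.mul (hL.comp ?_)
    refine tendsto_nhdsWithin_iff.2 ⟨?_, ?_⟩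
    · have : Tendsto (fun δ : ℝ => δ * p) (𝓝 0) (𝓝 (0 * p)) := tendsto_id.mul_const p
      rw [zero_mul] at this
      exact this.mono_left nhdsWithin_le_nhds
    · filter_upwards [self_mem_nhdsWithin] with δ hδ using mul_pos (mem_Ioi.1 hδ) (mem_Ioi.1 hp)


/-- The density `(x^α - (x - 1)₊^α) / (α x)`. -/
def powMass (α x : ℝ) : ℝ := (x ^ α - (max (x - 1) 0) ^ α) / (α * x)

theorem measurable_powMass (α : ℝ) : Measurable (powMass α) := by
  unfold powMass; fun_prop

theorem powMass_eq {α x : ℝ} (hα0 : 0 < α) (hα1 : α < 1) (hx : 0 < x) :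
    powMass α x = -(∫ p in Ioc 0 x, powIncr α p) * x⁻¹ := by
  rcases le_or_gt x 1 with h | h
  · rw [integral_powIncr_of_le hα0 hx.le h, powMass, max_eq_right (by linarith),
      Real.zero_rpow hα0.ne']
    field_simp; ring
  · rw [integral_powIncr_of_lt hα0 hα1 h, powMass, max_eq_left (by linarith)]
    field_simp; ring

theorem powMass_nonneg {α x : ℝ} (hα0 : 0 < α) (hx : 0 < x) : 0 ≤ powMass α x := by
  refine div_nonneg (sub_nonneg.2 (Real.rpow_le_rpow (le_max_right _ _) ?_ hα0.le)) (by positivity)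
  exact max_le (by linarith) hx.le

theorem powMass_of_le {α x : ℝ} (hα0 : 0 < α) (hx : 0 < x) (h : x ≤ 1) :
    powMass α x = x ^ (α - 1) / α := by
  rw [powMass, max_eq_right (by linarith), Real.zero_rpow hα0.ne', Real.rpow_sub_one hx.ne']
  field_simp; ring

theorem powMass_le {α x : ℝ} (hα0 : 0 < α) (hα1 : α < 1) (h : 1 < x) :
    powMass α x ≤ x ^ (α - 2) / α := by
  have hx : 0 < x := by linarith
  rw [powMass, max_eq_left (by linarith), show α - 2 = α - 1 - 1 by ring,
    Real.rpow_sub_one hx.ne' (α - 1), div_div, mul_comm x α]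
  gcongr
  exact rpow_sub_rpow_sub_one_le hα1 h

theorem integrableOn_powMass {α : ℝ} (hα0 : 0 < α) (hα1 : α < 1) :
    IntegrableOn (powMass α) (Ioi 0) := by
  rw [← Ioc_union_Ioi_eq_Ioi zero_le_one]
  refine IntegrableOn.union ?_ ?_
  · refine IntegrableOn.congr_fun ((integrableOn_Ioc_rpow (r := α - 1) (by linarith)
      zero_le_one).div_const α) (fun x hx => (powMass_of_le hα0 hx.1 hx.2).symm) measurableSet_Ioc
  · refine ((integrableOn_Ioi_rpow_of_lt (a := α - 2) (by linarith) zero_lt_one).div_const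
      α).mono' (measurable_powMass α).aestronglyMeasurable ?_
    filter_upwards [ae_restrict_mem measurableSet_Ioi] with x hx
    rw [Real.norm_of_nonneg (powMass_nonneg hα0 (zero_lt_one.trans hx))]
    exact powMass_le hα0 hα1 hx

theorem integral_powMass_pos {α : ℝ} (hα0 : 0 < α) (hα1 : α < 1) :
    0 < ∫ x in Ioi 0, powMass α x := by
  rw [setIntegral_pos_iff_support_of_nonneg_ae _ (integrableOn_powMass hα0 hα1)]
  · refine lt_of_lt_of_le ?_ (measure_mono (s := Ioo 0 1) ?_)
    · simp
    · intro p hp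
      refine ⟨?_, hp.1⟩
      rw [Function.mem_support, powMass_of_le hα0 hp.1 hp.2.le]
      have h1 := Real.rpow_pos_of_pos hp.1 (α - 1)
      positivity
  · filter_upwards [ae_restrict_mem measurableSet_Ioi] with p hp
    exact powMass_nonneg hα0 hp

theorem truncated_fracDiff_eq_powMass {α κ δ M C : ℝ} (hα1 : α < 1) (hκ : 0 < κ) (hκα : κ < α)
    (hδ : 0 < δ) {q : ℝ → ℝ} (hq : Measurable q) (hM : ∀ τ, 0 < τ → |q τ| ≤ M)
    (hC : ∀ τ, 0 < τ → |q τ| ≤ C * τ ^ (-κ))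
    (hint : IntegrableOn (fun τ => τ ^ (α - 1) * q τ) (Ioi 0)) :
    ∫ σ in Ioi δ, σ ^ (-1 - α) *
        ((∫ τ in Ioi 0, τ ^ (α - 1) * q τ) - ∫ τ in Ioi 0, τ ^ (α - 1) * q (τ + σ)) =
      ∫ x in Ioi 0, powMass α x * q (δ * x) := by
  have hα0 : 0 < α := hκ.trans hκα
  have hI := integrableOn_powIncr_mul_rpow hα0 hα1 (r := -κ) (by linarith) (by linarith)
  have e1 : ∀ σ ∈ Ioi δ, σ ^ (-1 - α) *
        ((∫ τ in Ioi 0, τ ^ (α - 1) * q τ) - ∫ τ in Ioi 0, τ ^ (α - 1) * q (τ + σ)) =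
      ∫ p in Ioi 0, -powIncr α p * (σ⁻¹ * q (σ * p)) := by
    intro σ hσ
    have hσ0 : 0 < σ := hδ.trans hσ
    rw [fracIntegral_sub_shift hα0 hα1 hσ0 hq hM hint, mul_neg, ← mul_assoc,
      ← Real.rpow_add hσ0, sub_add_cancel, Real.rpow_neg_one, ← integral_const_mul, ← integral_neg]
    refine integral_congr_ae (ae_of_all _ fun p => ?_)
    simp only; ring
  rw [setIntegral_congr_fun measurableSet_Ioi e1, integral_integral_swap]
  · have e2 : ∀ p ∈ Ioi (0 : ℝ), ∫ σ in Ioi δ, -powIncr α p * (σ⁻¹ * q (σ * p)) =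
        ∫ x in Ioi 0, (Ioi p).indicator (fun x => -powIncr α p * (x⁻¹ * q (δ * x))) x := by
      intro p hp
      have hp0 : 0 < p := hp
      have e3 : (Ioi p).indicator (fun x => -powIncr α p * (x⁻¹ * q (δ * x))) =
          (Ioi 0).indicator
            ((Ioi p).indicator (fun x => -powIncr α p * (x⁻¹ * q (δ * x)))) := by
        rw [indicator_indicator, inter_eq_right.2 (Ioi_subset_Ioi hp0.le)]
      rw [← integral_indicator measurableSet_Ioi (f := (Ioi p).indicator _), ← e3,
        integral_indicator measurableSet_Ioi, integral_const_mul, integral_const_mul]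
      congr 1
      have h1 := integral_comp_mul_left_Ioi (fun τ => τ⁻¹ * q τ) δ hp0
      have h2 := integral_comp_mul_left_Ioi (fun τ => τ⁻¹ * q τ) p hδ
      rw [smul_eq_mul] at h1 h2
      have h3 : p * ∫ σ in Ioi δ, (p * σ)⁻¹ * q (p * σ) =
          δ * ∫ x in Ioi p, (δ * x)⁻¹ * q (δ * x) := by
        rw [h1, h2, mul_inv_cancel_left₀ hp0.ne', mul_inv_cancel_left₀ hδ.ne', mul_comm]
      rw [← integral_const_mul, ← integral_const_mul] at h3
      have h4 : ∀ a b : ℝ, 0 < a → a * ((a * b)⁻¹ * q (a * b)) = b⁻¹ * q (a * b) := by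
        intro a b ha
        rw [mul_inv, mul_assoc, mul_inv_cancel_left₀ ha.ne']
      simp_rw [h4 p _ hp0, h4 δ _ hδ] at h3
      simpa only [mul_comm] using h3
    rw [setIntegral_congr_fun measurableSet_Ioi e2, integral_integral_swap]
    · refine setIntegral_congr_fun measurableSet_Ioi fun x hx => ?_
      have hx0 : 0 < x := hx
      rw [powMass_eq hα0 hα1 hx0, ← integral_neg, ← integral_mul_const, ← integral_mul_const]
      have e3 : ∀ p, (Ioi p).indicator (fun x => -powIncr α p * (x⁻¹ * q (δ * x))) x =
          (Iio x).indicator (fun p => -powIncr α p * (x⁻¹ * q (δ * x))) p := by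
        intro p; simp [indicator]
      simp_rw [e3]
      rw [setIntegral_indicator measurableSet_Iio, Ioi_inter_Iio,
        ← integral_Ioc_eq_integral_Ioo]
      refine integral_congr_ae (ae_of_all _ fun p => ?_)
      simp only; ring
    · have hmeas : Measurable (Function.uncurry fun p x =>
          (Ioi p).indicator (fun x => -powIncr α p * (x⁻¹ * q (δ * x))) x) :=
        Measurable.ite (measurableSet_lt measurable_fst measurable_snd)
          (((measurable_powIncr α).comp measurable_fst).neg.mul
            (measurable_snd.inv.mul (hq.comp (measurable_snd.const_mul δ)))) measurable_const
      have hbd : ∀ p x, 0 < p → ‖(Ioi p).indicator (fun x => -powIncr α p * (x⁻¹ * q (δ * x))) x‖ ≤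
          (Ioi p).indicator (fun x => |powIncr α p| * (C * δ ^ (-κ)) * x ^ (-1 - κ)) x := by
        intro p x hp
        simp only [indicator, mem_Ioi]
        split_ifs with h
        · have hx : 0 < x := hp.trans h
          rw [norm_mul, norm_neg, Real.norm_eq_abs, norm_mul, norm_inv, Real.norm_of_nonneg hx.le,
            mul_assoc]
          refine mul_le_mul_of_nonneg_left ?_ (abs_nonneg _)
          refine (mul_le_mul_of_nonneg_left (hC _ (mul_pos hδ hx)) (inv_nonneg.2 hx.le)).trans
            (le_of_eq ?_)
          rw [Real.mul_rpow hδ.le hx.le, sub_eq_add_neg (-1) κ, Real.rpow_add hx,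
            Real.rpow_neg_one]
          ring
        · simp
      have hib : ∀ p, 0 < p → IntegrableOn (fun x => (Ioi p).indicator
          (fun x => |powIncr α p| * (C * δ ^ (-κ)) * x ^ (-1 - κ)) x) (Ioi 0) := by
        intro p hp
        rw [integrableOn_indicator_iff measurableSet_Ioi]
        have h5 : IntegrableOn (fun x => |powIncr α p| * (C * δ ^ (-κ)) * x ^ (-1 - κ)) (Ioi p) :=
          (integrableOn_Ioi_rpow_of_lt (a := -1 - κ) (by linarith) hp).const_mul _
        exact h5.mono_set inter_subset_left
      have hi : ∀ p, 0 < p → IntegrableOn (fun x => (Ioi p).indicator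
          (fun x => -powIncr α p * (x⁻¹ * q (δ * x))) x) (Ioi 0) := by
        intro p hp
        exact (hib p hp).mono' (hmeas.comp measurable_prodMk_left).aestronglyMeasurable
          (ae_of_all _ fun x => hbd p x hp)
      rw [integrable_prod_iff hmeas.aestronglyMeasurable]
      refine ⟨?_, ?_⟩
      · filter_upwards [ae_restrict_mem measurableSet_Ioi] with p hp using hi p hp
      · refine (hI.abs.mul_const (C * δ ^ (-κ) / κ)).mono'
          hmeas.norm.stronglyMeasurable.integral_prod_right'.aestronglyMeasurable ?_
        filter_upwards [ae_restrict_mem measurableSet_Ioi] with p hp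
        have hp0 : 0 < p := hp
        rw [Real.norm_of_nonneg (integral_nonneg fun _ => norm_nonneg _)]
        refine (integral_mono (hi p hp).norm (hib p hp) fun x => hbd p x hp).trans (le_of_eq ?_)
        rw [setIntegral_indicator measurableSet_Ioi, inter_eq_right.2 (Ioi_subset_Ioi hp0.le),
          integral_const_mul, integral_Ioi_rpow_of_lt (by linarith) hp0, abs_mul,
          abs_of_nonneg (Real.rpow_nonneg hp0.le (-κ)), show -1 - κ + 1 = -κ by ring]
        field_simp
  · have h1 : Integrable (fun z : ℝ × ℝ => z.1 ^ (-1 - κ) * (powIncr α z.2 * z.2 ^ (-κ)))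
        ((volume.restrict (Ioi δ)).prod (volume.restrict (Ioi 0))) :=
      (integrableOn_Ioi_rpow_of_lt (by linarith) hδ).mul_prod hI
    refine (h1.norm.mul_const C).mono' ?_ ?_
    · exact (((measurable_powIncr α).comp measurable_snd).neg.mul (measurable_fst.inv.mul
        (hq.comp (measurable_fst.mul measurable_snd)))).aestronglyMeasurable
    · rw [Measure.prod_restrict]
      filter_upwards [ae_restrict_mem (measurableSet_Ioi.prod measurableSet_Ioi)] with z hz
      have h1 : 0 < z.1 := hδ.trans hz.1
      have h2 : 0 < z.2 := hz.2
      simp only [Function.uncurry, norm_mul, norm_neg, norm_inv]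
      rw [Real.norm_of_nonneg h1.le, Real.norm_of_nonneg (Real.rpow_nonneg h1.le _),
        Real.norm_of_nonneg (Real.rpow_nonneg h2.le _)]
      have h3 := hC _ (mul_pos h1 h2)
      rw [Real.mul_rpow h1.le h2.le] at h3
      calc ‖powIncr α z.2‖ * (z.1⁻¹ * ‖q (z.1 * z.2)‖)
          ≤ ‖powIncr α z.2‖ * (z.1⁻¹ * (C * (z.1 ^ (-κ) * z.2 ^ (-κ)))) := by
            gcongr; exact h3
        _ = _ := by
          rw [sub_eq_add_neg (-1) κ, Real.rpow_add h1, Real.rpow_neg_one]; ring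

theorem eventually_truncated_fracDiff_le {α κ M C c : ℝ} (hα1 : α < 1) (hκ : 0 < κ) (hκα : κ < α)
    {q : ℝ → ℝ} (hq : Measurable q) (hM : ∀ τ, 0 < τ → |q τ| ≤ M)
    (hC : ∀ τ, 0 < τ → |q τ| ≤ C * τ ^ (-κ))
    (hint : IntegrableOn (fun τ => τ ^ (α - 1) * q τ) (Ioi 0))
    (hc : ∀ e, 0 < e → ∀ᶠ τ in 𝓝[>] 0, q τ ≤ c + e) {e : ℝ} (he : 0 < e) :
    ∀ᶠ δ in 𝓝[>] 0, ∫ σ in Ioi δ, σ ^ (-1 - α) *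
        ((∫ τ in Ioi 0, τ ^ (α - 1) * q τ) - ∫ τ in Ioi 0, τ ^ (α - 1) * q (τ + σ)) ≤
      (∫ x in Ioi 0, powMass α x) * c + e := by
  have hα0 : 0 < α := hκ.trans hκα
  have hP := integrableOn_powMass hα0 hα1
  have hbound : ∀ δ, 0 < δ → ∀ x, 0 < x → |max (q (δ * x) - c) 0| ≤ M + |c| := by
    intro δ hδ x hx
    have h1 := abs_le.1 (hM _ (mul_pos hδ hx))
    have h2 := neg_abs_le c
    rw [abs_of_nonneg (le_max_right _ _)]
    exact max_le (by linarith) (by linarith [abs_nonneg c])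
  have hmeas : ∀ δ, Measurable fun x => max (q (δ * x) - c) 0 := fun δ =>
    ((hq.comp (measurable_const_mul δ)).sub_const c).max measurable_const
  have hlim : Tendsto (fun δ => ∫ x in Ioi 0, powMass α x * max (q (δ * x) - c) 0)
      (𝓝[>] 0) (𝓝 (∫ x in Ioi (0 : ℝ), powMass α x * 0)) := by
    refine tendsto_integral_filter_of_dominated_convergence (fun x => |powMass α x| * (M + |c|))
      (Eventually.of_forall fun δ => ((measurable_powMass α).mul (hmeas δ)).aestronglyMeasurable)
      ?_ (hP.abs.mul_const _) ?_
    · filter_upwards [self_mem_nhdsWithin] with δ hδ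
      filter_upwards [ae_restrict_mem measurableSet_Ioi] with x hx
      rw [norm_mul]
      exact mul_le_mul_of_nonneg_left (hbound δ hδ x hx) (norm_nonneg _)
    · filter_upwards [ae_restrict_mem measurableSet_Ioi] with x hx
      refine tendsto_const_nhds.mul ?_
      have hx0 : 0 < x := hx
      have ht : Tendsto (fun δ : ℝ => δ * x) (𝓝[>] 0) (𝓝[>] 0) := by
        refine tendsto_nhdsWithin_iff.2 ⟨?_, ?_⟩
        · have : Tendsto (fun δ : ℝ => δ * x) (𝓝 0) (𝓝 (0 * x)) := tendsto_id.mul_const x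
          rw [zero_mul] at this
          exact this.mono_left nhdsWithin_le_nhds
        · filter_upwards [self_mem_nhdsWithin] with δ hδ using mul_pos (mem_Ioi.1 hδ) hx0
      rw [Metric.tendsto_nhds]
      intro e he
      filter_upwards [ht.eventually (hc (e / 2) (by linarith))] with δ h
      rw [dist_zero_right, Real.norm_of_nonneg (le_max_right _ _)]
      exact max_lt (by linarith) he
  simp only [mul_zero, integral_zero] at hlim
  filter_upwards [hlim.eventually (gt_mem_nhds he), self_mem_nhdsWithin] with δ h hδ
  rw [truncated_fracDiff_eq_powMass hα1 hκ hκα hδ hq hM hC hint]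
  have i1 : IntegrableOn (fun x => powMass α x * max (q (δ * x) - c) 0) (Ioi 0) := by
    refine hP.mul_bdd (c := M + |c|) (hmeas δ).aestronglyMeasurable ?_
    filter_upwards [ae_restrict_mem measurableSet_Ioi] with x hx using hbound δ hδ x hx
  have i2 : IntegrableOn (fun x => powMass α x * q (δ * x)) (Ioi 0) := by
    refine hP.mul_bdd (c := M) (hq.comp (measurable_const_mul δ)).aestronglyMeasurable ?_
    filter_upwards [ae_restrict_mem measurableSet_Ioi] with x hx
    exact hM _ (mul_pos (mem_Ioi.1 hδ) hx)
  have : ∫ x in Ioi 0, powMass α x * q (δ * x) ≤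
      ∫ x in Ioi 0, (powMass α x * c + powMass α x * max (q (δ * x) - c) 0) := by
    refine setIntegral_mono_on i2 ((hP.mul_const c).add i1) measurableSet_Ioi fun x hx => ?_
    rw [← mul_add]
    exact mul_le_mul_of_nonneg_left (by linarith [le_max_left (q (δ * x) - c) 0])
      (powMass_nonneg hα0 hx)
  rw [integral_add (hP.mul_const c) i1, integral_mul_const] at this
  linarith

end

noncomputable section

open MeasureTheory Filter Topology Set Module

set_option linter.unusedSectionVars false

variable {E : Type*} [NormedAddCommGroup E] [InnerProductSpace ℝ E] [FiniteDimensional ℝ E]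
  [MeasurableSpace E] [BorelSpace E]

/-- The weight `σ^(-1-s) g_σ(e)` for a unit vector `e`, where `g` is the heat kernel. -/
def heatWeight (E : Type*) [NormedAddCommGroup E] [InnerProductSpace ℝ E] (s σ : ℝ) : ℝ :=
  σ ^ (-1 - s) * ((4 * Real.pi * σ) ^ (-(finrank ℝ E : ℝ) / 2) * Real.exp (-(1 / (4 * σ))))

theorem heatWeight_pos {s σ : ℝ} (hσ : 0 < σ) : 0 < heatWeight E s σ := by
  unfold heatWeight; positivity

theorem measurable_heatWeight (s : ℝ) : Measurable (heatWeight E s) := by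
  unfold heatWeight; fun_prop

theorem integrableOn_heatWeight {s : ℝ} (hs : 0 < s) (hs1 : s < 1) :
    IntegrableOn (heatWeight E s) (Ioi 0) := by
  set d := finrank ℝ E with hd
  have hc : ∀ σ : ℝ, 0 < σ → heatWeight E s σ =
      (4 * Real.pi) ^ (-(d : ℝ) / 2) * (σ ^ (-1 - s + -(d : ℝ) / 2) * Real.exp (-(1 / (4 * σ)))) := by
    intro σ hσ
    rw [heatWeight, Real.mul_rpow (by positivity) hσ.le, Real.rpow_add hσ]
    ring
  rw [← Ioc_union_Ioi_eq_Ioi zero_le_one]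
  refine IntegrableOn.union ?_ ?_
  · refine Measure.integrableOn_of_bounded (M := (4 * Real.pi) ^ (-(d : ℝ) / 2) *
      (4 ^ (d + 2) * (d + 2).factorial)) (by simp) (measurable_heatWeight s).aestronglyMeasurable ?_
    filter_upwards [ae_restrict_mem measurableSet_Ioc] with σ hσ
    have hσ0 := hσ.1
    rw [Real.norm_of_nonneg (heatWeight_pos hσ0).le, hc σ hσ0]
    refine mul_le_mul_of_nonneg_left ?_ (by positivity)
    have h1 := Real.pow_div_factorial_le_exp (1 / (4 * σ)) (by positivity) (d + 2)
    have h2 : Real.exp (-(1 / (4 * σ))) ≤ (4 * σ) ^ (d + 2) * (d + 2).factorial := by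
      rw [Real.exp_neg, inv_le_comm₀ (Real.exp_pos _) (by positivity)]
      refine le_trans (le_of_eq ?_) h1
      rw [mul_inv, one_div, inv_pow, div_eq_mul_inv]
    have h3 : σ ^ (-1 - s + -(d : ℝ) / 2) * σ ^ (d + 2) ≤ 1 := by
      rw [← Real.rpow_natCast, ← Real.rpow_add hσ0]
      refine Real.rpow_le_one hσ0.le hσ.2 ?_
      push_cast
      have : (0 : ℝ) ≤ d := by positivity
      linarith
    calc _ ≤ σ ^ (-1 - s + -(d : ℝ) / 2) * ((4 * σ) ^ (d + 2) * (d + 2).factorial) := by gcongr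
      _ = (σ ^ (-1 - s + -(d : ℝ) / 2) * σ ^ (d + 2)) * (4 ^ (d + 2) * (d + 2).factorial) := by
        rw [mul_pow]; ring
      _ ≤ 1 * _ := by gcongr
      _ = _ := one_mul _
  · have hd0 : (0 : ℝ) ≤ d := by positivity
    refine ((integrableOn_Ioi_rpow_of_lt (a := -1 - s + -(d : ℝ) / 2) (by linarith)
      zero_lt_one).const_mul ((4 * Real.pi) ^ (-(d : ℝ) / 2))).mono'
      (measurable_heatWeight s).aestronglyMeasurable ?_
    filter_upwards [ae_restrict_mem measurableSet_Ioi] with σ hσ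
    have hσ0 : 0 < σ := zero_lt_one.trans hσ
    rw [Real.norm_of_nonneg (heatWeight_pos hσ0).le, hc σ hσ0]
    refine mul_le_mul_of_nonneg_left (mul_le_of_le_one_right (by positivity) ?_) (by positivity)
    rw [Real.exp_le_one_iff]
    have : 0 < 1 / (4 * σ) := by positivity
    linarith

theorem integral_heatWeight_pos {s : ℝ} (hs : 0 < s) (hs1 : s < 1) :
    0 < ∫ σ in Ioi 0, heatWeight E s σ := by
  rw [setIntegral_pos_iff_support_of_nonneg_ae _ (integrableOn_heatWeight hs hs1)]
  · refine lt_of_lt_of_le ?_ (measure_mono (s := Ioi 0) ?_)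
    · simp
    · exact fun p hp => ⟨(heatWeight_pos hp).ne', hp⟩
  · filter_upwards [ae_restrict_mem measurableSet_Ioi] with p hp using (heatWeight_pos hp).le

theorem integral_rpow_mul_heatKernel (s : ℝ) (δ : ℝ) {z : E} (hz : z ≠ 0) :
    ∫ τ in Ioi δ, τ ^ (-1 - s) * heatKernel E τ z =
      (∫ σ in Ioi (δ / ‖z‖ ^ 2), (‖z‖ ^ 2 * σ) ^ (-1 - s) * heatKernel E (‖z‖ ^ 2 * σ) z) *
        ‖z‖ ^ 2 := by
  have hz0 : 0 < ‖z‖ ^ 2 := by positivity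
  have := integral_comp_mul_left_Ioi (fun τ => τ ^ (-1 - s) * heatKernel E τ z) (δ / ‖z‖ ^ 2) hz0
  rw [mul_div_cancel₀ _ hz0.ne', smul_eq_mul] at this
  rw [this]; field_simp

theorem integral_Ioi_rpow_mul_heatKernel {s δ : ℝ} (hδ : 0 ≤ δ) {z : E} (hz : z ≠ 0) :
    ∫ τ in Ioi δ, τ ^ (-1 - s) * heatKernel E τ z =
      (∫ σ in Ioi (δ / ‖z‖ ^ 2), heatWeight E s σ) / ‖z‖ ^ ((finrank ℝ E : ℝ) + 2 * s) := by
  have hz0 : 0 < ‖z‖ := by positivity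
  rw [integral_rpow_mul_heatKernel s δ hz, ← integral_mul_const, ← integral_div]
  refine setIntegral_congr_fun measurableSet_Ioi fun σ hσ => ?_
  have hσ0 : 0 < σ := lt_of_le_of_lt (by positivity) hσ
  simp only [heatKernel, heatWeight]
  rw [Real.mul_rpow (by positivity) hσ0.le, show 4 * Real.pi * (‖z‖ ^ 2 * σ) =
    ‖z‖ ^ 2 * (4 * Real.pi * σ) by ring, Real.mul_rpow (by positivity) (by positivity)]
  have h1 : (‖z‖ ^ 2) ^ (-1 - s) * (‖z‖ ^ 2) ^ (-(finrank ℝ E : ℝ) / 2) * ‖z‖ ^ 2 =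
      (‖z‖ ^ ((finrank ℝ E : ℝ) + 2 * s))⁻¹ := by
    rw [← Real.rpow_natCast, ← Real.rpow_mul hz0.le, ← Real.rpow_mul hz0.le,
      ← Real.rpow_add hz0, ← Real.rpow_add hz0, ← Real.rpow_neg hz0.le]
    congr 1; push_cast; ring
  have h2 : -(1 / (4 * (‖z‖ ^ 2 * σ))) * ‖z‖ ^ 2 = -(1 / (4 * σ)) := by field_simp
  rw [h2, div_eq_mul_inv _ (‖z‖ ^ (_ : ℝ)), ← h1]
  ring

theorem integrableOn_rpow_mul_heatKernel {s : ℝ} (hs : 0 < s) (hs1 : s < 1) {z : E} (hz : z ≠ 0) :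
    IntegrableOn (fun τ => τ ^ (-1 - s) * heatKernel E τ z) (Ioi 0) := by
  by_contra h
  have h1 := integral_Ioi_rpow_mul_heatKernel (s := s) le_rfl hz
  rw [integral_undef h, zero_div] at h1
  have h2 : 0 < ‖z‖ ^ ((finrank ℝ E : ℝ) + 2 * s) := by positivity
  exact (div_pos (integral_heatWeight_pos (E := E) hs hs1) h2).ne h1

/-- The kernel of the fractional Laplacian is integrable away from the origin. -/
theorem integrableOn_inv_norm_rpow [Nontrivial E] {s ε : ℝ} (hs : 0 < s) (hε : 0 < ε) :
    IntegrableOn (fun z : E => 1 / ‖z‖ ^ ((finrank ℝ E : ℝ) + 2 * s)) (Metric.ball 0 ε)ᶜ := by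
  rw [← integrable_indicator_iff Metric.isOpen_ball.measurableSet.compl]
  have h := (integrable_fun_norm_addHaar (E := E) volume
    (f := (Ici ε).indicator fun r => 1 / r ^ ((finrank ℝ E : ℝ) + 2 * s))).2 ?_
  · refine h.congr (ae_of_all _ fun z => ?_)
    simp [indicator]
  · have : IntegrableOn (fun r : ℝ => r ^ (-1 - 2 * s)) (Ici ε) :=
      (integrableOn_Ioi_rpow_of_lt (a := -1 - 2 * s) (by linarith) (half_pos hε)).mono_set
        (fun r hr => by simp only [mem_Ici, mem_Ioi] at *; linarith)
    rw [← integrable_indicator_iff measurableSet_Ici] at this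
    refine this.integrableOn.congr_fun (fun r hr => ?_) measurableSet_Ioi
    have hr0 : 0 < r := hr
    simp only [indicator, smul_eq_mul]
    split_ifs
    · have h1 : 1 ≤ finrank ℝ E := finrank_pos
      rw [one_div, ← Real.rpow_neg hr0.le, ← Real.rpow_natCast, ← Real.rpow_add hr0, Nat.cast_sub h1]
      congr 1; push_cast; ring
    · simp

theorem integrable_rpow_mul_heatKernel_mul {s δ M : ℝ} (hs : 0 < s) (hδ : 0 < δ) {w : E → ℝ}
    (hw : Measurable w) (hM : ∀ x, |w x| ≤ M) (x : E) :
    Integrable (fun p : ℝ × E => p.1 ^ (-1 - s) * heatKernel E p.1 (x - p.2) * w p.2)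
      ((volume.restrict (Ioi δ)).prod volume) := by
  have hM0 : 0 ≤ M := (abs_nonneg _).trans (hM 0)
  have hm : Measurable fun p : ℝ × E => p.1 ^ (-1 - s) * heatKernel E p.1 (x - p.2) :=
    (by fun_prop : Measurable fun p : ℝ × E => p.1 ^ (-1 - s)).mul
      (measurable_heatKernel.comp (measurable_fst.prodMk (measurable_const.sub measurable_snd)))
  refine Integrable.mul_bdd (c := M) ?_ (hw.comp measurable_snd).aestronglyMeasurable
    (ae_of_all _ fun p => hM _)
  rw [integrable_prod_iff hm.aestronglyMeasurable]
  refine ⟨?_, ?_⟩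
  · filter_upwards [ae_restrict_mem measurableSet_Ioi] with τ hτ
    exact ((integrable_heatKernel (hδ.trans hτ)).comp_sub_left x).const_mul _
  · refine IntegrableOn.congr_fun (integrableOn_Ioi_rpow_of_lt (a := -1 - s) (by linarith) hδ)
      (fun τ hτ => ?_) measurableSet_Ioi
    have hτ0 : 0 < τ := hδ.trans hτ
    simp only [norm_mul]
    rw [integral_const_mul, Real.norm_of_nonneg (by positivity)]
    simp_rw [Real.norm_of_nonneg (heatKernel_pos hτ0 _).le]
    rw [integral_heatKernel_sub hτ0, mul_one]

/-- A truncated heat-semigroup representation of the fractional Laplacian as an average of the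
principal value truncations. -/
theorem integral_sub_heat_eq [Nontrivial E] {s δ M c : ℝ} (hs : 0 < s) (hs1 : s < 1) (hδ : 0 < δ)
    {w : E → ℝ} (hw : Measurable w) (hM : ∀ x, |w x| ≤ M) (x : E) :
    Integrable (fun σ => heatWeight E s σ * ∫ y in (Metric.ball x (√(δ / σ)))ᶜ,
        (c - w y) / ‖x - y‖ ^ ((finrank ℝ E : ℝ) + 2 * s)) (volume.restrict (Ioi 0)) ∧
    ∫ τ in Ioi δ, τ ^ (-1 - s) * (c - heat τ w x) =
      ∫ σ in Ioi 0, heatWeight E s σ * ∫ y in (Metric.ball x (√(δ / σ)))ᶜ,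
        (c - w y) / ‖x - y‖ ^ ((finrank ℝ E : ℝ) + 2 * s) := by
  have hW := integrableOn_heatWeight (E := E) hs hs1
  have hcM : ∀ y, |c - w y| ≤ |c| + M := fun y => (abs_sub _ _).trans (by gcongr; exact hM y)
  have hcw : Measurable fun y => c - w y := measurable_const.sub hw
  have h1 := integrable_rpow_mul_heatKernel_mul hs hδ hcw hcM x
  have e1 : ∫ τ in Ioi δ, τ ^ (-1 - s) * (c - heat τ w x) =
      ∫ τ in Ioi δ, ∫ y, τ ^ (-1 - s) * heatKernel E τ (x - y) * (c - w y) := by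
    refine setIntegral_congr_fun measurableSet_Ioi fun τ hτ => ?_
    have hτ0 : 0 < τ := hδ.trans hτ
    simp only [mul_assoc]
    rw [integral_const_mul]
    congr 1
    simp only [mul_sub]
    rw [integral_sub (((integrable_heatKernel hτ0).comp_sub_left x).mul_const c)
      (integrable_heatKernel_mul hτ0 hw.aestronglyMeasurable hM x), integral_mul_const,
      integral_heatKernel_sub hτ0, one_mul, heat]
  have hae : ∀ᵐ y : E, x - y ≠ 0 := by
    have : ∀ᵐ y : E, y ≠ x := by simp [ae_iff]
    filter_upwards [this] with y hy using sub_ne_zero.2 hy.symm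
  set F : E → ℝ → ℝ := fun y σ => {σ | δ ≤ σ * ‖x - y‖ ^ 2}.indicator
    (fun σ => heatWeight E s σ * ((c - w y) / ‖x - y‖ ^ ((finrank ℝ E : ℝ) + 2 * s))) σ with hF
  have hFm : Measurable (Function.uncurry F) := by
    have hms : MeasurableSet {p : E × ℝ | δ ≤ p.2 * ‖x - p.1‖ ^ 2} :=
      measurableSet_le measurable_const (by fun_prop)
    refine Measurable.ite hms ?_ measurable_const
    exact ((measurable_heatWeight s).comp measurable_snd).mul
      ((hcw.comp measurable_fst).div
        (by fun_prop : Measurable fun p : E × ℝ => ‖x - p.1‖ ^ ((finrank ℝ E : ℝ) + 2 * s)))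
  have hset : ∀ y, x - y ≠ 0 → {σ : ℝ | δ ≤ σ * ‖x - y‖ ^ 2} = Ici (δ / ‖x - y‖ ^ 2) := by
    intro y hy
    ext σ
    have : 0 < ‖x - y‖ ^ 2 := by positivity
    simp only [mem_ofPred_eq, mem_Ici]
    rw [div_le_iff₀ this]
  have hG : ∀ y, x - y ≠ 0 → ∀ G : ℝ → ℝ, ∫ σ in Ioi (0 : ℝ), (Ici (δ / ‖x - y‖ ^ 2)).indicator G σ =
      ∫ σ in Ioi (δ / ‖x - y‖ ^ 2), G σ := by
    intro y hy G
    have h0 : 0 < ‖x - y‖ ^ 2 := by positivity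
    have h1 : Ici (δ / ‖x - y‖ ^ 2) ⊆ Ioi 0 := fun σ hσ => lt_of_lt_of_le (div_pos hδ h0) hσ
    rw [setIntegral_indicator measurableSet_Ici, inter_eq_right.2 h1, integral_Ici_eq_integral_Ioi]
  have e2 : ∀ y, x - y ≠ 0 → ∀ a : ℝ, ∫ τ in Ioi δ, τ ^ (-1 - s) * heatKernel E τ (x - y) * a =
      ∫ σ in Ioi 0, {σ | δ ≤ σ * ‖x - y‖ ^ 2}.indicator
        (fun σ => heatWeight E s σ * (a / ‖x - y‖ ^ ((finrank ℝ E : ℝ) + 2 * s))) σ := by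
    intro y hy a
    rw [hset y hy, hG y hy, integral_mul_const, integral_mul_const,
      integral_Ioi_rpow_mul_heatKernel hδ.le hy]
    ring
  have hFi : Integrable (Function.uncurry F) (volume.prod (volume.restrict (Ioi 0))) := by
    rw [integrable_prod_iff hFm.aestronglyMeasurable]
    refine ⟨?_, ?_⟩
    · filter_upwards [hae] with y hy
      have hms : MeasurableSet {σ | δ ≤ σ * ‖x - y‖ ^ 2} := by
        rw [hset y hy]; exact measurableSet_Ici
      have h3 := hW.mul_const ((c - w y) / ‖x - y‖ ^ ((finrank ℝ E : ℝ) + 2 * s))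
      exact h3.indicator hms
    · have h2 := h1.integral_norm_prod_right
      refine h2.congr ?_
      filter_upwards [hae] with y hy
      have e3 : ∀ τ ∈ Ioi δ, ‖τ ^ (-1 - s) * heatKernel E τ (x - y) * (c - w y)‖ =
          τ ^ (-1 - s) * heatKernel E τ (x - y) * |c - w y| := by
        intro τ hτ
        have hτ0 : 0 < τ := hδ.trans hτ
        rw [norm_mul, Real.norm_of_nonneg (mul_nonneg (by positivity) (heatKernel_pos hτ0 _).le),
          Real.norm_eq_abs]
      rw [setIntegral_congr_fun measurableSet_Ioi e3, e2 y hy]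
      refine setIntegral_congr_fun measurableSet_Ioi fun σ hσ => ?_
      simp only [Function.uncurry, hF, norm_indicator_eq_indicator_norm, norm_mul, norm_div,
        Real.norm_eq_abs]
      simp only [indicator, abs_of_pos (heatWeight_pos (E := E) (s := s) hσ),
        abs_of_nonneg (Real.rpow_nonneg (norm_nonneg (x - y)) _)]
  have e4 : ∀ σ ∈ Ioi (0 : ℝ), ∫ y, F y σ = heatWeight E s σ *
      ∫ y in (Metric.ball x (√(δ / σ)))ᶜ, (c - w y) / ‖x - y‖ ^ ((finrank ℝ E : ℝ) + 2 * s) := by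
    intro σ hσ
    have hσ0 : 0 < σ := hσ
    rw [← integral_const_mul, ← integral_indicator Metric.isOpen_ball.measurableSet.compl]
    refine integral_congr_ae (ae_of_all _ fun y => ?_)
    have : δ ≤ σ * ‖x - y‖ ^ 2 ↔ √(δ / σ) ≤ ‖x - y‖ := by
      rw [Real.sqrt_le_left (norm_nonneg _), div_le_iff₀' hσ0]
    simp only [hF, indicator, mem_ofPred_eq, this, mem_compl_iff, Metric.mem_ball, not_lt,
      dist_comm y x, dist_eq_norm]
  refine ⟨hFi.integral_prod_right.congr ?_, ?_⟩
  · filter_upwards [ae_restrict_mem measurableSet_Ioi] with σ hσ using e4 σ hσ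
  · rw [e1, integral_integral_swap h1, ← setIntegral_congr_fun measurableSet_Ioi e4,
      ← integral_integral_swap hFi]
    refine integral_congr_ae ?_
    filter_upwards [hae] with y hy using e2 y hy _


theorem norm_setIntegral_div_rpow_le {s M c ε : ℝ} {w : E → ℝ} (hM : ∀ x, |w x| ≤ M) (x : E)
    {ε₀ : ℝ} (hε₀ : ε₀ ≤ ε)
    (hi : IntegrableOn (fun z : E => 1 / ‖z‖ ^ ((finrank ℝ E : ℝ) + 2 * s)) (Metric.ball 0 ε₀)ᶜ) :
    |∫ y in (Metric.ball x ε)ᶜ, (c - w y) / ‖x - y‖ ^ ((finrank ℝ E : ℝ) + 2 * s)| ≤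
      (|c| + M) * ∫ z in (Metric.ball (0 : E) ε₀)ᶜ, 1 / ‖z‖ ^ ((finrank ℝ E : ℝ) + 2 * s) := by
  have hms : MeasurableSet (Metric.ball (0 : E) ε₀)ᶜ := Metric.isOpen_ball.measurableSet.compl
  rw [← integral_indicator hms, ← integral_sub_left_eq_self _ volume x, ← integral_const_mul,
    ← integral_indicator Metric.isOpen_ball.measurableSet.compl, ← Real.norm_eq_abs]
  refine norm_integral_le_of_norm_le
    ((((integrable_indicator_iff hms).2 hi).comp_sub_left x).const_mul _) (ae_of_all _ fun y => ?_)
  have hc : |c - w y| ≤ |c| + M := (abs_sub _ _).trans (by gcongr; exact hM y)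
  have hp : 0 ≤ ‖x - y‖ ^ ((finrank ℝ E : ℝ) + 2 * s) := by positivity
  have h0 : 0 ≤ |c| + M := (abs_nonneg _).trans hc
  simp only [indicator, mem_compl_iff, Metric.mem_ball, not_lt, dist_comm y x,
    dist_eq_norm, sub_zero]
  split_ifs with h1 h2 h2
  · rw [norm_div, Real.norm_eq_abs, Real.norm_of_nonneg hp, mul_one_div]
    gcongr
  · exact absurd (hε₀.trans h1) h2
  · rw [norm_zero]; positivity
  · simp

/-- If the principal value integrals converge then so do the truncated heat-semigroup integrals. -/
theorem tendsto_integral_sub_heat [Nontrivial E] {s M c L : ℝ} (hs : 0 < s) (hs1 : s < 1)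
    {w : E → ℝ} (hw : Measurable w) (hM : ∀ x, |w x| ≤ M) (x : E)
    (hL : Tendsto (fun ε => ∫ y in (Metric.ball x ε)ᶜ,
      (c - w y) / ‖x - y‖ ^ ((finrank ℝ E : ℝ) + 2 * s)) (𝓝[>] 0) (𝓝 L)) :
    (∃ B, ∀ r, 0 < r → |∫ τ in Ioi r, τ ^ (-1 - s) * (c - heat τ w x)| ≤ B) ∧
    Tendsto (fun r => ∫ τ in Ioi r, τ ^ (-1 - s) * (c - heat τ w x)) (𝓝[>] 0)
      (𝓝 ((∫ σ in Ioi 0, heatWeight E s σ) * L)) := by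
  set m : ℝ → ℝ := fun ε => ∫ y in (Metric.ball x ε)ᶜ,
      (c - w y) / ‖x - y‖ ^ ((finrank ℝ E : ℝ) + 2 * s) with hm
  have hW := integrableOn_heatWeight (E := E) hs hs1
  obtain ⟨B, hB⟩ : ∃ B, ∀ ε, 0 < ε → |m ε| ≤ B := by
    have h1 : ∀ᶠ ε in 𝓝[>] 0, |m ε| < |L| + 1 := hL.abs.eventually (gt_mem_nhds (by linarith))
    obtain ⟨ε₀, hε₀, h2⟩ := mem_nhdsGT_iff_exists_Ioo_subset.1 h1
    have hε₀' : 0 < ε₀ := hε₀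
    refine ⟨max (|L| + 1) ((|c| + M) * ∫ z in (Metric.ball (0 : E) ε₀)ᶜ,
      1 / ‖z‖ ^ ((finrank ℝ E : ℝ) + 2 * s)), fun ε hε => ?_⟩
    rcases lt_or_ge ε ε₀ with h | h
    · exact le_max_of_le_left (le_of_lt (h2 ⟨hε, h⟩))
    · exact le_max_of_le_right (norm_setIntegral_div_rpow_le hM x h
        (integrableOn_inv_norm_rpow hs hε₀'))
  have hbd : ∀ r, 0 < r → ∀ σ ∈ Ioi (0 : ℝ), ‖heatWeight E s σ * m (√(r / σ))‖ ≤
      heatWeight E s σ * B := by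
    intro r hr σ hσ
    have hσ0 : 0 < σ := hσ
    rw [norm_mul, Real.norm_of_nonneg (heatWeight_pos hσ0).le]
    exact mul_le_mul_of_nonneg_left (hB _ (Real.sqrt_pos.2 (div_pos hr hσ0)))
      (heatWeight_pos hσ0).le
  refine ⟨⟨∫ σ in Ioi 0, heatWeight E s σ * B, fun r hr => ?_⟩, ?_⟩
  · rw [(integral_sub_heat_eq hs hs1 hr hw hM x).2]
    refine norm_integral_le_of_norm_le (f := fun σ => heatWeight E s σ * m (√(r / σ)))
      (hW.mul_const B) ?_
    filter_upwards [ae_restrict_mem measurableSet_Ioi] with σ hσ using hbd r hr σ hσ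
  · rw [← integral_mul_const]
    have hcongr : (fun r => ∫ σ in Ioi 0, heatWeight E s σ * m (√(r / σ))) =ᶠ[𝓝[>] 0]
        (fun r => ∫ τ in Ioi r, τ ^ (-1 - s) * (c - heat τ w x)) := by
      filter_upwards [self_mem_nhdsWithin] with r hr
      exact (integral_sub_heat_eq hs hs1 hr hw hM x).2.symm
    refine Tendsto.congr' hcongr ?_
    refine tendsto_integral_filter_of_dominated_convergence (fun σ => heatWeight E s σ * B) ?_ ?_
      (hW.mul_const B) ?_
    · filter_upwards [self_mem_nhdsWithin] with r hr
      exact (integral_sub_heat_eq hs hs1 hr hw hM x).1.aestronglyMeasurable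
    · filter_upwards [self_mem_nhdsWithin] with r hr
      filter_upwards [ae_restrict_mem measurableSet_Ioi] with σ hσ using hbd r hr σ hσ
    · filter_upwards [ae_restrict_mem measurableSet_Ioi] with σ hσ
      have hσ0 : 0 < σ := hσ
      refine tendsto_const_nhds.mul (hL.comp (tendsto_nhdsWithin_iff.2 ⟨?_, ?_⟩))
      · have : Tendsto (fun r : ℝ => √(r / σ)) (𝓝 0) (𝓝 (√(0 / σ))) :=
          (Real.continuous_sqrt.comp (continuous_id.div_const σ)).tendsto 0
        rw [zero_div, Real.sqrt_zero] at this
        exact this.mono_left nhdsWithin_le_nhds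
      · filter_upwards [self_mem_nhdsWithin] with r hr
        exact Real.sqrt_pos.2 (div_pos hr hσ0)

end

noncomputable section

open MeasureTheory Filter Topology Set Module

set_option linter.unusedSectionVars false

variable {E : Type*} [NormedAddCommGroup E] [InnerProductSpace ℝ E] [FiniteDimensional ℝ E]
  [MeasurableSpace E] [BorelSpace E]

/-- Dominating function for fractional integrals of functions bounded by `M` and `C / τ`. -/
def fracBound (β M C τ : ℝ) : ℝ := if τ ≤ 1 then M * τ ^ (β - 1) else C * τ ^ (β - 2)

theorem integrableOn_fracBound {β : ℝ} (hβ0 : 0 < β) (hβ1 : β < 1) (M C : ℝ) :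
    IntegrableOn (fracBound β M C) (Ioi 0) := by
  rw [← Ioc_union_Ioi_eq_Ioi zero_le_one]
  refine IntegrableOn.union ?_ ?_
  · refine IntegrableOn.congr_fun ((integrableOn_Ioc_rpow (r := β - 1) (by linarith)
      zero_le_one).const_mul M) (fun x hx => ?_) measurableSet_Ioc
    simp [fracBound, hx.2]
  · refine IntegrableOn.congr_fun ((integrableOn_Ioi_rpow_of_lt (a := β - 2) (by linarith)
      zero_lt_one).const_mul C) (fun x hx => ?_) measurableSet_Ioi
    simp [fracBound, not_le.2 (mem_Ioi.1 hx)]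

theorem abs_rpow_mul_le_fracBound {β M C τ a : ℝ} (hτ : 0 < τ) (hM : |a| ≤ M)
    (hC : |a| ≤ C * τ ^ (-1 : ℝ)) : |τ ^ (β - 1) * a| ≤ fracBound β M C τ := by
  rw [abs_mul, abs_of_pos (Real.rpow_pos_of_pos hτ _), fracBound]
  split_ifs
  · rw [mul_comm]; gcongr
  · calc τ ^ (β - 1) * |a| ≤ τ ^ (β - 1) * (C * τ ^ (-1 : ℝ)) := by gcongr
      _ = C * (τ ^ (β - 1) * τ ^ (-1 : ℝ)) := by ring
      _ = _ := by rw [← Real.rpow_add hτ]; ring_nf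

theorem integrableOn_rpow_mul {β M C : ℝ} (hβ0 : 0 < β) (hβ1 : β < 1) {q : ℝ → ℝ}
    (hq : Measurable q) (hM : ∀ τ, 0 < τ → |q τ| ≤ M)
    (hC : ∀ τ, 0 < τ → |q τ| ≤ C * τ ^ (-1 : ℝ)) :
    IntegrableOn (fun τ => τ ^ (β - 1) * q τ) (Ioi 0) := by
  refine (integrableOn_fracBound hβ0 hβ1 M C).mono'
    (by fun_prop : Measurable fun τ => τ ^ (β - 1) * q τ).aestronglyMeasurable ?_
  filter_upwards [ae_restrict_mem measurableSet_Ioi] with τ hτ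
  exact abs_rpow_mul_le_fracBound hτ (hM τ hτ) (hC τ hτ)

/-- Heat decay constant of a bounded integrable function. -/
def heatDecay (M : ℝ) (w : E → ℝ) : ℝ :=
  M + (4 * Real.pi) ^ (-(finrank ℝ E : ℝ) / 2) * ∫ y, |w y|

theorem abs_heat_le_rpow {κ M : ℝ} (hκ0 : 0 ≤ κ) (hκ : κ ≤ (finrank ℝ E : ℝ) / 2) {w : E → ℝ}
    (hw : Integrable w) (hM : ∀ x, |w x| ≤ M) {τ : ℝ} (hτ : 0 < τ) (x : E) :
    |heat τ w x| ≤ heatDecay M w * τ ^ (-κ) := by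
  have hM0 : 0 ≤ M := (abs_nonneg _).trans (hM 0)
  have hI : 0 ≤ ∫ y, |w y| := integral_nonneg fun _ => abs_nonneg _
  have hc : 0 ≤ (4 * Real.pi) ^ (-(finrank ℝ E : ℝ) / 2) * ∫ y, |w y| := by positivity
  rw [heatDecay]
  rcases le_or_gt τ 1 with h | h
  · have h1 : 1 ≤ τ ^ (-κ) := Real.one_le_rpow_of_pos_of_le_one_of_nonpos hτ h (by linarith)
    calc |heat τ w x| ≤ M := abs_heat_le hτ hM x
      _ ≤ M + (4 * Real.pi) ^ (-(finrank ℝ E : ℝ) / 2) * ∫ y, |w y| := by linarith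
      _ ≤ _ := le_mul_of_one_le_right (by linarith) h1
  · have h1 : τ ^ (-(finrank ℝ E : ℝ) / 2) ≤ τ ^ (-κ) :=
      Real.rpow_le_rpow_of_exponent_le h.le (by linarith)
    calc |heat τ w x| ≤ (4 * Real.pi * τ) ^ (-(finrank ℝ E : ℝ) / 2) * ∫ y, |w y| :=
          abs_heat_le_of_integrable hτ hw x
      _ = ((4 * Real.pi) ^ (-(finrank ℝ E : ℝ) / 2) * ∫ y, |w y|) *
          τ ^ (-(finrank ℝ E : ℝ) / 2) := by
        rw [Real.mul_rpow (by positivity) hτ.le]; ring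
      _ ≤ (M + (4 * Real.pi) ^ (-(finrank ℝ E : ℝ) / 2) * ∫ y, |w y|) * τ ^ (-κ) := by
        gcongr; linarith

/-- The fractional integral `∫₀^∞ τ^(β-1) e^(τΔ) w dτ`. -/
def fracPot (β : ℝ) (w : E → ℝ) (x : E) : ℝ := ∫ τ in Ioi 0, τ ^ (β - 1) * heat τ w x

/-- A bounded integrable measurable function. -/
structure BddIntegrable (M : ℝ) (w : E → ℝ) : Prop where
  measurable : Measurable w
  integrable : Integrable w
  bound : ∀ x, |w x| ≤ M

variable {β M : ℝ} {w : E → ℝ}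

theorem BddIntegrable.heat_decay (h : BddIntegrable M w) (hE : 2 ≤ finrank ℝ E) {τ : ℝ}
    (hτ : 0 < τ) (x : E) : |heat τ w x| ≤ heatDecay M w * τ ^ (-1 : ℝ) := by
  have : (2 : ℝ) ≤ finrank ℝ E := by exact_mod_cast hE
  exact abs_heat_le_rpow zero_le_one (by linarith) h.integrable h.bound hτ x

theorem BddIntegrable.integrableOn (h : BddIntegrable M w) (hE : 2 ≤ finrank ℝ E)
    (hβ0 : 0 < β) (hβ1 : β < 1) (x : E) :
    IntegrableOn (fun τ => τ ^ (β - 1) * heat τ w x) (Ioi 0) :=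
  integrableOn_rpow_mul hβ0 hβ1 (measurable_heat_left h.measurable x)
    (fun _ hτ => abs_heat_le hτ h.bound x) (fun _ hτ => h.heat_decay hE hτ x)

theorem BddIntegrable.abs_fracPot_le (h : BddIntegrable M w) (hE : 2 ≤ finrank ℝ E)
    (hβ0 : 0 < β) (hβ1 : β < 1) (x : E) :
    |fracPot β w x| ≤ ∫ τ in Ioi 0, fracBound β M (heatDecay M w) τ := by
  refine norm_integral_le_of_norm_le (f := fun τ => τ ^ (β - 1) * heat τ w x)
    (integrableOn_fracBound hβ0 hβ1 M _) ?_
  filter_upwards [ae_restrict_mem measurableSet_Ioi] with τ hτ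
  exact abs_rpow_mul_le_fracBound hτ (abs_heat_le hτ h.bound x) (h.heat_decay hE hτ x)

theorem BddIntegrable.continuous_fracPot (h : BddIntegrable M w) (hE : 2 ≤ finrank ℝ E)
    (hβ0 : 0 < β) (hβ1 : β < 1) : Continuous (fracPot β w) := by
  refine continuous_of_dominated (bound := fracBound β M (heatDecay M w))
    (fun x => (h.integrableOn hE hβ0 hβ1 x).aestronglyMeasurable) (fun x => ?_)
    (integrableOn_fracBound hβ0 hβ1 M _) ?_
  · filter_upwards [ae_restrict_mem measurableSet_Ioi] with τ hτ
    exact abs_rpow_mul_le_fracBound hτ (abs_heat_le hτ h.bound x) (h.heat_decay hE hτ x)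
  · filter_upwards [ae_restrict_mem measurableSet_Ioi] with τ hτ
    exact continuous_const.mul (continuous_heat_of_integrable hτ h.integrable)

theorem BddIntegrable.integral_mul_fracPot (h : BddIntegrable M w) (hE : 2 ≤ finrank ℝ E)
    (hβ0 : 0 < β) (hβ1 : β < 1) {η : E → ℝ} (hη : Integrable η) :
    ∫ y, η y * fracPot β w y = ∫ τ in Ioi 0, τ ^ (β - 1) * ∫ y, η y * heat τ w y := by
  unfold fracPot
  simp_rw [← integral_const_mul]
  rw [integral_integral_swap]
  · refine integral_congr_ae (ae_of_all _ fun τ => integral_congr_ae (ae_of_all _ fun y => ?_))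
    simp only; ring
  · refine (hη.mul_prod (integrableOn_fracBound hβ0 hβ1 M (heatDecay M w))).norm.mono' ?_ ?_
    · refine hη.aestronglyMeasurable.comp_fst.mul (Measurable.aestronglyMeasurable ?_)
      exact (by fun_prop : Measurable fun p : E × ℝ => p.2 ^ (β - 1)).mul
        ((stronglyMeasurable_heat h.measurable).measurable.comp measurable_swap)
    · have : ∀ᵐ p : E × ℝ ∂(volume.prod (volume.restrict (Ioi 0))), 0 < p.2 :=
        Measure.quasiMeasurePreserving_snd.ae (ae_restrict_mem measurableSet_Ioi)
      filter_upwards [this] with p hp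
      simp only [Function.uncurry, norm_mul]
      refine mul_le_mul_of_nonneg_left ?_ (norm_nonneg _)
      rw [← norm_mul]
      exact (abs_rpow_mul_le_fracBound hp (abs_heat_le hp h.bound _)
        (h.heat_decay hE hp _)).trans (le_abs_self _)

theorem BddIntegrable.integral_mul_sub_heat_fracPot (h : BddIntegrable M w)
    (hE : 2 ≤ finrank ℝ E) (hβ0 : 0 < β) (hβ1 : β < 1) {η : E → ℝ} (hη : Integrable η) {σ : ℝ}
    (hσ : 0 < σ) :
    ∫ y, η y * heat σ (fracPot β w) y =
      ∫ τ in Ioi 0, τ ^ (β - 1) * ∫ y, η y * heat (τ + σ) w y := by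
  have hc := h.continuous_fracPot hE hβ0 hβ1
  rw [integral_mul_heat_comm hσ hη hc.aestronglyMeasurable (h.abs_fracPot_le hE hβ0 hβ1),
    h.integral_mul_fracPot hE hβ0 hβ1 (integrable_heat hσ hη)]
  refine setIntegral_congr_fun measurableSet_Ioi fun τ hτ => ?_
  have hτ0 : 0 < τ := hτ
  rw [← integral_mul_heat_comm hσ hη (measurable_heat h.measurable τ).aestronglyMeasurable
    (abs_heat_le hτ0 h.bound)]
  congr 1
  refine integral_congr_ae (ae_of_all _ fun y => ?_)
  simp only
  rw [heat_heat hσ hτ0 h.measurable.aestronglyMeasurable h.bound, add_comm]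

theorem BddIntegrable.heat_fracPot (h : BddIntegrable M w)
    (hE : 2 ≤ finrank ℝ E) (hβ0 : 0 < β) (hβ1 : β < 1) {σ : ℝ} (hσ : 0 < σ) (x : E) :
    heat σ (fracPot β w) x = ∫ τ in Ioi 0, τ ^ (β - 1) * heat (τ + σ) w x := by
  rw [heat, h.integral_mul_fracPot hE hβ0 hβ1 ((integrable_heatKernel hσ).comp_sub_left x)]
  refine setIntegral_congr_fun measurableSet_Ioi fun τ hτ => ?_
  have hτ0 : 0 < τ := hτ
  rw [add_comm, ← heat_heat hσ hτ0 h.measurable.aestronglyMeasurable h.bound, heat]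

theorem abs_integral_mul_heat_le {η : E → ℝ} (hη : Integrable η) {τ C : ℝ}
    (hC : ∀ x, |heat τ w x| ≤ C) : |∫ y, η y * heat τ w y| ≤ (∫ y, |η y|) * C := by
  rw [← integral_mul_const]
  refine norm_integral_le_of_norm_le (f := fun y => η y * heat τ w y) (hη.abs.mul_const _)
    (ae_of_all _ fun y => ?_)
  rw [norm_mul]
  exact mul_le_mul_of_nonneg_left (hC y) (norm_nonneg _)

theorem measurable_integral_mul_heat {η : E → ℝ} (hη : Measurable η) (hw : Measurable w) :
    Measurable fun τ => ∫ y, η y * heat τ w y := by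
  have : StronglyMeasurable fun p : ℝ × E => η p.2 * heat p.1 w p.2 :=
    (hη.comp measurable_snd).stronglyMeasurable.mul (stronglyMeasurable_heat hw)
  exact this.integral_prod_right'.measurable

theorem integrable_mul_heat {η : E → ℝ} (hη : Integrable η) (hw : Measurable w)
    (hM : ∀ x, |w x| ≤ M) {τ : ℝ} (hτ : 0 < τ) : Integrable fun y => η y * heat τ w y :=
  hη.mul_bdd (c := M) (measurable_heat hw τ).aestronglyMeasurable
    (ae_of_all _ (abs_heat_le hτ hM))

end

noncomputable section

open MeasureTheory Filter Topology Set Module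

set_option linter.unusedSectionVars false

variable {E : Type*} [NormedAddCommGroup E] [InnerProductSpace ℝ E] [FiniteDimensional ℝ E]
  [MeasurableSpace E] [BorelSpace E]

/-- The truncated operator `∫_δ^∞ σ^(-1-α) (φ - e^(σΔ) φ) dσ`. -/
def truncFrac (α δ : ℝ) (φ : E → ℝ) (x : E) : ℝ :=
  ∫ σ in Ioi δ, σ ^ (-1 - α) * (φ x - heat σ φ x)

/-- The inf-convolution of `H` with `‖·‖² / ε`. -/
def infConv (ε : ℝ) (H : E → ℝ) (x : E) : ℝ := ⨅ y, (H y + ‖x - y‖ ^ 2 / ε)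

variable {H : E → ℝ} {P ε : ℝ}

theorem bddBelow_infConv (hP : ∀ x, |H x| ≤ P) (hε : 0 < ε) (x : E) :
    BddBelow (range fun y => H y + ‖x - y‖ ^ 2 / ε) := by
  refine ⟨-P, ?_⟩
  rintro _ ⟨y, rfl⟩
  have h1 := (abs_le.1 (hP y)).1
  have h2 : 0 ≤ ‖x - y‖ ^ 2 / ε := by positivity
  simp only
  linarith

theorem infConv_le (hP : ∀ x, |H x| ≤ P) (hε : 0 < ε) (x y : E) :
    infConv ε H x ≤ H y + ‖x - y‖ ^ 2 / ε := ciInf_le (bddBelow_infConv hP hε x) y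

theorem infConv_le_self (hP : ∀ x, |H x| ≤ P) (hε : 0 < ε) (x : E) : infConv ε H x ≤ H x := by
  simpa using infConv_le hP hε x x

theorem abs_infConv_le (hP : ∀ x, |H x| ≤ P) (hε : 0 < ε) (x : E) : |infConv ε H x| ≤ P := by
  refine abs_le.2 ⟨le_ciInf fun y => ?_, (infConv_le_self hP hε x).trans (abs_le.1 (hP x)).2⟩
  have h1 := (abs_le.1 (hP y)).1
  have h2 : 0 ≤ ‖x - y‖ ^ 2 / ε := by positivity
  linarith

theorem exists_infConv_eq (hH : Continuous H) (hP : ∀ x, |H x| ≤ P) (hε : 0 < ε) (x : E) :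
    ∃ y, infConv ε H x = H y + ‖x - y‖ ^ 2 / ε ∧ ‖x - y‖ ^ 2 ≤ 2 * P * ε := by
  have hc : Continuous fun y => H y + ‖x - y‖ ^ 2 / ε := by fun_prop
  have ht : Tendsto (fun y => H y + ‖x - y‖ ^ 2 / ε) (cocompact E) atTop := by
    refine tendsto_atTop_add_left_of_le _ (-P) (fun y => (abs_le.1 (hP y)).1) ?_
    refine Tendsto.atTop_div_const hε ((tendsto_pow_atTop two_ne_zero).comp ?_)
    have := (tendsto_dist_right_cocompact_atTop x)
    refine this.congr fun y => ?_
    rw [dist_comm, dist_eq_norm]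
  obtain ⟨y, hy⟩ := hc.exists_forall_le ht
  have e : infConv ε H x = H y + ‖x - y‖ ^ 2 / ε :=
    le_antisymm (infConv_le hP hε x y) (le_ciInf hy)
  refine ⟨y, e, ?_⟩
  have h1 := infConv_le_self hP hε x
  have h2 := (abs_le.1 (hP x)).2
  have h3 := (abs_le.1 (hP y)).1
  rw [e] at h1
  rw [← div_le_iff₀ hε]
  linarith

theorem measurable_infConv (hP : ∀ x, |H x| ≤ P) (hε : 0 < ε) :
    Measurable (infConv ε H) := by
  refine UpperSemicontinuous.measurable ?_
  exact upperSemicontinuous_ciInf (fun x => bddBelow_infConv hP hε x)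
    fun y => Continuous.upperSemicontinuous (by fun_prop)

theorem tendsto_infConv (hH : Continuous H) (hP : ∀ x, |H x| ≤ P) (x : E) :
    Tendsto (fun ε => infConv ε H x) (𝓝[>] 0) (𝓝 (H x)) := by
  rw [Metric.tendsto_nhdsWithin_nhds]
  intro e he
  obtain ⟨r, hr, h⟩ := Metric.continuous_iff.1 hH x e he
  have hP0 : 0 ≤ P := (abs_nonneg _).trans (hP x)
  refine ⟨r ^ 2 / (2 * P + 1), by positivity, fun {ε} hε hd => ?_⟩
  have hε0 : 0 < ε := hε
  obtain ⟨y, hy, hyx⟩ := exists_infConv_eq hH hP hε0 x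
  rw [dist_zero_right, Real.norm_of_nonneg hε0.le, lt_div_iff₀ (by positivity)] at hd
  have h1 : dist y x < r := by
    rw [dist_comm, dist_eq_norm]
    refine lt_of_pow_lt_pow_left₀ 2 hr.le ?_
    nlinarith
  have h2 := h y h1
  rw [Real.dist_eq, abs_lt] at h2 ⊢
  have h3 := infConv_le_self hP hε0 x
  have h4 : 0 ≤ ‖x - y‖ ^ 2 / ε := by positivity
  constructor <;> linarith

theorem heat_infConv_le (hH : Continuous H) (hP : ∀ x, |H x| ≤ P) (hε : 0 < ε) {x y : E} {σ : ℝ}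
    (hσ : 0 < σ) : heat σ (infConv ε H) x ≤ heat σ H y + ‖x - y‖ ^ 2 / ε := by
  rw [heat_eq', heat_eq', ← mul_one (‖x - y‖ ^ 2 / ε), ← integral_heatKernel (E := E) hσ,
    mul_comm (‖x - y‖ ^ 2 / ε), ← integral_mul_const, ← integral_add
    (integrable_heatKernel_mul_add hσ hH.aestronglyMeasurable hP y)
    ((integrable_heatKernel hσ).mul_const _)]
  refine integral_mono (integrable_heatKernel_mul_add hσ
    (measurable_infConv hP hε).aestronglyMeasurable (abs_infConv_le hP hε) x)
    ((integrable_heatKernel_mul_add hσ hH.aestronglyMeasurable hP y).add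
    ((integrable_heatKernel hσ).mul_const _)) fun z => ?_
  simp only
  rw [← mul_add]
  refine mul_le_mul_of_nonneg_left ?_ (heatKernel_pos hσ z).le
  simpa using infConv_le hP hε (x + z) (y + z)

theorem sub_heat_infConv_ge (hH : Continuous H) (hP : ∀ x, |H x| ≤ P) (hε : 0 < ε) {x y : E}
    (hy : infConv ε H x = H y + ‖x - y‖ ^ 2 / ε) {σ : ℝ} (hσ : 0 < σ) :
    H y - heat σ H y ≤ infConv ε H x - heat σ (infConv ε H) x := by
  have := heat_infConv_le hH hP hε (x := x) (y := y) hσ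
  linarith

theorem heat_infConv_sub_le (hH : Continuous H) (hP : ∀ x, |H x| ≤ P) (hε : 0 < ε) (x : E) {σ : ℝ}
    (hσ : 0 < σ) : heat σ (infConv ε H) x - infConv ε H x ≤
      8 * 2 ^ ((finrank ℝ E : ℝ) / 2) * σ / ε := by
  obtain ⟨y, hy, -⟩ := exists_infConv_eq hH hP hε x
  have hm := (measurable_infConv hP hε).aestronglyMeasurable (μ := (volume : Measure E))
  have hb := abs_infConv_le hP hε
  have i1 := integrable_heatKernel_mul_add hσ hm hb x
  have i2 : Integrable fun z => heatKernel E σ z * infConv ε H (x - z) := by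
    simpa [heatKernel_neg, sub_eq_add_neg] using i1.comp_neg
  have i3 := (integrable_heatKernel (E := E) hσ).mul_const (infConv ε H x)
  have i4 := (integrable_sq_norm_mul_heatKernel (E := E) hσ).div_const ε
  have key : heat σ (infConv ε H) x + heat σ (infConv ε H) x ≤
      ∫ z, (2 * (heatKernel E σ z * infConv ε H x) + 2 * (‖z‖ ^ 2 * heatKernel E σ z / ε)) := by
    nth_rw 1 [heat_eq', heat_eq, ← integral_add i1 i2]
    refine integral_mono (i1.add i2) ((i3.const_mul 2).add (i4.const_mul 2)) fun z => ?_
    have h1 := infConv_le hP hε (x + z) y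
    have h2 := infConv_le hP hε (x - z) y
    have h3 : ‖x + z - y‖ ^ 2 / ε + ‖x - z - y‖ ^ 2 / ε =
        2 * (‖x - y‖ ^ 2 / ε) + 2 * (‖z‖ ^ 2 / ε) := by
      have := parallelogram_law_with_norm ℝ (x - y) z
      rw [show x + z - y = x - y + z by abel, show x - z - y = x - y - z by abel, ← add_div,
        this]
      ring
    have h4 : infConv ε H (x + z) + infConv ε H (x - z) ≤
        2 * infConv ε H x + 2 * (‖z‖ ^ 2 / ε) := by linarith
    have := mul_le_mul_of_nonneg_left h4 (heatKernel_pos hσ z).le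
    simp only
    calc _ = heatKernel E σ z * (infConv ε H (x + z) + infConv ε H (x - z)) := by ring
      _ ≤ _ := this
      _ = _ := by ring
  rw [integral_add (i3.const_mul 2) (i4.const_mul 2), integral_const_mul, integral_const_mul,
    integral_mul_const, integral_heatKernel hσ, integral_div] at key
  have h5 := integral_sq_norm_mul_heatKernel_le (E := E) hσ
  have h6 : (∫ z : E, ‖z‖ ^ 2 * heatKernel E σ z) / ε ≤
      8 * 2 ^ ((finrank ℝ E : ℝ) / 2) * σ / ε := by gcongr
  linarith

theorem integrableOn_rpow_mul_min {α : ℝ} (hα0 : 0 < α) (hα1 : α < 1) :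
    IntegrableOn (fun σ : ℝ => σ ^ (-1 - α) * min σ 1) (Ioi 0) := by
  rw [← Ioc_union_Ioi_eq_Ioi zero_le_one]
  refine IntegrableOn.union ?_ ?_
  · refine (integrableOn_Ioc_rpow (r := -α) (by linarith) zero_le_one).congr_fun (fun σ hσ => ?_)
      measurableSet_Ioc
    simp only
    rw [min_eq_left hσ.2, ← Real.rpow_add_one hσ.1.ne']
    congr 1; ring
  · refine (integrableOn_Ioi_rpow_of_lt (a := -1 - α) (by linarith) zero_lt_one).congr_fun
      (fun σ hσ => ?_) measurableSet_Ioi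
    simp [min_eq_right (le_of_lt (mem_Ioi.1 hσ))]

section Trunc

variable {α δ : ℝ} {φ : E → ℝ}

theorem measurable_sub_heat (hφ : Measurable φ) :
    Measurable fun p : E × ℝ => p.2 ^ (-1 - α) * (φ p.1 - heat p.2 φ p.1) :=
  (by fun_prop : Measurable fun p : E × ℝ => p.2 ^ (-1 - α)).mul
    ((hφ.comp measurable_fst).sub ((stronglyMeasurable_heat hφ).measurable.comp measurable_swap))

theorem abs_sub_heat_le (hP : ∀ x, |φ x| ≤ P) {σ : ℝ} (hσ : 0 < σ) (x : E) :
    |φ x - heat σ φ x| ≤ 2 * P :=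
  (abs_sub _ _).trans (by linarith [hP x, abs_heat_le hσ hP x])

theorem norm_rpow_mul_sub_heat_le (hP : ∀ x, |φ x| ≤ P) {σ : ℝ} (hσ : 0 < σ) (x : E) :
    ‖σ ^ (-1 - α) * (φ x - heat σ φ x)‖ ≤ σ ^ (-1 - α) * (2 * P) := by
  rw [norm_mul, Real.norm_of_nonneg (by positivity)]
  exact mul_le_mul_of_nonneg_left (abs_sub_heat_le hP hσ x) (by positivity)

theorem integrableOn_trunc (hα : 0 < α) (hδ : 0 < δ) (hφ : Measurable φ) (hP : ∀ x, |φ x| ≤ P)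
    (x : E) : IntegrableOn (fun σ => σ ^ (-1 - α) * (φ x - heat σ φ x)) (Ioi δ) := by
  refine ((integrableOn_Ioi_rpow_of_lt (a := -1 - α) (by linarith) hδ).mul_const (2 * P)).mono'
    ((measurable_sub_heat hφ).comp measurable_prodMk_left).aestronglyMeasurable ?_
  filter_upwards [ae_restrict_mem measurableSet_Ioi] with σ hσ
  exact norm_rpow_mul_sub_heat_le hP (hδ.trans hσ) x

theorem abs_truncFrac_le (hα : 0 < α) (hδ : 0 < δ) (hP : ∀ x, |φ x| ≤ P) (x : E) :
    |truncFrac α δ φ x| ≤ ∫ σ in Ioi δ, σ ^ (-1 - α) * (2 * P) := by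
  refine norm_integral_le_of_norm_le (f := fun σ => σ ^ (-1 - α) * (φ x - heat σ φ x))
    ((integrableOn_Ioi_rpow_of_lt (a := -1 - α) (by linarith) hδ).mul_const (2 * P)) ?_
  filter_upwards [ae_restrict_mem measurableSet_Ioi] with σ hσ
  exact norm_rpow_mul_sub_heat_le hP (hδ.trans hσ) x

theorem measurable_truncFrac (hφ : Measurable φ) : Measurable (truncFrac α δ φ) :=
  ((measurable_sub_heat (α := α) hφ).stronglyMeasurable.integral_prod_right'
    (ν := volume.restrict (Ioi δ))).measurable

theorem heat_sub {ψ : E → ℝ} {Q σ : ℝ} (hσ : 0 < σ) (hφ : Measurable φ) (hψ : Measurable ψ)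
    (hP : ∀ x, |φ x| ≤ P) (hQ : ∀ x, |ψ x| ≤ Q) (x : E) :
    heat σ (fun y => φ y - ψ y) x = heat σ φ x - heat σ ψ x := by
  unfold heat
  rw [← integral_sub (integrable_heatKernel_mul hσ hφ.aestronglyMeasurable hP x)
    (integrable_heatKernel_mul hσ hψ.aestronglyMeasurable hQ x)]
  simp_rw [mul_sub]

theorem truncFrac_sub {ψ : E → ℝ} {Q : ℝ} (hα : 0 < α) (hδ : 0 < δ) (hφ : Measurable φ)
    (hψ : Measurable ψ) (hP : ∀ x, |φ x| ≤ P) (hQ : ∀ x, |ψ x| ≤ Q) (x : E) :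
    truncFrac α δ (fun y => φ y - ψ y) x = truncFrac α δ φ x - truncFrac α δ ψ x := by
  unfold truncFrac
  rw [← integral_sub (integrableOn_trunc hα hδ hφ hP x) (integrableOn_trunc hα hδ hψ hQ x)]
  refine setIntegral_congr_fun measurableSet_Ioi fun σ hσ => ?_
  simp only
  rw [heat_sub (hδ.trans hσ) hφ hψ hP hQ]
  ring

theorem integral_mul_truncFrac (hα : 0 < α) (hδ : 0 < δ) (hφ : Measurable φ)
    (hP : ∀ x, |φ x| ≤ P) {η : E → ℝ} (hη : Integrable η) :
    ∫ x, η x * truncFrac α δ φ x =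
      ∫ σ in Ioi δ, σ ^ (-1 - α) * ∫ x, η x * (φ x - heat σ φ x) := by
  unfold truncFrac
  simp_rw [← integral_const_mul]
  rw [integral_integral_swap]
  · refine integral_congr_ae (ae_of_all _ fun τ => integral_congr_ae (ae_of_all _ fun y => ?_))
    simp only; ring
  · refine (hη.mul_prod ((integrableOn_Ioi_rpow_of_lt (a := -1 - α) (by linarith) hδ).mul_const
      (2 * P))).norm.mono' ?_ ?_
    · exact hη.aestronglyMeasurable.comp_fst.mul (measurable_sub_heat hφ).aestronglyMeasurable
    · have : ∀ᵐ p : E × ℝ ∂(volume.prod (volume.restrict (Ioi δ))), δ < p.2 :=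
        Measure.quasiMeasurePreserving_snd.ae (ae_restrict_mem measurableSet_Ioi)
      filter_upwards [this] with p hp
      simp only [Function.uncurry]
      rw [norm_mul, norm_mul (η p.1)]
      refine mul_le_mul_of_nonneg_left ?_ (norm_nonneg (η p.1))
      exact (norm_rpow_mul_sub_heat_le hP (hδ.trans hp) _).trans (le_abs_self _)

theorem truncFrac_infConv_ge (hα : 0 < α) (hδ : 0 < δ) (hH : Continuous H) (hP : ∀ x, |H x| ≤ P)
    (hε : 0 < ε) {x y : E} (hy : infConv ε H x = H y + ‖x - y‖ ^ 2 / ε) :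
    truncFrac α δ H y ≤ truncFrac α δ (infConv ε H) x := by
  refine setIntegral_mono_on (integrableOn_trunc hα hδ hH.measurable hP y)
    (integrableOn_trunc hα hδ (measurable_infConv hP hε) (abs_infConv_le hP hε) x)
    measurableSet_Ioi fun σ hσ => ?_
  have hσ0 : 0 < σ := hδ.trans hσ
  exact mul_le_mul_of_nonneg_left (sub_heat_infConv_ge hH hP hε hy hσ0) (by positivity)

theorem exists_truncFrac_infConv_ge (hα0 : 0 < α) (hα1 : α < 1) (hH : Continuous H)
    (hP : ∀ x, |H x| ≤ P) (hε : 0 < ε) :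
    ∃ C, ∀ δ, 0 < δ → ∀ x, -C ≤ truncFrac α δ (infConv ε H) x := by
  set K := max (8 * 2 ^ ((finrank ℝ E : ℝ) / 2) / ε) (2 * P) with hK
  have hK0 : 0 ≤ K := le_max_of_le_left (by positivity)
  have hI := (integrableOn_rpow_mul_min hα0 hα1).const_mul K
  refine ⟨∫ σ in Ioi 0, K * (σ ^ (-1 - α) * min σ 1), fun δ hδ x => ?_⟩
  have h1 : ∫ σ in Ioi δ, -(K * (σ ^ (-1 - α) * min σ 1)) ≤ truncFrac α δ (infConv ε H) x := by
    refine setIntegral_mono_on (IntegrableOn.mono_set hI (Ioi_subset_Ioi hδ.le)).neg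
      (integrableOn_trunc hα0 hδ (measurable_infConv hP hε) (abs_infConv_le hP hε) x)
      measurableSet_Ioi fun σ hσ => ?_
    have hσ0 : 0 < σ := hδ.trans hσ
    have h2 : -(K * min σ 1) ≤ infConv ε H x - heat σ (infConv ε H) x := by
      rcases le_total σ 1 with h | h
      · rw [min_eq_left h]
        have h3 := heat_infConv_sub_le hH hP hε x hσ0
        have h4 : 8 * 2 ^ ((finrank ℝ E : ℝ) / 2) * σ / ε ≤ K * σ := by
          rw [mul_div_right_comm]
          gcongr
          exact le_max_left _ _
        linarith
      · rw [min_eq_right h]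
        have h3 := (abs_le.1 (abs_sub_heat_le (abs_infConv_le hP hε) hσ0 x)).1
        have h4 : 2 * P ≤ K := le_max_right _ _
        linarith
    calc -(K * (σ ^ (-1 - α) * min σ 1)) = σ ^ (-1 - α) * (-(K * min σ 1)) := by ring
      _ ≤ _ := mul_le_mul_of_nonneg_left h2 (by positivity)
  refine le_trans ?_ h1
  rw [integral_neg]
  refine neg_le_neg (setIntegral_mono_set hI ?_ (Ioi_subset_Ioi hδ.le).eventuallyLE)
  filter_upwards [ae_restrict_mem measurableSet_Ioi] with σ hσ
  have hσ0 : 0 < σ := hσ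
  simp only [Pi.zero_apply]
  positivity

end Trunc

end

noncomputable section

open MeasureTheory Filter Topology Set Module

set_option linter.unusedSectionVars false

variable {E : Type*} [NormedAddCommGroup E] [InnerProductSpace ℝ E] [FiniteDimensional ℝ E]
  [MeasurableSpace E] [BorelSpace E]

/-- A bounded integrable function whose second differences are `O(‖z‖²)` in `L¹`. -/
structure HasL1SecondDiff (C : ℝ) (η : E → ℝ) : Prop where
  nonneg : 0 ≤ C
  integrable : Integrable η
  bdd : ∃ M, BddIntegrable M η
  secondDiff : ∀ z, ∫ x, |2 * η x - η (x + z) - η (x - z)| ≤ C * ‖z‖ ^ 2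

variable {C : ℝ} {η : E → ℝ}

theorem integrable_heatKernel_mul_translate {η : E → ℝ} (hη : Integrable η) (hm : Measurable η)
    {σ : ℝ} (hσ : 0 < σ) (c : ℝ) :
    Integrable (fun p : E × E => heatKernel E σ p.2 * η (p.1 + c • p.2))
      (volume.prod volume) := by
  have hmeas : Measurable fun p : E × E => heatKernel E σ p.2 * η (p.1 + c • p.2) :=
    ((continuous_heatKernel σ).measurable.comp measurable_snd).mul (hm.comp (by fun_prop))
  rw [integrable_prod_iff' hmeas.aestronglyMeasurable]
  refine ⟨ae_of_all _ fun z => (hη.comp_add_right (c • z)).const_mul (heatKernel E σ z), ?_⟩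
  refine ((integrable_heatKernel hσ).mul_const (∫ x, ‖η x‖)).congr (ae_of_all _ fun z => ?_)
  simp only [norm_mul]
  rw [integral_const_mul, integral_add_right_eq_self (fun x => ‖η x‖),
    Real.norm_of_nonneg (heatKernel_pos hσ z).le]

theorem HasL1SecondDiff.integral_abs_sub_heat_le (h : HasL1SecondDiff C η) {σ : ℝ} (hσ : 0 < σ) :
    ∫ x, |η x - heat σ η x| ≤ C * (8 * 2 ^ ((finrank ℝ E : ℝ) / 2)) * σ := by
  obtain ⟨M, hM⟩ := h.bdd
  have hC0 := h.nonneg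
  have i0 := integrable_heatKernel_mul_translate h.integrable hM.measurable hσ 0
  have i1 := integrable_heatKernel_mul_translate h.integrable hM.measurable hσ 1
  have i2 := integrable_heatKernel_mul_translate h.integrable hM.measurable hσ (-1)
  simp only [zero_smul, add_zero, one_smul, neg_smul, ← sub_eq_add_neg] at i0 i1 i2
  have i3 := ((i0.const_mul 2).sub i1).sub i2
  have hi : Integrable (fun p : E × E => heatKernel E σ p.2 *
      |2 * η p.1 - η (p.1 + p.2) - η (p.1 - p.2)|) (volume.prod volume) := by
    refine i3.abs.congr (ae_of_all _ fun p => ?_)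
    simp only [Pi.sub_apply]
    rw [← abs_of_pos (heatKernel_pos hσ p.2), ← abs_mul, abs_of_pos (heatKernel_pos hσ p.2)]
    congr 1; ring
  have e1 : ∀ x, 2 * |η x - heat σ η x| ≤
      ∫ z, heatKernel E σ z * |2 * η x - η (x + z) - η (x - z)| := by
    intro x
    have j1 := integrable_heatKernel_mul_add hσ hM.measurable.aestronglyMeasurable hM.bound x
    have j2 : Integrable fun z => heatKernel E σ z * η (x - z) := by
      simpa [heatKernel_neg, sub_eq_add_neg] using j1.comp_neg
    have j0 := (integrable_heatKernel (E := E) hσ).mul_const (2 * η x)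
    have e2 : 2 * (η x - heat σ η x) =
        ∫ z, heatKernel E σ z * (2 * η x - η (x + z) - η (x - z)) := by
      have k1 := integral_sub (j0.sub j1) j2
      have k2 := integral_sub j0 j1
      simp only [Pi.sub_apply] at k1 k2
      simp_rw [mul_sub _ _ (η (x - _)), mul_sub _ (2 * η x)]
      rw [k1, k2, integral_mul_const, integral_heatKernel hσ, ← heat_eq, ← heat_eq']
      ring
    rw [← abs_two, ← abs_mul, abs_two, e2]
    refine (abs_integral_le_integral_abs).trans (le_of_eq ?_)
    refine integral_congr_ae (ae_of_all _ fun z => ?_)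
    simp only
    rw [abs_mul, abs_of_pos (heatKernel_pos hσ z)]
  have hd : Integrable fun x => |η x - heat σ η x| :=
    (h.integrable.sub (integrable_heat hσ h.integrable)).abs
  have e3 : 2 * ∫ x, |η x - heat σ η x| ≤
      ∫ z, heatKernel E σ z * (C * ‖z‖ ^ 2) := by
    rw [← integral_const_mul]
    refine (integral_mono (hd.const_mul 2) hi.integral_prod_left e1).trans ?_
    rw [integral_integral_swap hi]
    refine integral_mono hi.integral_prod_right ?_ fun z => ?_
    · exact ((integrable_sq_norm_mul_heatKernel hσ).const_mul C).congr
        (ae_of_all _ fun z => by simp only; ring)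
    · simp only
      rw [integral_const_mul]
      exact mul_le_mul_of_nonneg_left (h.secondDiff z) (heatKernel_pos hσ z).le
  have e4 : ∫ z : E, heatKernel E σ z * (C * ‖z‖ ^ 2) =
      C * ∫ z : E, ‖z‖ ^ 2 * heatKernel E σ z := by
    rw [← integral_const_mul]
    refine integral_congr_ae (ae_of_all _ fun z => ?_)
    simp only; ring
  have e5 := mul_le_mul_of_nonneg_left (integral_sq_norm_mul_heatKernel_le (E := E) hσ) hC0
  have e6 : 0 ≤ ∫ x, |η x - heat σ η x| := integral_nonneg fun _ => abs_nonneg _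
  rw [e4] at e3
  linarith

theorem HasL1SecondDiff.exists_bound (h : HasL1SecondDiff C η) :
    ∃ K, ∀ σ, 0 < σ → ∫ x, |η x - heat σ η x| ≤ K * min σ 1 := by
  obtain ⟨M, hM⟩ := h.bdd
  have hη := h.integrable
  refine ⟨max (C * (8 * 2 ^ ((finrank ℝ E : ℝ) / 2))) (2 * ∫ x, |η x|), fun σ hσ => ?_⟩
  rcases le_total σ 1 with h1 | h1
  · rw [min_eq_left h1]
    refine (h.integral_abs_sub_heat_le hσ).trans ?_
    gcongr
    exact le_max_left _ _
  · rw [min_eq_right h1, mul_one]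
    refine le_trans ?_ (le_max_right _ _)
    have hh := integrable_heat hσ hη
    have ha := integrable_heat hσ hη.abs
    have h2 : ∫ x, |heat σ η x| ≤ ∫ x, heat σ (fun y => |η y|) x := by
      refine integral_mono hh.abs ha fun x => ?_
      refine abs_integral_le_integral_abs.trans (le_of_eq (integral_congr_ae
        (ae_of_all _ fun y => ?_)))
      simp only
      rw [abs_mul, abs_of_pos (heatKernel_pos hσ _)]
    have h3 : ∫ x, heat σ (fun y => |η y|) x = ∫ x, |η x| := by
      have := integral_mul_heat_comm (E := E) hσ hη.abs (φ := fun _ => 1)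
        aestronglyMeasurable_const (M := 1) (by simp)
      simp_rw [heat_const hσ, mul_one] at this
      exact this.symm
    calc ∫ x, |η x - heat σ η x| ≤ ∫ x, (|η x| + |heat σ η x|) :=
          integral_mono (hη.sub hh).abs (hη.abs.add hh.abs) fun x => abs_sub _ _
      _ = (∫ x, |η x|) + ∫ x, |heat σ η x| := integral_add hη.abs hh.abs
      _ ≤ _ := by linarith

variable {H : E → ℝ} {P α : ℝ}

theorem integral_mul_sub_heat_comm (hη : Integrable η) {φ : E → ℝ} (hφ : Measurable φ)
    (hP : ∀ x, |φ x| ≤ P) {σ : ℝ} (hσ : 0 < σ) :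
    ∫ x, η x * (φ x - heat σ φ x) = ∫ x, (η x - heat σ η x) * φ x := by
  simp_rw [mul_sub, sub_mul]
  rw [integral_sub (hη.mul_bdd (c := P) hφ.aestronglyMeasurable (ae_of_all _ hP))
    (integrable_mul_heat hη hφ hP hσ), integral_sub
    (hη.mul_bdd (c := P) hφ.aestronglyMeasurable (ae_of_all _ hP))
    ((integrable_heat hσ hη).mul_bdd (c := P) hφ.aestronglyMeasurable (ae_of_all _ hP)),
    integral_mul_heat_comm hσ hη hφ.aestronglyMeasurable hP]

/-- Pointwise lower bounds for the truncated operators pass to the weak formulation. -/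
theorem eventually_integral_mul_truncFrac_ge (hα0 : 0 < α) (hα1 : α < 1) (hH : Continuous H)
    (hP : ∀ x, |H x| ≤ P) {D K : Set E} (hD : IsOpen D) (hK : IsCompact K) (hKD : K ⊆ D)
    (hx : ∀ x ∈ D, ∀ e, 0 < e → ∀ᶠ δ in 𝓝[>] 0, -e ≤ truncFrac α δ H x)
    (hη : HasL1SecondDiff C η) (hη0 : ∀ x, 0 ≤ η x) (hηK : ∀ x, x ∉ K → η x = 0)
    {e : ℝ} (he : 0 < e) :
    ∀ᶠ δ in 𝓝[>] 0, -e ≤ ∫ x, η x * truncFrac α δ H x := by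
  have hP0 : 0 ≤ P := (abs_nonneg _).trans (hP 0)
  obtain ⟨B, hB⟩ := hη.exists_bound
  have hηi := hη.integrable
  obtain ⟨M, hM⟩ := hη.bdd
  have hdi : ∀ σ, 0 < σ → Integrable fun x => |η x - heat σ η x| := fun σ hσ =>
    (hηi.sub (integrable_heat hσ hηi)).abs
  set g : ℝ → ℝ → ℝ := fun ε σ => ∫ x, |η x - heat σ η x| * |infConv ε H x - H x| with hg
  have hdm : ∀ ε, 0 < ε → Measurable fun x => |infConv ε H x - H x| := fun ε hε =>
    ((measurable_infConv hP hε).sub hH.measurable).abs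
  have hdb : ∀ ε, 0 < ε → ∀ x, |infConv ε H x - H x| ≤ 2 * P := fun ε hε x =>
    (abs_sub _ _).trans (by linarith [hP x, abs_infConv_le hP hε x])
  have hgi : ∀ ε, 0 < ε → ∀ σ, 0 < σ →
      Integrable fun x => |η x - heat σ η x| * |infConv ε H x - H x| := fun ε hε σ hσ =>
    (hdi σ hσ).mul_bdd (c := 2 * P) (hdm ε hε).aestronglyMeasurable
      (ae_of_all _ fun x => by simpa using hdb ε hε x)
  have hgb : ∀ ε, 0 < ε → ∀ σ, 0 < σ → |g ε σ| ≤ 2 * P * (B * min σ 1) := by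
    intro ε hε σ hσ
    rw [abs_of_nonneg (integral_nonneg fun x => by positivity)]
    calc g ε σ ≤ ∫ x, |η x - heat σ η x| * (2 * P) :=
          integral_mono (hgi ε hε σ hσ) ((hdi σ hσ).mul_const _)
            fun x => mul_le_mul_of_nonneg_left (hdb ε hε x) (abs_nonneg _)
      _ ≤ _ := by
        rw [integral_mul_const, mul_comm]
        exact mul_le_mul_of_nonneg_left (hB σ hσ) (by positivity)
  have hgm : ∀ ε, 0 < ε → Measurable (g ε) := by
    intro ε hε
    have : StronglyMeasurable fun p : ℝ × E =>
        |η p.2 - heat p.1 η p.2| * |infConv ε H p.2 - H p.2| :=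
      ((hM.measurable.comp measurable_snd).sub
        (stronglyMeasurable_heat hM.measurable).measurable).abs.mul
        ((hdm ε hε).comp measurable_snd) |>.stronglyMeasurable
    exact this.integral_prod_right'.measurable
  have hI := (integrableOn_rpow_mul_min hα0 hα1).const_mul (2 * P * B)
  have hgt : ∀ ε, 0 < ε → ∀ σ, 0 < σ →
      ‖σ ^ (-1 - α) * g ε σ‖ ≤ 2 * P * B * (σ ^ (-1 - α) * min σ 1) := by
    intro ε hε σ hσ
    rw [norm_mul, Real.norm_of_nonneg (by positivity)]
    calc σ ^ (-1 - α) * ‖g ε σ‖ ≤ σ ^ (-1 - α) * (2 * P * (B * min σ 1)) := by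
          gcongr; exact hgb ε hε σ hσ
      _ = _ := by ring
  have hR : Tendsto (fun ε => ∫ σ in Ioi 0, σ ^ (-1 - α) * g ε σ) (𝓝[>] 0)
      (𝓝 (∫ σ in Ioi (0 : ℝ), σ ^ (-1 - α) * 0)) := by
    refine tendsto_integral_filter_of_dominated_convergence
      (fun σ => 2 * P * B * (σ ^ (-1 - α) * min σ 1)) ?_ ?_ hI ?_
    · filter_upwards [self_mem_nhdsWithin] with ε hε
      exact ((by fun_prop : Measurable fun σ : ℝ => σ ^ (-1 - α)).mul
        (hgm ε hε)).aestronglyMeasurable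
    · filter_upwards [self_mem_nhdsWithin] with ε hε
      filter_upwards [ae_restrict_mem measurableSet_Ioi] with σ hσ using hgt ε hε σ hσ
    · filter_upwards [ae_restrict_mem measurableSet_Ioi] with σ hσ
      refine tendsto_const_nhds.mul ?_
      have h0 : ∫ x, |η x - heat σ η x| * 0 = 0 := by simp
      conv => rhs; rw [← h0]
      refine tendsto_integral_filter_of_dominated_convergence
        (fun x => |η x - heat σ η x| * (2 * P)) ?_ ?_ ((hdi σ hσ).mul_const _) ?_
      · filter_upwards [self_mem_nhdsWithin] with ε hε using (hgi ε hε σ hσ).aestronglyMeasurable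
      · filter_upwards [self_mem_nhdsWithin] with ε hε
        refine ae_of_all _ fun x => ?_
        rw [norm_mul, norm_abs_eq_norm, norm_abs_eq_norm]
        exact mul_le_mul_of_nonneg_left (hdb ε hε x) (abs_nonneg _)
      · refine ae_of_all _ fun x => tendsto_const_nhds.mul ?_
        have := ((tendsto_infConv hH hP x).sub_const (H x)).abs
        simpa using this
  simp only [mul_zero, integral_zero] at hR
  obtain ⟨r, hr, hrD⟩ := hK.exists_thickening_subset_open hD hKD
  have hsmall : ∀ᶠ ε : ℝ in 𝓝[>] 0, ε * (2 * P) < r ^ 2 := by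
    have : Tendsto (fun ε : ℝ => ε * (2 * P)) (𝓝 0) (𝓝 (0 * (2 * P))) := tendsto_id.mul_const _
    rw [zero_mul] at this
    exact (this.mono_left nhdsWithin_le_nhds).eventually (gt_mem_nhds (by positivity))
  obtain ⟨ε, hεR, hεr, hε⟩ := ((hR.eventually (gt_mem_nhds (half_pos he))).and
    (hsmall.and self_mem_nhdsWithin)).exists
  have hε0 : 0 < ε := hε
  have hmF := measurable_infConv (H := H) hP hε0
  have hbF := abs_infConv_le (H := H) hP hε0
  obtain ⟨C', hC'⟩ := exists_truncFrac_infConv_ge hα0 hα1 hH hP hε0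
  have hneg : Tendsto (fun δ => ∫ x, η x * max (-truncFrac α δ (infConv ε H) x) 0) (𝓝[>] 0)
      (𝓝 (∫ x : E, (0 : ℝ))) := by
    refine tendsto_integral_filter_of_dominated_convergence
      (fun x => |η x| * |C'|) ?_ ?_ (hηi.abs.mul_const _) (ae_of_all _ fun x => ?_)
    · exact Eventually.of_forall fun δ => (hM.measurable.mul
        ((measurable_truncFrac hmF).neg.max measurable_const)).aestronglyMeasurable
    · filter_upwards [self_mem_nhdsWithin] with δ hδ
      refine ae_of_all _ fun x => ?_
      rw [norm_mul, Real.norm_of_nonneg (le_max_right _ _)]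
      refine mul_le_mul_of_nonneg_left (max_le ?_ (abs_nonneg _)) (norm_nonneg _)
      linarith [hC' δ hδ x, le_abs_self C']
    · by_cases hxK : x ∈ K
      · suffices h : Tendsto (fun δ => max (-truncFrac α δ (infConv ε H) x) 0) (𝓝[>] 0) (𝓝 0) by
          simpa using h.const_mul (η x)
        obtain ⟨y, hy, hyx⟩ := exists_infConv_eq hH hP hε0 x
        have hyD : y ∈ D := by
          refine hrD (Metric.mem_thickening_iff.2 ⟨x, hxK, ?_⟩)
          rw [dist_comm, dist_eq_norm]
          refine lt_of_pow_lt_pow_left₀ 2 hr.le ?_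
          linarith
        rw [Metric.tendsto_nhds]
        intro e' he'
        filter_upwards [hx y hyD (e' / 2) (by linarith), self_mem_nhdsWithin] with δ h1 hδ
        have h2 := truncFrac_infConv_ge (α := α) hα0 hδ hH hP hε0 hy
        rw [dist_zero_right, Real.norm_of_nonneg (le_max_right _ _)]
        exact max_lt (by linarith) he'
      · simp [hηK x hxK]
  rw [integral_zero] at hneg
  filter_upwards [hneg.eventually (gt_mem_nhds (half_pos he)), self_mem_nhdsWithin] with δ h1 hδ
  have hδ0 : 0 < δ := hδ
  have hti : ∀ {φ : E → ℝ}, Measurable φ → (∀ x, |φ x| ≤ P) →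
      Integrable fun x => η x * truncFrac α δ φ x := fun hφ hb =>
    hηi.mul_bdd (c := ∫ σ in Ioi δ, σ ^ (-1 - α) * (2 * P))
      (measurable_truncFrac hφ).aestronglyMeasurable
      (ae_of_all _ (abs_truncFrac_le hα0 hδ0 hb))
  have h2 : -(∫ x, η x * max (-truncFrac α δ (infConv ε H) x) 0) ≤
      ∫ x, η x * truncFrac α δ (infConv ε H) x := by
    rw [← integral_neg]
    refine integral_mono ?_ (hti hmF hbF) fun x => ?_
    · refine Integrable.neg (hηi.mul_bdd (c := |C'|)
        ((measurable_truncFrac hmF).neg.max measurable_const).aestronglyMeasurable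
        (ae_of_all _ fun x => ?_))
      rw [Real.norm_of_nonneg (le_max_right _ _)]
      exact max_le (by linarith [hC' δ hδ0 x, le_abs_self C']) (abs_nonneg _)
    · simp only
      rw [← mul_neg]
      refine mul_le_mul_of_nonneg_left ?_ (hη0 x)
      linarith [le_max_left (-truncFrac α δ (infConv ε H) x) 0]
  have h3 : |(∫ x, η x * truncFrac α δ (infConv ε H) x) - ∫ x, η x * truncFrac α δ H x| ≤
      ∫ σ in Ioi 0, σ ^ (-1 - α) * g ε σ := by
    have hgI : IntegrableOn (fun σ => σ ^ (-1 - α) * g ε σ) (Ioi 0) := by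
      refine Integrable.mono' hI ((by fun_prop : Measurable fun σ : ℝ => σ ^ (-1 - α)).mul
        (hgm ε hε)).aestronglyMeasurable ?_
      filter_upwards [ae_restrict_mem measurableSet_Ioi] with σ hσ using hgt ε hε σ hσ
    have hmd : Measurable fun x => infConv ε H x - H x := hmF.sub hH.measurable
    rw [← integral_sub (hti hmF hbF) (hti hH.measurable hP)]
    simp_rw [← mul_sub, ← truncFrac_sub hα0 hδ0 hmF hH.measurable hbF hP]
    rw [integral_mul_truncFrac hα0 hδ0 hmd (hdb ε hε0) hηi]
    refine (norm_integral_le_of_norm_le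
      (f := fun σ => σ ^ (-1 - α) * ∫ x, η x * (infConv ε H x - H x -
        heat σ (fun y => infConv ε H y - H y) x))
      (hgI.mono_set (Ioi_subset_Ioi hδ0.le)) ?_).trans (setIntegral_mono_set hgI ?_
      (Ioi_subset_Ioi hδ0.le).eventuallyLE)
    · filter_upwards [ae_restrict_mem measurableSet_Ioi] with σ hσ
      have hσ0 : 0 < σ := hδ0.trans hσ
      rw [norm_mul, Real.norm_of_nonneg (by positivity : 0 ≤ σ ^ (-1 - α)),
        integral_mul_sub_heat_comm hηi hmd (hdb ε hε0) hσ0]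
      refine mul_le_mul_of_nonneg_left (abs_integral_le_integral_abs.trans (le_of_eq ?_))
        (by positivity)
      simp only [hg, abs_mul]
    · filter_upwards [ae_restrict_mem measurableSet_Ioi] with σ hσ
      have hσ0 : 0 < σ := hσ
      exact mul_nonneg (by positivity) (integral_nonneg fun x => by positivity)
  have h4 := (abs_le.1 h3).2
  linarith

end

noncomputable section

open MeasureTheory Filter Topology Set Module
open scoped NNReal

set_option linter.unusedSectionVars false

variable {E : Type*} [NormedAddCommGroup E] [InnerProductSpace ℝ E] [FiniteDimensional ℝ E]
  [MeasurableSpace E] [BorelSpace E]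

variable {α β s M C δ : ℝ} {w η : E → ℝ}

theorem truncFrac_fracPot (h : BddIntegrable M w) (hE : 2 ≤ finrank ℝ E) (hβ0 : 0 < β)
    (hβ1 : β < 1) (hδ : 0 < δ) (x : E) :
    truncFrac α δ (fracPot β w) x = ∫ σ in Ioi δ, σ ^ (-1 - α) *
      ((∫ τ in Ioi 0, τ ^ (β - 1) * heat τ w x) -
        ∫ τ in Ioi 0, τ ^ (β - 1) * heat (τ + σ) w x) := by
  refine setIntegral_congr_fun measurableSet_Ioi fun σ hσ => ?_
  rw [h.heat_fracPot hE hβ0 hβ1 (hδ.trans hσ), fracPot]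

theorem integral_mul_truncFrac_fracPot (h : BddIntegrable M w) (hE : 2 ≤ finrank ℝ E)
    (hα : 0 < α) (hβ0 : 0 < β) (hβ1 : β < 1) (hδ : 0 < δ) (hη : Integrable η) :
    ∫ x, η x * truncFrac α δ (fracPot β w) x = ∫ σ in Ioi δ, σ ^ (-1 - α) *
      ((∫ τ in Ioi 0, τ ^ (β - 1) * ∫ x, η x * heat τ w x) -
        ∫ τ in Ioi 0, τ ^ (β - 1) * ∫ x, η x * heat (τ + σ) w x) := by
  have hm := (h.continuous_fracPot hE hβ0 hβ1).measurable
  have hb := h.abs_fracPot_le hE hβ0 hβ1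
  rw [integral_mul_truncFrac hα hδ hm hb hη]
  refine setIntegral_congr_fun measurableSet_Ioi fun σ hσ => ?_
  have hσ0 : 0 < σ := hδ.trans hσ
  rw [← h.integral_mul_fracPot hE hβ0 hβ1 hη,
    ← h.integral_mul_sub_heat_fracPot hE hβ0 hβ1 hη hσ0,
    ← integral_sub (hη.mul_bdd hm.aestronglyMeasurable (ae_of_all _ hb))
      (integrable_mul_heat hη hm hb hσ0)]
  simp_rw [mul_sub]

theorem eventually_heat_le_of_upperSemicontinuousAt (h : BddIntegrable M w) {x : E}
    (hw : UpperSemicontinuousAt w x) {e : ℝ} (he : 0 < e) :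
    ∀ᶠ τ in 𝓝[>] 0, heat τ w x ≤ w x + e := by
  obtain ⟨r, hr, hr'⟩ := Metric.eventually_nhds_iff.1 (hw (w x + e / 2) (by linarith))
  set A : ℝ := 8 * 2 ^ ((finrank ℝ E : ℝ) / 2) with hA
  have hM0 : 0 ≤ M := (abs_nonneg _).trans (h.bound 0)
  have ht : ∀ᶠ τ : ℝ in 𝓝[>] 0, 2 * M / r ^ 2 * (A * τ) < e / 2 := by
    have : Tendsto (fun τ : ℝ => 2 * M / r ^ 2 * (A * τ)) (𝓝 0) (𝓝 (2 * M / r ^ 2 * (A * 0))) :=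
      (tendsto_id.const_mul A).const_mul _
    rw [mul_zero, mul_zero] at this
    exact (this.mono_left nhdsWithin_le_nhds).eventually (gt_mem_nhds (half_pos he))
  filter_upwards [ht, self_mem_nhdsWithin] with τ h1 hτ
  have hτ0 : 0 < τ := hτ
  have hpt : ∀ z, w (x + z) ≤ w x + e / 2 + 2 * M / r ^ 2 * ‖z‖ ^ 2 := by
    intro z
    rcases lt_or_ge ‖z‖ r with hz | hz
    · have h2 : w (x + z) < w x + e / 2 := hr' (by simpa using hz)
      have : 0 ≤ 2 * M / r ^ 2 * ‖z‖ ^ 2 := by positivity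
      linarith
    · have h2 := (abs_le.1 (h.bound (x + z))).2
      have h3 := (abs_le.1 (h.bound x)).1
      have h4 : 2 * M ≤ 2 * M / r ^ 2 * ‖z‖ ^ 2 := by
        rw [div_mul_eq_mul_div, le_div_iff₀ (by positivity)]
        gcongr
      linarith
  have i1 := integrable_heatKernel_mul_add hτ0 h.measurable.aestronglyMeasurable h.bound x
  have i2 := (integrable_heatKernel (E := E) hτ0).mul_const (w x + e / 2)
  have i3 := (integrable_sq_norm_mul_heatKernel (E := E) hτ0).const_mul (2 * M / r ^ 2)
  have h5 : heat τ w x ≤ ∫ z : E, (heatKernel E τ z * (w x + e / 2) +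
      2 * M / r ^ 2 * (‖z‖ ^ 2 * heatKernel E τ z)) := by
    rw [heat_eq']
    refine integral_mono i1 (i2.add i3) fun z => ?_
    have := mul_le_mul_of_nonneg_left (hpt z) (heatKernel_pos hτ0 z).le
    simp only
    linarith
  rw [integral_add i2 i3, integral_mul_const, integral_const_mul, integral_heatKernel hτ0] at h5
  have h6 := mul_le_mul_of_nonneg_left (integral_sq_norm_mul_heatKernel_le (E := E) hτ0)
    (by positivity : 0 ≤ 2 * M / r ^ 2)
  linarith

theorem HasL1SecondDiff.exists_abs_integral_sub_le (hη : HasL1SecondDiff C η)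
    (h : BddIntegrable M w) :
    ∃ K, ∀ τ, 0 < τ → |(∫ x, η x * w x) - ∫ x, η x * heat τ w x| ≤ K * min τ 1 := by
  obtain ⟨B, hB⟩ := hη.exists_bound
  have hηi := hη.integrable
  refine ⟨M * B, fun τ hτ => ?_⟩
  have hM0 : 0 ≤ M := (abs_nonneg _).trans (h.bound 0)
  rw [← integral_sub (hηi.mul_bdd h.measurable.aestronglyMeasurable (ae_of_all _ h.bound))
      (integrable_mul_heat hηi h.measurable h.bound hτ)]
  simp_rw [← mul_sub]
  rw [integral_mul_sub_heat_comm hηi h.measurable h.bound hτ]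
  refine (norm_integral_le_of_norm_le (f := fun x => (η x - heat τ η x) * w x)
    ((hηi.sub (integrable_heat hτ hηi)).abs.const_mul M) (ae_of_all _ fun x => ?_)).trans ?_
  · rw [norm_mul, mul_comm]
    exact mul_le_mul_of_nonneg_right (h.bound x) (norm_nonneg _)
  · rw [integral_const_mul, mul_assoc]
    exact mul_le_mul_of_nonneg_left (hB τ hτ) hM0

theorem integrableOn_of_abs_le_min {K : ℝ} (hs0 : 0 < s) (hs1 : s < 1) {u : ℝ → ℝ}
    (hu : Measurable u) (hK : ∀ τ, 0 < τ → |u τ| ≤ K * min τ 1) :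
    IntegrableOn (fun τ => τ ^ (-1 - s) * u τ) (Ioi 0) := by
  refine ((integrableOn_rpow_mul_min hs0 hs1).const_mul K).mono'
    ((by fun_prop : Measurable fun τ : ℝ => τ ^ (-1 - s)).mul hu).aestronglyMeasurable ?_
  filter_upwards [ae_restrict_mem measurableSet_Ioi] with τ hτ
  have hτ0 : 0 < τ := hτ
  rw [norm_mul, Real.norm_of_nonneg (by positivity)]
  calc τ ^ (-1 - s) * ‖u τ‖ ≤ τ ^ (-1 - s) * (K * min τ 1) := by gcongr; exact hK τ hτ0
    _ = _ := by ring

theorem tendsto_integral_Ioi_zero {u : ℝ → ℝ} (hu : IntegrableOn u (Ioi 0)) :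
    Tendsto (fun r => ∫ τ in Ioi r, u τ) (𝓝[>] 0) (𝓝 (∫ τ in Ioi 0, u τ)) := by
  have e : ∀ r ∈ Ioi (0 : ℝ), ∫ τ in Ioi 0, (Ioi r).indicator u τ = ∫ τ in Ioi r, u τ := by
    intro r hr
    rw [setIntegral_indicator measurableSet_Ioi, inter_eq_right.2 (Ioi_subset_Ioi (le_of_lt hr))]
  refine Tendsto.congr' (eventually_of_mem self_mem_nhdsWithin e) ?_
  refine tendsto_integral_filter_of_dominated_convergence (fun τ => ‖u τ‖)
    (Eventually.of_forall fun r => (hu.indicator measurableSet_Ioi).aestronglyMeasurable)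
    (Eventually.of_forall fun r => ae_of_all _ fun τ => norm_indicator_le_norm_self _ _)
    hu.norm ?_
  filter_upwards [ae_restrict_mem measurableSet_Ioi] with τ hτ
  refine tendsto_const_nhds.congr' ?_
  filter_upwards [Ioo_mem_nhdsGT (mem_Ioi.1 hτ)] with r hr
  rw [indicator_of_mem (mem_Ioi.2 hr.2)]

theorem abs_integral_Ioi_le {u : ℝ → ℝ} (hu : IntegrableOn u (Ioi 0)) {r : ℝ} (hr : 0 < r) :
    |∫ τ in Ioi r, u τ| ≤ ∫ τ in Ioi 0, |u τ| :=
  abs_integral_le_integral_abs.trans (setIntegral_mono_set hu.abs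
    (ae_of_all _ fun _ => abs_nonneg _) (Ioi_subset_Ioi hr.le).eventuallyLE)

/-- A pointwise supersolution, tested against an upper semicontinuous lower bound `G` of its
fractional Laplacian. -/
theorem integral_mul_usc_le (hE : 2 ≤ finrank ℝ E) (hs0 : 0 < s) (hs1 : s < 1)
    (hα : α = (1 + s) / 2) (hβ : β = (1 - s) / 2)
    (hw : BddIntegrable M w) {D K : Set E} (hD : IsOpen D) (hK : IsCompact K) (hKD : K ⊆ D)
    {f G : E → ℝ} {N : ℝ} (hG : BddIntegrable N G) (hGu : UpperSemicontinuous G)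
    (hpt : ∀ x ∈ D, ∃ F, (∫ x in Ioi 0, powMass α x) * G x ≤
        (∫ p in Ioi 0, powIncr β p * p ^ s) * ((∫ σ in Ioi 0, heatWeight E s σ) * F) ∧
      Tendsto (fun ε => ∫ y in (Metric.ball x ε)ᶜ,
        (f x - w y) / ‖x - y‖ ^ ((finrank ℝ E : ℝ) + 2 * s)) (𝓝[>] 0) (𝓝 F))
    (hη : HasL1SecondDiff C η) (hη0 : ∀ x, 0 ≤ η x) (hηK : ∀ x, x ∉ K → η x = 0) :
    (∫ x in Ioi 0, powMass α x) * ∫ x, η x * G x ≤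
      (∫ p in Ioi 0, powIncr β p * p ^ s) *
        ∫ τ in Ioi 0, τ ^ (-1 - s) * ((∫ x, η x * w x) - ∫ x, η x * heat τ w x) := by
  have : Nontrivial E := Module.nontrivial_of_finrank_pos (R := ℝ) (by omega)
  have hE' : (2 : ℝ) ≤ finrank ℝ E := by exact_mod_cast hE
  have hα0 : 0 < α := by rw [hα]; linarith
  have hα1 : α < 1 := by rw [hα]; linarith
  have hβ0 : 0 < β := by rw [hβ]; linarith
  have hβ1 : β < 1 := by rw [hβ]; linarith
  have hβs : β + s = α := by rw [hα, hβ]; ring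
  have hηi := hη.integrable
  obtain ⟨Mη, hMη⟩ := hη.bdd
  set l := ∫ p in Ioi 0, powIncr β p * p ^ s
  set c := ∫ x in Ioi 0, powMass α x
  have hv := hw.continuous_fracPot hE hβ0 hβ1
  have hvb := hw.abs_fracPot_le hE hβ0 hβ1
  have hg := hG.continuous_fracPot hE hα0 hα1
  have hgb := hG.abs_fracPot_le hE hα0 hα1
  set Pv := ∫ τ in Ioi 0, fracBound β M (heatDecay M w) τ
  set Pg := ∫ τ in Ioi 0, fracBound α N (heatDecay N G) τ
  have hHb : ∀ x, |fracPot β w x - fracPot α G x| ≤ Pv + Pg := fun x =>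
    (abs_sub _ _).trans (add_le_add (hvb x) (hgb x))
  have hsub : ∀ {δ}, 0 < δ → ∀ x, truncFrac α δ (fun y => fracPot β w y - fracPot α G y) x =
      truncFrac α δ (fracPot β w) x - truncFrac α δ (fracPot α G) x := fun hδ x =>
    truncFrac_sub hα0 hδ hv.measurable hg.measurable hvb hgb x
  have hptw : ∀ x ∈ D, ∀ e, 0 < e → ∀ᶠ δ in 𝓝[>] 0,
      -e ≤ truncFrac α δ (fun y => fracPot β w y - fracPot α G y) x := by
    intro x hx e he
    obtain ⟨F, hF, hlim⟩ := hpt x hx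
    obtain ⟨⟨B, hB⟩, hL⟩ := tendsto_integral_sub_heat hs0 hs1 hw.measurable hw.bound x hlim
    have h1 := tendsto_truncated_fracDiff hβ0 hs0 (by linarith)
      (measurable_heat_left hw.measurable x) (fun τ hτ => abs_heat_le hτ hw.bound x)
      (hw.integrableOn hE hβ0 hβ1 x) hB hL
    rw [hβs] at h1
    have h2 := eventually_truncated_fracDiff_le hα1 (half_pos hα0) (half_lt_self hα0)
      (measurable_heat_left hG.measurable x) (fun τ hτ => abs_heat_le hτ hG.bound x)
      (fun τ hτ => abs_heat_le_rpow (half_pos hα0).le (by linarith) hG.integrable hG.bound hτ x)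
      (hG.integrableOn hE hα0 hα1 x)
      (fun e he => eventually_heat_le_of_upperSemicontinuousAt hG (hGu x) he) (half_pos he)
    filter_upwards [h1.eventually (lt_mem_nhds (sub_lt_self _ (half_pos he))), h2,
      self_mem_nhdsWithin] with δ h3 h4 hδ
    rw [hsub hδ, truncFrac_fracPot hw hE hβ0 hβ1 hδ, truncFrac_fracPot hG hE hα0 hα1 hδ]
    linarith
  have hH : Continuous fun y => fracPot β w y - fracPot α G y := hv.sub hg
  have hweak := fun e he => eventually_integral_mul_truncFrac_ge (e := e) hα0 hα1 hH hHb
    hD hK hKD hptw hη hη0 hηK he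
  obtain ⟨K1, hK1⟩ := hη.exists_abs_integral_sub_le hw
  obtain ⟨K2, hK2⟩ := hη.exists_abs_integral_sub_le hG
  have hm1 := measurable_integral_mul_heat hMη.measurable hw.measurable
  have hm2 := measurable_integral_mul_heat hMη.measurable hG.measurable
  have hm2' : Measurable fun τ => -∫ x, η x * heat τ G x := hm2.neg
  have hi := integrableOn_of_abs_le_min hs0 hs1 (measurable_const.sub hm1) hK1
  have hb1 : ∀ τ, 0 < τ → |∫ x, η x * heat τ w x| ≤ (∫ x, |η x|) * M := fun τ hτ =>
    abs_integral_mul_heat_le hηi (abs_heat_le hτ hw.bound)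
  have hb1' : ∀ τ, 0 < τ → |∫ x, η x * heat τ w x| ≤
      (∫ x, |η x|) * heatDecay M w * τ ^ (-1 : ℝ) := fun τ hτ => by
    rw [mul_assoc]; exact abs_integral_mul_heat_le hηi (hw.heat_decay hE hτ)
  have hb2 : ∀ τ, 0 < τ → |-∫ x, η x * heat τ G x| ≤ (∫ x, |η x|) * N := fun τ hτ => by
    rw [abs_neg]; exact abs_integral_mul_heat_le hηi (abs_heat_le hτ hG.bound)
  have hb2' : ∀ τ, 0 < τ → |-∫ x, η x * heat τ G x| ≤
      (∫ x, |η x|) * heatDecay N G * τ ^ (-1 : ℝ) := fun τ hτ => by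
    rw [abs_neg, mul_assoc]; exact abs_integral_mul_heat_le hηi (hG.heat_decay hE hτ)
  have hb2'' : ∀ τ, 0 < τ → |-∫ x, η x * heat τ G x| ≤
      (∫ x, |η x|) * heatDecay N G * τ ^ (-(α / 2)) := fun τ hτ => by
    rw [abs_neg, mul_assoc]
    exact abs_integral_mul_heat_le hηi fun x =>
      abs_heat_le_rpow (half_pos hα0).le (by linarith) hG.integrable hG.bound hτ x
  have h1 := tendsto_truncated_fracDiff hβ0 hs0 (by linarith) hm1 hb1
    (integrableOn_rpow_mul hβ0 hβ1 hm1 hb1 hb1') (fun r hr => abs_integral_Ioi_le hi hr)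
    (tendsto_integral_Ioi_zero hi)
  rw [hβs] at h1
  refine le_of_forall_pos_le_add fun e he => ?_
  have h2 := eventually_truncated_fracDiff_le (c := -∫ x, η x * G x) (e := e / 3) hα1
    (half_pos hα0) (half_lt_self hα0) hm2' hb2 hb2''
    (integrableOn_rpow_mul hα0 hα1 hm2' hb2 hb2') (fun e he => ?_) (by linarith)
  · obtain ⟨δ, h3, h4, h5, hδ⟩ := (h2.and ((h1.eventually (gt_mem_nhds (lt_add_of_pos_right _
      (by linarith : 0 < e / 3)))).and ((hweak (e / 3) (by linarith)).and
      self_mem_nhdsWithin))).exists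
    have hδ0 : 0 < δ := hδ
    have hti : ∀ {φ : E → ℝ} {Q : ℝ}, Measurable φ → (∀ x, |φ x| ≤ Q) →
        Integrable fun x => η x * truncFrac α δ φ x := fun {φ Q} hφ hb =>
      hηi.mul_bdd (c := ∫ σ in Ioi δ, σ ^ (-1 - α) * (2 * Q))
        (measurable_truncFrac hφ).aestronglyMeasurable
        (ae_of_all _ (abs_truncFrac_le hα0 hδ0 hb))
    simp_rw [hsub hδ0, mul_sub] at h5
    rw [integral_sub (hti hv.measurable hvb) (hti hg.measurable hgb),
      integral_mul_truncFrac_fracPot hw hE hα0 hβ0 hβ1 hδ0 hηi,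
      integral_mul_truncFrac_fracPot hG hE hα0 hα0 hα1 hδ0 hηi] at h5
    have h6 : ∀ σ : ℝ, σ ^ (-1 - α) *
        ((∫ τ in Ioi 0, τ ^ (α - 1) * -∫ x, η x * heat τ G x) -
          ∫ τ in Ioi 0, τ ^ (α - 1) * -∫ x, η x * heat (τ + σ) G x) =
        -(σ ^ (-1 - α) * ((∫ τ in Ioi 0, τ ^ (α - 1) * ∫ x, η x * heat τ G x) -
          ∫ τ in Ioi 0, τ ^ (α - 1) * ∫ x, η x * heat (τ + σ) G x)) := fun σ => by
      simp_rw [mul_neg, integral_neg]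
      ring
    simp only [h6, integral_neg] at h3
    linarith
  · have ht : ∀ᶠ τ : ℝ in 𝓝[>] 0, K2 * τ < e := by
      have : Tendsto (fun τ : ℝ => K2 * τ) (𝓝 0) (𝓝 (K2 * 0)) := tendsto_id.const_mul _
      rw [mul_zero] at this
      exact (this.mono_left nhdsWithin_le_nhds).eventually (gt_mem_nhds he)
    filter_upwards [ht, Ioo_mem_nhdsGT zero_lt_one] with τ h3 hτ
    have h4 := (abs_le.1 (hK2 τ hτ.1)).2
    rw [min_eq_left hτ.2.le] at h4
    linarith

end

noncomputable section

open MeasureTheory Filter Topology Set Module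
open scoped NNReal

set_option linter.unusedSectionVars false

variable {E : Type*} [NormedAddCommGroup E] [InnerProductSpace ℝ E] [FiniteDimensional ℝ E]
  [MeasurableSpace E] [BorelSpace E]

variable {s M C : ℝ} {w η : E → ℝ}

/-- Pointwise supersolutions `F ≥ k f`, with `f = w` almost everywhere, are weak supersolutions
in the heat semigroup formulation. -/
theorem integral_mul_le_of_pointwise (hE : 2 ≤ finrank ℝ E) (hs0 : 0 < s) (hs1 : s < 1)
    (hw : BddIntegrable M w) {D K : Set E} (hD : IsOpen D)
    (hK : IsCompact K) (hKD : K ⊆ D) {f : E → ℝ} {k : ℝ} (hk : 0 ≤ k) (hf0 : ∀ x ∈ D, 0 ≤ f x)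
    (hfw : ∀ᵐ x, x ∈ D → f x = w x)
    (hpt : ∀ x ∈ D, ∃ F, k * f x ≤ F ∧
      Tendsto (fun ε => ∫ y in (Metric.ball x ε)ᶜ,
        (f x - w y) / ‖x - y‖ ^ ((finrank ℝ E : ℝ) + 2 * s)) (𝓝[>] 0) (𝓝 F))
    (hη : HasL1SecondDiff C η) (hη0 : ∀ x, 0 ≤ η x) (hηK : ∀ x, x ∉ K → η x = 0) :
    (∫ σ in Ioi 0, heatWeight E s σ) * k * ∫ x, η x * w x ≤
      ∫ τ in Ioi 0, τ ^ (-1 - s) * ((∫ x, η x * w x) - ∫ x, η x * heat τ w x) := by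
  have hl : 0 < ∫ p in Ioi 0, powIncr ((1 - s) / 2) p * p ^ s :=
    integral_powIncr_mul_rpow_pos (by linarith) hs0 (by linarith)
  have hc : 0 < ∫ x in Ioi 0, powMass ((1 + s) / 2) x := integral_powMass_pos (by linarith)
    (by linarith)
  have hCK := integral_heatWeight_pos (E := E) hs0 hs1
  set l := ∫ p in Ioi 0, powIncr ((1 - s) / 2) p * p ^ s
  set c := ∫ x in Ioi 0, powMass ((1 + s) / 2) x
  set CK := ∫ σ in Ioi 0, heatWeight E s σ
  set I := ∫ τ in Ioi 0, τ ^ (-1 - s) * ((∫ x, η x * w x) - ∫ x, η x * heat τ w x)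
  obtain ⟨Mη, hMη⟩ := hη.bdd
  have hM0 : 0 ≤ M := (abs_nonneg _).trans (hw.bound 0)
  set κ := l * CK * k / c with hκ
  have hκ0 : 0 ≤ κ := by positivity
  have hcκ : c * κ = l * CK * k := by rw [hκ]; field_simp
  set F : E → ℝ≥0 := fun x => D.indicator (fun x => Real.toNNReal (κ * min (f x) M)) x with hF
  have hFD : ∀ x ∈ D, (F x : ℝ) = κ * min (f x) M := fun x hx => by
    rw [hF]
    simp only [indicator_of_mem hx]
    exact Real.coe_toNNReal _ (mul_nonneg hκ0 (le_min (hf0 x hx) hM0))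
  have hFD' : ∀ x, x ∉ D → (F x : ℝ) = 0 := fun x hx => by
    rw [hF]
    simp only [indicator_of_notMem hx, NNReal.coe_zero]
  have hFw : (fun x => (F x : ℝ)) =ᵐ[volume] D.indicator fun x => κ * w x := by
    filter_upwards [hfw] with x hx
    by_cases hxD : x ∈ D
    · rw [hFD x hxD, indicator_of_mem hxD, hx hxD, min_eq_left (abs_le.1 (hw.bound x)).2]
    · rw [hFD' x hxD, indicator_of_notMem hxD]
  have hFi : Integrable fun x => (F x : ℝ) :=
    ((hw.integrable.const_mul κ).indicator hD.measurableSet).congr hFw.symm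
  have hFle : ∀ x, (F x : ℝ) ≤ κ * M := fun x => by
    by_cases hxD : x ∈ D
    · rw [hFD x hxD]; gcongr; exact min_le_right _ _
    · rw [hFD' x hxD]; positivity
  have hηF : ∫ x, η x * F x = κ * ∫ x, η x * w x := by
    rw [← integral_const_mul]
    refine integral_congr_ae ?_
    filter_upwards [hFw] with x hx
    rw [hx]
    by_cases hxD : x ∈ D
    · rw [indicator_of_mem hxD]; ring
    · rw [hηK x fun h => hxD (hKD h)]; ring
  have hηFi : Integrable fun x => η x * F x :=
    hη.integrable.mul_bdd (c := κ * M) hFi.aestronglyMeasurable (ae_of_all _ fun x => by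
      rw [Real.norm_of_nonneg (NNReal.coe_nonneg _)]; exact hFle x)
  have key : ∀ ε > 0, c * (κ * ∫ x, η x * w x) ≤ l * I + c * (Mη * ε) := by
    intro ε hε
    obtain ⟨g, hgF, hgu, hgi, hgε⟩ := exists_upperSemicontinuous_le_integral_le F hFi hε
    have hgF' : ∀ x, (g x : ℝ) ≤ F x := fun x => NNReal.coe_le_coe.2 (hgF x)
    have hgu' : UpperSemicontinuous fun x => (g x : ℝ) :=
      NNReal.continuous_coe.comp_upperSemicontinuous hgu fun _ _ h => NNReal.coe_le_coe.2 h
    have hG : BddIntegrable (κ * M) fun x => (g x : ℝ) :=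
      ⟨hgu'.measurable, hgi, fun x => by
        rw [abs_of_nonneg (NNReal.coe_nonneg _)]; exact (hgF' x).trans (hFle x)⟩
    have h1 := integral_mul_usc_le hE hs0 hs1 rfl rfl hw hD hK hKD hG hgu' (f := f)
      (fun x hx => by
        obtain ⟨A, hA, hlim⟩ := hpt x hx
        refine ⟨A, ?_, hlim⟩
        calc c * g x ≤ c * (κ * f x) := by
              gcongr
              refine (hgF' x).trans ?_
              rw [hFD x hx]
              gcongr
              exact min_le_left _ _
          _ = l * (CK * (k * f x)) := by rw [← mul_assoc, hcκ]; ring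
          _ ≤ l * (CK * A) := by gcongr) hη hη0 hηK
    have hηGi : Integrable fun x => η x * g x :=
      hη.integrable.mul_bdd (c := κ * M) hgi.aestronglyMeasurable (ae_of_all _ hG.bound)
    have h2 : (∫ x, η x * F x) - ∫ x, η x * g x ≤ Mη * ε := by
      rw [← integral_sub hηFi hηGi]
      calc ∫ x, (η x * F x - η x * g x) ≤ ∫ x, Mη * ((F x : ℝ) - g x) := by
            refine integral_mono (hηFi.sub hηGi) ((hFi.sub hgi).const_mul _) fun x => ?_
            simp only
            rw [← mul_sub]
            exact mul_le_mul_of_nonneg_right ((le_abs_self _).trans (hMη.bound x))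
              (sub_nonneg.2 (hgF' x))
        _ = Mη * ((∫ x, (F x : ℝ)) - ∫ x, (g x : ℝ)) := by
            rw [integral_const_mul, integral_sub hFi hgi]
        _ ≤ Mη * ε := by
            have := (abs_nonneg _).trans (hMη.bound 0)
            gcongr
            linarith
    rw [hηF] at h2
    have h3 := mul_le_mul_of_nonneg_left h2 hc.le
    linarith
  have h4 : c * (κ * ∫ x, η x * w x) ≤ l * I := by
    have ht : Tendsto (fun ε : ℝ => l * I + c * (Mη * ε)) (𝓝[>] 0) (𝓝 (l * I + c * (Mη * 0))) :=
      (((tendsto_id.const_mul Mη).const_mul c).const_add (l * I)).mono_left nhdsWithin_le_nhds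
    rw [mul_zero, mul_zero, add_zero] at ht
    exact ge_of_tendsto ht (eventually_of_mem self_mem_nhdsWithin key)
  rw [← mul_assoc, hcκ] at h4
  refine le_of_mul_le_mul_left ?_ hl
  linarith

end

noncomputable section

open MeasureTheory Filter Topology Set Module

set_option linter.unusedSectionVars false

variable {E : Type*} [NormedAddCommGroup E] [InnerProductSpace ℝ E] [FiniteDimensional ℝ E]
  [MeasurableSpace E] [BorelSpace E]

variable {s M C : ℝ} {w η : E → ℝ}

theorem exists_abs_secondDiff_le (hη : ContDiff ℝ 2 η) (hc : HasCompactSupport η) :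
    ∃ A, 0 ≤ A ∧ ∀ x z, |2 * η x - η (x + z) - η (x - z)| ≤ A * ‖z‖ ^ 2 := by
  obtain ⟨L, hL⟩ := ContDiff.lipschitzWith_of_hasCompactSupport (𝕂 := ℝ) (n := 1)
    (hc.fderiv (𝕜 := ℝ)) (hη.fderiv_right (by norm_num)) one_ne_zero
  have hd : Differentiable ℝ η := hη.differentiable (by norm_num)
  have key : ∀ x z, |η (x + z) - η x - fderiv ℝ η x z| ≤ L * ‖z‖ ^ 2 := by
    intro x z
    have := (convex_closedBall x ‖z‖).norm_image_sub_le_of_norm_fderiv_le' (f := η) (𝕜 := ℝ)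
      (φ := fderiv ℝ η x) (C := L * ‖z‖) (x := x) (y := x + z) (fun y _ => hd y) (fun y hy => ?_)
      (by simp) (by simp)
    · rw [add_sub_cancel_left] at this
      rw [sq, ← mul_assoc]
      exact this
    · refine (hL.norm_sub_le y x).trans ?_
      gcongr
      simpa [dist_eq_norm] using hy
  refine ⟨2 * L, by positivity, fun x z => ?_⟩
  have h1 := abs_le.1 (key x z)
  have h2 := abs_le.1 (key x (-z))
  rw [norm_neg, map_neg, ← sub_eq_add_neg] at h2
  rw [abs_le]
  constructor <;> linarith [h1.1, h1.2, h2.1, h2.2]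

theorem ContDiff.exists_hasL1SecondDiff (hη : ContDiff ℝ 2 η) (hc : HasCompactSupport η) :
    ∃ C, HasL1SecondDiff C η := by
  obtain ⟨A, hA0, hA⟩ := exists_abs_secondDiff_le hη hc
  obtain ⟨M, hM⟩ := hc.exists_bound_of_continuous hη.continuous
  have hi : Integrable η := hη.continuous.integrable_of_hasCompactSupport hc
  obtain ⟨r, hr⟩ := hc.isBounded.subset_closedBall (0 : E)
  have hI : 0 ≤ ∫ x, |η x| := integral_nonneg fun _ => abs_nonneg _
  refine ⟨A * volume.real (Metric.closedBall (0 : E) (r + 1)) + 4 * ∫ x, |η x|, by positivity, hi,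
    ⟨M, hη.continuous.measurable, hi, hM⟩, fun z => ?_⟩
  have i1 : Integrable fun x => η (x + z) := hi.comp_add_right z
  have i2 : Integrable fun x => η (x - z) := hi.comp_sub_right z
  rcases le_total ‖z‖ 1 with hz | hz
  · have h0 : ∀ y, y ∉ Metric.closedBall (0 : E) r → η y = 0 := fun y hy =>
      image_eq_zero_of_notMem_tsupport fun h => hy (hr h)
    have hs : ∀ x, |2 * η x - η (x + z) - η (x - z)| ≤
        (Metric.closedBall (0 : E) (r + 1)).indicator (fun _ => A * ‖z‖ ^ 2) x := by
      intro x
      by_cases hx : x ∈ Metric.closedBall (0 : E) (r + 1)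
      · rw [indicator_of_mem hx]; exact hA x z
      · rw [indicator_of_notMem hx]
        simp only [Metric.mem_closedBall, dist_zero_right, not_le] at hx h0
        have h1 := norm_sub_le (x + z) z
        have h2 := norm_add_le (x - z) z
        rw [add_sub_cancel_right] at h1
        rw [sub_add_cancel] at h2
        rw [h0 x (by linarith), h0 (x + z) (by linarith), h0 (x - z) (by linarith)]
        simp
    refine (integral_mono_of_nonneg (ae_of_all _ fun _ => abs_nonneg _)
      ((integrable_indicator_iff measurableSet_closedBall).2
        (integrableOn_const (isCompact_closedBall _ _).measure_lt_top.ne)) (ae_of_all _ hs)).trans ?_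
    rw [integral_indicator measurableSet_closedBall, setIntegral_const, smul_eq_mul]
    nlinarith [sq_nonneg ‖z‖, mul_nonneg hI (sq_nonneg ‖z‖)]
  · have h1 : ∫ x, |2 * η x - η (x + z) - η (x - z)| ≤
        ∫ x, (2 * |η x| + |η (x + z)| + |η (x - z)|) := by
      refine integral_mono (((hi.const_mul 2).sub i1).sub i2).abs
        (((hi.abs.const_mul 2).add i1.abs).add i2.abs) fun x => ?_
      have := abs_le.1 (le_refl |η x|)
      have := abs_le.1 (le_refl |η (x + z)|)
      have := abs_le.1 (le_refl |η (x - z)|)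
      simp only
      rw [abs_le]
      constructor <;> linarith
    have h2 : ∫ x, (2 * |η x| + |η (x + z)| + |η (x - z)|) = 4 * ∫ x, |η x| := by
      have i3 : Integrable fun x => 2 * |η x| + |η (x + z)| := (hi.abs.const_mul 2).add i1.abs
      rw [integral_add i3 i2.abs,
        integral_add (hi.abs.const_mul 2) i1.abs, integral_const_mul,
        integral_add_right_eq_self (fun x => |η x|), integral_sub_right_eq_self (fun x => |η x|)]
      ring
    have h3 : 1 ≤ ‖z‖ ^ 2 := one_le_pow₀ hz
    have h4 : 0 ≤ A * volume.real (Metric.closedBall (0 : E) (r + 1)) * ‖z‖ ^ 2 := by positivity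
    nlinarith

theorem heat_comp_sub_right (τ : ℝ) (η : E → ℝ) (a x : E) :
    heat τ (fun y => η (y - a)) x = heat τ η (x - a) := by
  rw [heat_eq, heat_eq]
  simp_rw [sub_right_comm]

theorem HasL1SecondDiff.comp_sub_right (h : HasL1SecondDiff C η) (a : E) :
    HasL1SecondDiff C fun y => η (y - a) := by
  obtain ⟨M, hM⟩ := h.bdd
  refine ⟨h.nonneg, h.integrable.comp_sub_right a,
    ⟨M, hM.measurable.comp (measurable_id.sub_const a), h.integrable.comp_sub_right a,
      fun x => hM.bound _⟩, fun z => ?_⟩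
  refine le_trans (le_of_eq ?_) (h.secondDiff z)
  rw [← integral_sub_right_eq_self (fun x => |2 * η x - η (x + z) - η (x - z)|) a]
  refine integral_congr_ae (ae_of_all _ fun x => ?_)
  simp only
  rw [sub_add_eq_add_sub, sub_right_comm x a z]

/-- Convolution of `w` with the reflection of `η`. -/
def mollify (η w : E → ℝ) (x : E) : ℝ := ∫ y, η (y - x) * w y

theorem mollify_eq (η w : E → ℝ) (x : E) : mollify η w x = ∫ y, η y * w (x + y) := by
  rw [mollify, ← integral_add_right_eq_self _ x]
  simp [add_comm]

theorem abs_mollify_le (hη : Integrable η) (hw : ∀ x, |w x| ≤ M) (x : E) :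
    |mollify η w x| ≤ (∫ x, |η x|) * M := by
  rw [mollify_eq, ← integral_mul_const]
  refine norm_integral_le_of_norm_le (f := fun y => η y * w (x + y)) (hη.abs.mul_const M)
    (ae_of_all _ fun y => ?_)
  rw [norm_mul]
  exact mul_le_mul_of_nonneg_left (hw _) (norm_nonneg _)

theorem continuous_mollify (hη : Continuous η) {Q : ℝ} (hQ : ∀ x, |η x| ≤ Q)
    (hw : Integrable w) : Continuous (mollify η w) := by
  refine continuous_of_dominated (bound := fun y => Q * |w y|) (fun x =>
    ((hη.comp (continuous_id.sub continuous_const)).aestronglyMeasurable.mul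
      hw.aestronglyMeasurable)) (fun x => ae_of_all _ fun y => ?_) (hw.abs.const_mul _)
    (ae_of_all _ fun y => ?_)
  · rw [norm_mul]
    exact mul_le_mul_of_nonneg_right (hQ _) (norm_nonneg _)
  · exact (hη.comp (continuous_const.sub continuous_id)).mul continuous_const

theorem heat_mollify {τ : ℝ} (hτ : 0 < τ) (hη : Integrable η) (hw : Measurable w)
    (hM : ∀ x, |w x| ≤ M) (x : E) : heat τ (mollify η w) x = mollify η (heat τ w) x := by
  rw [mollify_eq, heat_eq']
  simp_rw [mollify_eq, heat_eq', ← integral_const_mul]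
  rw [integral_integral_swap]
  · refine integral_congr_ae (ae_of_all _ fun y => integral_congr_ae (ae_of_all _ fun z => ?_))
    simp only
    rw [add_right_comm x z y]; ring
  · have hm : Measurable fun p : E × E => w (x + p.1 + p.2) := hw.comp (by fun_prop)
    refine (((integrable_heatKernel (E := E) hτ).mul_prod hη).mul_bdd (c := M)
      hm.aestronglyMeasurable (ae_of_all _ fun p => hM _)).congr (ae_of_all _ fun p => ?_)
    simp only [Function.uncurry]; ring

theorem mollify_sub_heat {τ : ℝ} (hτ : 0 < τ) (hη : Integrable η) (hw : Measurable w)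
    (hM : ∀ x, |w x| ≤ M) (x : E) :
    mollify η w x - heat τ (mollify η w) x = ∫ y, η (y - x) * (w y - heat τ w y) := by
  rw [heat_mollify hτ hη hw hM, mollify, mollify]
  have hη' := hη.comp_sub_right x
  rw [← integral_sub (hη'.mul_bdd (c := M) hw.aestronglyMeasurable (ae_of_all _ hM))
    (integrable_mul_heat hη' hw hM hτ)]
  simp_rw [mul_sub]

theorem HasL1SecondDiff.exists_abs_mollify_sub_le (h : HasL1SecondDiff C η) (hw : Measurable w)
    (hM : ∀ x, |w x| ≤ M) :
    ∃ K, ∀ τ, 0 < τ → ∀ x, |mollify η w x - heat τ (mollify η w) x| ≤ K * min τ 1 := by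
  obtain ⟨B, hB⟩ := h.exists_bound
  have hM0 : 0 ≤ M := (abs_nonneg _).trans (hM 0)
  have hηi := h.integrable
  refine ⟨M * B, fun τ hτ x => ?_⟩
  have hi : Integrable fun y => η y - heat τ η y := hηi.sub (integrable_heat hτ hηi)
  rw [mollify_sub_heat hτ hηi hw hM, integral_mul_sub_heat_comm (hηi.comp_sub_right x) hw hM hτ]
  simp_rw [heat_comp_sub_right]
  refine (norm_integral_le_of_norm_le (f := fun y => (η (y - x) - heat τ η (y - x)) * w y)
    ((hi.comp_sub_right x).abs.const_mul M) (ae_of_all _ fun y => ?_)).trans ?_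
  · rw [norm_mul, mul_comm]
    exact mul_le_mul_of_nonneg_right (hM y) (norm_nonneg _)
  · rw [integral_const_mul, integral_sub_right_eq_self (fun y => |η y - heat τ η y|), mul_assoc]
    exact mul_le_mul_of_nonneg_left (hB τ hτ) hM0

/-- Strong maximum principle for the semigroup formulation. -/
theorem ae_eq_zero_of_integral_nonneg (hs0 : 0 < s) (hs1 : s < 1) (hw : BddIntegrable M w)
    (hw0 : ∀ x, 0 ≤ w x) (hη : HasL1SecondDiff C η) (hηc : Continuous η) (hη0 : ∀ x, 0 ≤ η x)
    {x₀ : E} (hx₀ : 0 < η x₀) (h0 : ∫ x, η x * w x = 0)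
    (h : 0 ≤ ∫ τ in Ioi 0, τ ^ (-1 - s) * ((∫ x, η x * w x) - ∫ x, η x * heat τ w x)) :
    w =ᵐ[volume] 0 := by
  obtain ⟨K, hK⟩ := hη.exists_abs_integral_sub_le hw
  obtain ⟨Mη, hMη⟩ := hη.bdd
  have hηi := hη.integrable
  have hi := integrableOn_of_abs_le_min hs0 hs1 (u := fun τ => (∫ x, η x * w x) -
    ∫ x, η x * heat τ w x) (measurable_const.sub
    (measurable_integral_mul_heat hMη.measurable hw.measurable)) hK
  simp_rw [h0, zero_sub] at h hi
  have hpos : ∀ τ, 0 < τ → 0 ≤ ∫ x, η x * heat τ w x := fun τ hτ =>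
    integral_nonneg fun x => mul_nonneg (hη0 x) (heat_nonneg hτ hw0 x)
  have hn : ∀ᵐ τ ∂volume.restrict (Ioi (0 : ℝ)), τ ^ (-1 - s) * -∫ x, η x * heat τ w x ≤ 0 := by
    filter_upwards [ae_restrict_mem measurableSet_Ioi] with τ hτ
    have := hpos τ hτ
    have : 0 ≤ τ ^ (-1 - s) := Real.rpow_nonneg (le_of_lt hτ) _
    nlinarith
  have he : (fun τ => -(τ ^ (-1 - s) * -∫ x, η x * heat τ w x)) =ᵐ[volume.restrict (Ioi (0 : ℝ))] 0 := by
    refine (integral_eq_zero_iff_of_nonneg_ae ?_ hi.neg).1 ?_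
    · filter_upwards [hn] with τ hτ using neg_nonneg.2 hτ
    · rw [integral_neg']
      have := integral_nonpos_of_ae hn
      linarith
  have : (ae (volume.restrict (Ioi (0 : ℝ)))).NeBot := ae_neBot.2 (by simp)
  obtain ⟨τ, hτ, hτ0⟩ := (he.and (ae_restrict_mem measurableSet_Ioi)).exists
  have hτ0 : 0 < τ := hτ0
  have h1 : ∫ x, η x * heat τ w x = 0 := by
    have h2 : 0 < τ ^ (-1 - s) := by positivity
    simpa [h2.ne'] using hτ
  rw [integral_mul_heat_comm hτ0 hηi hw.measurable.aestronglyMeasurable hw.bound] at h1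
  have hh := heat_nonneg hτ0 hη0
  have h2 := (integral_eq_zero_iff_of_nonneg (fun x => mul_nonneg (hh x) (hw0 x))
    (hw.integrable.bdd_mul (c := Mη) (measurable_heat hMη.measurable τ).aestronglyMeasurable
      (ae_of_all _ (abs_heat_le hτ0 hMη.bound)))).1 h1
  filter_upwards [h2] with x hx
  refine (mul_eq_zero.1 hx).resolve_left (ne_of_gt ?_)
  rw [heat]
  exact integral_pos_of_integrable_nonneg_nonzero (x := x₀)
    (((continuous_heatKernel τ).comp (continuous_const.sub continuous_id)).mul hηc)
    (integrable_heatKernel_mul_of_integrable hτ0 hηi x)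
    (fun y => mul_nonneg (heatKernel_pos hτ0 _).le (hη0 y))
    (mul_pos (heatKernel_pos hτ0 _) hx₀).ne'

/-- Data of a positive continuous supersolution in the semigroup formulation, on the set `B`. -/
structure IsHeatSupersolution (s k : ℝ) (B : Set E) (V : E → ℝ) : Prop where
  continuous : Continuous V
  nonneg : ∀ x, 0 ≤ V x
  bound : ∃ M, ∀ x, |V x| ≤ M
  sub_heat : ∃ K, ∀ τ, 0 < τ → ∀ x, |V x - heat τ V x| ≤ K * min τ 1
  pos : ∀ x ∈ B, 0 < V x
  le : ∀ x ∈ B, k * V x ≤ ∫ τ in Ioi 0, τ ^ (-1 - s) * (V x - heat τ V x)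

theorem exists_isHeatSupersolution (hE : 2 ≤ finrank ℝ E) (hs0 : 0 < s) (hs1 : s < 1)
    (hw : BddIntegrable M w) (hw0 : ∀ x, 0 ≤ w x) (hne : ¬ w =ᵐ[volume] 0) {x₀ : E} {R ρ : ℝ}
    (hρ : 0 < ρ) {f : E → ℝ} {k : ℝ} (hk : 0 ≤ k) (hf0 : ∀ x ∈ Metric.ball x₀ R, 0 ≤ f x)
    (hfw : ∀ᵐ x, x ∈ Metric.ball x₀ R → f x = w x)
    (hpt : ∀ x ∈ Metric.ball x₀ R, ∃ F, k * f x ≤ F ∧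
      Tendsto (fun ε => ∫ y in (Metric.ball x ε)ᶜ,
        (f x - w y) / ‖x - y‖ ^ ((finrank ℝ E : ℝ) + 2 * s)) (𝓝[>] 0) (𝓝 F)) :
    ∃ V : E → ℝ, IsHeatSupersolution s ((∫ σ in Ioi 0, heatWeight E s σ) * k)
      (Metric.ball x₀ (R - ρ)) V := by
  let φ : ContDiffBump (0 : E) := ⟨ρ / 2, ρ, by positivity, by linarith⟩
  have hφc : Continuous φ := φ.continuous
  have hφ0 : ∀ x, 0 ≤ φ x := φ.nonneg'
  have hφ1 : ∀ x, |φ x| ≤ 1 := fun x => by rw [abs_of_nonneg (hφ0 x)]; exact φ.le_one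
  obtain ⟨C, hC⟩ := (φ.contDiff (n := 2)).exists_hasL1SecondDiff φ.hasCompactSupport
  have hφi := hC.integrable
  have hCK := integral_heatWeight_pos (E := E) hs0 hs1
  have hnn : ∀ x, 0 ≤ mollify φ w x := fun x =>
    integral_nonneg fun y => mul_nonneg (hφ0 _) (hw0 y)
  have hsub : ∀ x ∈ Metric.ball x₀ (R - ρ), Metric.closedBall x ρ ⊆ Metric.ball x₀ R := by
    intro x hx
    refine Metric.closedBall_subset_ball' ?_
    have := Metric.mem_ball.1 hx
    linarith
  have hsup : ∀ x ∈ Metric.ball x₀ (R - ρ), (∫ σ in Ioi 0, heatWeight E s σ) * k *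
      ∫ y, φ (y - x) * w y ≤ ∫ τ in Ioi 0, τ ^ (-1 - s) *
        ((∫ y, φ (y - x) * w y) - ∫ y, φ (y - x) * heat τ w y) := by
    intro x hx
    refine integral_mul_le_of_pointwise hE hs0 hs1 hw Metric.isOpen_ball
      (isCompact_closedBall x ρ) (hsub x hx) hk hf0 hfw hpt (hC.comp_sub_right x)
      (fun _ => hφ0 _) fun y hy => φ.zero_of_le_dist ?_
    rw [Metric.mem_closedBall, not_le, dist_eq_norm] at hy
    rw [dist_zero_right]
    exact hy.le
  refine ⟨mollify φ w, continuous_mollify hφc hφ1 hw.integrable, hnn,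
    ⟨_, abs_mollify_le hφi hw.bound⟩, hC.exists_abs_mollify_sub_le hw.measurable hw.bound,
    fun x hx => ?_, fun x hx => ?_⟩
  · refine (hnn x).lt_of_ne fun h0 => hne ?_
    have h1 := hsup x hx
    rw [← mollify, ← h0, mul_zero] at h1
    refine ae_eq_zero_of_integral_nonneg hs0 hs1 hw hw0 (hC.comp_sub_right x)
      (hφc.comp (continuous_sub_right x)) (fun _ => hφ0 _) (x₀ := x) ?_ h0.symm ?_
    · simp only [sub_self]
      exact φ.pos_of_mem_ball (Metric.mem_ball_self hρ)
    · rw [← mollify, ← h0]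
      exact h1
  · have h1 := hsup x hx
    refine h1.trans (le_of_eq (setIntegral_congr_fun measurableSet_Ioi fun τ hτ => ?_))
    rw [heat_mollify hτ hφi hw.measurable hw.bound, mollify, mollify]

end

noncomputable section

open MeasureTheory Filter Topology Set Module

set_option linter.unusedSectionVars false

variable {E : Type*} [NormedAddCommGroup E] [InnerProductSpace ℝ E] [FiniteDimensional ℝ E]
  [MeasurableSpace E] [BorelSpace E]

variable {s k M : ℝ} {B : Set E} {W u : E → ℝ}

theorem heatKernel_smul {t τ : ℝ} (ht : 0 < t) (hτ : 0 < τ) (z : E) :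
    t ^ finrank ℝ E * heatKernel E τ (t • z) = heatKernel E ((t ^ 2)⁻¹ * τ) z := by
  unfold heatKernel
  rw [← mul_assoc, norm_smul, Real.norm_of_nonneg ht.le]
  congr 1
  · rw [show 4 * Real.pi * ((t ^ 2)⁻¹ * τ) = (4 * Real.pi * τ) * (t ^ 2)⁻¹ by ring,
      Real.mul_rpow (x := 4 * Real.pi * τ) (y := (t ^ 2)⁻¹) (by positivity) (by positivity),
      mul_comm, Real.inv_rpow (by positivity),
      ← Real.rpow_neg (by positivity), ← Real.rpow_natCast t 2, ← Real.rpow_mul ht.le,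
      ← Real.rpow_natCast t]
    congr 2
    push_cast; ring
  · congr 1
    field_simp

theorem heat_dilate {t τ : ℝ} (ht : 0 < t) (hτ : 0 < τ) (V : E → ℝ) (a x : E) :
    heat τ (fun y => V (a + t⁻¹ • y)) x = heat ((t ^ 2)⁻¹ * τ) V (a + t⁻¹ • x) := by
  rw [heat_eq', heat_eq']
  simp_rw [← heatKernel_smul ht hτ]
  have h := Measure.integral_comp_smul (volume : Measure E)
    (fun z => heatKernel E τ (t • z) * V (a + t⁻¹ • x + z)) t⁻¹
  simp_rw [smul_inv_smul₀ ht.ne'] at h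
  simp_rw [smul_add, ← add_assoc]
  rw [h, smul_eq_mul, ← integral_const_mul, inv_pow, inv_inv, abs_of_pos (by positivity)]
  simp_rw [mul_assoc]

theorem IsHeatSupersolution.dilate {V : E → ℝ} {a : E} {r : ℝ}
    (h : IsHeatSupersolution s k (Metric.ball a r) V) {t : ℝ} (ht : 1 ≤ t) :
    IsHeatSupersolution s (((t ^ 2)⁻¹) ^ s * k) (Metric.ball 0 (t * r))
      fun x => V (a + t⁻¹ • x) := by
  have ht0 : 0 < t := by linarith
  have hmem : ∀ x ∈ Metric.ball (0 : E) (t * r), a + t⁻¹ • x ∈ Metric.ball a r := by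
    intro x hx
    rw [mem_ball_zero_iff] at hx
    rw [mem_ball_iff_norm, add_sub_cancel_left, norm_smul, Real.norm_of_nonneg (by positivity),
      inv_mul_lt_iff₀ ht0]
    exact hx
  obtain ⟨M, hM⟩ := h.bound
  obtain ⟨K, hK⟩ := h.sub_heat
  refine ⟨h.continuous.comp (by fun_prop), fun x => h.nonneg _, ⟨M, fun x => hM _⟩,
    ⟨K, fun τ hτ x => ?_⟩, fun x hx => h.pos _ (hmem x hx), fun x hx => ?_⟩
  · have hK0 : 0 ≤ K := by
      have := (abs_nonneg _).trans (hK 1 one_pos a)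
      simpa using this
    rw [heat_dilate ht0 hτ]
    refine (hK _ (by positivity) _).trans ?_
    have : (t ^ 2)⁻¹ * τ ≤ τ :=
      mul_le_of_le_one_left hτ.le (inv_le_one_of_one_le₀ (one_le_pow₀ ht))
    gcongr
  · have h1 := h.le _ (hmem x hx)
    set b := (t ^ 2)⁻¹ with hb
    have hb0 : 0 < b := by positivity
    set y := a + t⁻¹ • x
    have h2 := integral_comp_mul_left_Ioi
      (fun σ => σ ^ (-1 - s) * (V y - heat σ V y)) 0 hb0
    rw [mul_zero, smul_eq_mul] at h2
    have h3 : ∫ τ in Ioi 0, τ ^ (-1 - s) * (V y - heat τ (fun y => V (a + t⁻¹ • y)) x) =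
        b ^ s * ∫ σ in Ioi 0, σ ^ (-1 - s) * (V y - heat σ V y) := by
      have h4 : b ^ s = b ^ (1 + s) * b⁻¹ := by
        rw [← Real.rpow_neg_one, ← Real.rpow_add hb0]; ring_nf
      rw [h4, mul_assoc, ← h2, ← integral_const_mul]
      refine setIntegral_congr_fun measurableSet_Ioi fun τ hτ => ?_
      have hτ0 : 0 < τ := hτ
      rw [heat_dilate ht0 hτ0, Real.mul_rpow hb0.le hτ0.le, ← mul_assoc, ← mul_assoc,
        ← Real.rpow_add hb0, add_comm (1 + s), ← hb]
      simp [show a + t⁻¹ • x = y from rfl]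
    rw [h3, mul_assoc]
    gcongr

theorem integrable_indicator_sq_div {m : ℝ} (hWm : Measurable W) (hB : MeasurableSet B)
    (hm : 0 < m) (hWB : ∀ x ∈ B, m ≤ W x) (hu : MemLp u 2) :
    Integrable (B.indicator fun x => u x ^ 2 / W x) := by
  refine (hu.integrable_sq.const_mul m⁻¹).mono'
    (AEStronglyMeasurable.indicator (by
      simp_rw [div_eq_mul_inv]
      exact hu.integrable_sq.aestronglyMeasurable.mul hWm.inv.aestronglyMeasurable) hB)
    (ae_of_all _ fun x => ?_)
  by_cases hx : x ∈ B
  · have := hWB x hx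
    rw [indicator_of_mem hx, Real.norm_of_nonneg (div_nonneg (sq_nonneg _) (by linarith)),
      div_eq_inv_mul]
    gcongr
  · rw [indicator_of_notMem hx, norm_zero]
    positivity

/-- Discrete Picone inequality, integrated against the heat kernel. -/
theorem two_mul_integral_sub_heat_le {τ m : ℝ} (hτ : 0 < τ) (hWm : Measurable W)
    (hW0 : ∀ x, 0 ≤ W x) (hM : ∀ x, |W x| ≤ M) (hB : MeasurableSet B) (hm : 0 < m)
    (hWB : ∀ x ∈ B, m ≤ W x) (hu : MemLp u 2) (huB : ∀ᵐ x, x ∉ B → u x = 0) :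
    2 * ∫ x, B.indicator (fun x => u x ^ 2 / W x) x * (W x - heat τ W x) ≤
      ∫ p : E × E, heatKernel E τ (p.1 - p.2) * (u p.1 - u p.2) ^ 2 := by
  set ψ := B.indicator fun x => u x ^ 2 / W x with hψ
  have hψi : Integrable ψ := integrable_indicator_sq_div hWm hB hm hWB hu
  have hψ0 : ∀ x, 0 ≤ ψ x := fun x =>
    indicator_nonneg (fun x _ => div_nonneg (sq_nonneg _) (hW0 x)) x
  have hψW : ∀ᵐ x, ψ x * W x = u x ^ 2 := by
    filter_upwards [huB] with x hx
    by_cases hxB : x ∈ B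
    · rw [hψ, indicator_of_mem hxB, div_mul_cancel₀ _ (hm.trans_le (hWB x hxB)).ne']
    · rw [hψ, indicator_of_notMem hxB, hx hxB]; simp
  have i1 := integrable_heatKernel_mul_prod hτ hu.integrable_sq (φ := fun _ : E => (1 : ℝ))
    aestronglyMeasurable_const (M := 1) (by simp)
  have i2 := i1.swap
  have i3 := integrable_heatKernel_mul_prod hτ hψi hWm.aestronglyMeasurable hM
  have i4 := i3.swap
  have e1 : ∫ p : E × E, u p.1 ^ 2 * (heatKernel E τ (p.1 - p.2) * 1) = ∫ x, u x ^ 2 := by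
    rw [Measure.volume_eq_prod, integral_prod _ i1]
    simp only [mul_one, integral_const_mul, integral_heatKernel_sub hτ]
  have e2 : ∫ p : E × E, u p.2 ^ 2 * (heatKernel E τ (p.2 - p.1) * 1) = ∫ x, u x ^ 2 := by
    rw [← e1]
    exact integral_prod_swap (fun p : E × E => u p.1 ^ 2 * (heatKernel E τ (p.1 - p.2) * 1))
  have e3 : ∫ p : E × E, ψ p.1 * (heatKernel E τ (p.1 - p.2) * W p.2) =
      ∫ x, ψ x * heat τ W x := by
    rw [Measure.volume_eq_prod, integral_prod _ i3]
    simp only [integral_const_mul, heat]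
  have e4 : ∫ p : E × E, ψ p.2 * (heatKernel E τ (p.2 - p.1) * W p.1) =
      ∫ x, ψ x * heat τ W x := by
    rw [← e3]
    exact integral_prod_swap (fun p : E × E => ψ p.1 * (heatKernel E τ (p.1 - p.2) * W p.2))
  have hum : AEStronglyMeasurable (fun p : E × E =>
      heatKernel E τ (p.1 - p.2) * (u p.1 - u p.2) ^ 2) (volume.prod volume) :=
    ((continuous_heatKernel τ).comp
      (continuous_fst.sub continuous_snd)).aestronglyMeasurable.mul
      ((hu.aestronglyMeasurable.comp_fst.sub hu.aestronglyMeasurable.comp_snd).pow 2)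
  have i5 : Integrable (fun p : E × E => heatKernel E τ (p.1 - p.2) * (u p.1 - u p.2) ^ 2)
      (volume.prod volume) := by
    refine ((i1.add i2).const_mul 2).mono' hum (ae_of_all _ fun p => ?_)
    have hg := (heatKernel_pos hτ (p.1 - p.2)).le
    rw [Real.norm_of_nonneg (mul_nonneg hg (sq_nonneg _))]
    simp only [Pi.add_apply, Function.comp_apply, Prod.fst_swap, Prod.snd_swap, mul_one]
    rw [heatKernel_sub_comm τ p.2 p.1]
    nlinarith [mul_nonneg hg (sq_nonneg (u p.1 + u p.2))]
  have hfst : ∀ᵐ p : E × E ∂(volume.prod volume), ψ p.1 * W p.1 = u p.1 ^ 2 :=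
    Measure.quasiMeasurePreserving_fst.ae hψW
  have hsnd : ∀ᵐ p : E × E ∂(volume.prod volume), ψ p.2 * W p.2 = u p.2 ^ 2 :=
    Measure.quasiMeasurePreserving_snd.ae hψW
  have hmono := integral_mono_ae ((i1.add i2).sub (i3.add i4)) i5 (by
    filter_upwards [hfst, hsnd] with p h1 h2
    have hg := (heatKernel_pos hτ (p.1 - p.2)).le
    simp only [Pi.add_apply, Pi.sub_apply, Function.comp_apply, Prod.fst_swap, Prod.snd_swap,
      mul_one]
    rw [heatKernel_sub_comm τ p.2 p.1]
    have h3 : 2 * (u p.1 * u p.2) ≤ ψ p.1 * W p.2 + ψ p.2 * W p.1 := by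
      have ha : 0 ≤ ψ p.1 * W p.2 := mul_nonneg (hψ0 _) (hW0 _)
      have hb : 0 ≤ ψ p.2 * W p.1 := mul_nonneg (hψ0 _) (hW0 _)
      have hab : (u p.1 * u p.2) ^ 2 = (ψ p.1 * W p.2) * (ψ p.2 * W p.1) := by
        rw [mul_pow, ← h1, ← h2]; ring
      refine le_of_abs_le (abs_le_of_sq_le_sq' ?_ (by positivity) |> abs_le.2)
      nlinarith [sq_nonneg (ψ p.1 * W p.2 - ψ p.2 * W p.1)]
    nlinarith [mul_le_mul_of_nonneg_left h3 hg])
  rw [integral_sub' (i1.add i2) (i3.add i4), integral_add' i1 i2, integral_add' i3 i4] at hmono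
  simp only [Function.comp_apply, Prod.fst_swap, Prod.snd_swap] at hmono
  rw [← Measure.volume_eq_prod, e1, e2, e3, e4] at hmono
  have e5 : ∫ x, ψ x * (W x - heat τ W x) = (∫ x, u x ^ 2) - ∫ x, ψ x * heat τ W x := by
    simp_rw [mul_sub]
    rw [integral_sub (hψi.mul_bdd (c := M) hWm.aestronglyMeasurable (ae_of_all _ hM))
      (integrable_mul_heat hψi hWm hM hτ), integral_congr_ae hψW]
  rw [e5]
  linarith

theorem two_mul_integral_sq_le_energy (hs0 : 0 < s) (hs1 : s < 1)
    (h : IsHeatSupersolution s k B W) {m : ℝ} (hB : MeasurableSet B) (hm : 0 < m)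
    (hWB : ∀ x ∈ B, m ≤ W x) (hu : MemLp u 2) (huB : ∀ᵐ x, x ∉ B → u x = 0)
    (hi : Integrable fun p : E × E =>
      (u p.1 - u p.2) ^ 2 / ‖p.1 - p.2‖ ^ ((finrank ℝ E : ℝ) + 2 * s)) :
    2 * (k * ∫ x, u x ^ 2) ≤ (∫ σ in Ioi 0, heatWeight E s σ) *
      ∫ p : E × E, (u p.1 - u p.2) ^ 2 / ‖p.1 - p.2‖ ^ ((finrank ℝ E : ℝ) + 2 * s) := by
  obtain ⟨M, hM⟩ := h.bound
  obtain ⟨K, hK⟩ := h.sub_heat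
  have hWm := h.continuous.measurable
  set ψ := B.indicator fun x => u x ^ 2 / W x with hψ
  have hψi : Integrable ψ := integrable_indicator_sq_div hWm hB hm hWB hu
  have hψ0 : ∀ x, 0 ≤ ψ x := fun x =>
    indicator_nonneg (fun x _ => div_nonneg (sq_nonneg _) (h.nonneg x)) x
  have hψW : (fun x => ψ x * W x) =ᵐ[volume] fun x => u x ^ 2 := by
    filter_upwards [huB] with x hx
    by_cases hxB : x ∈ B
    · rw [hψ, indicator_of_mem hxB, div_mul_cancel₀ _ (hm.trans_le (hWB x hxB)).ne']
    · rw [hψ, indicator_of_notMem hxB, hx hxB]; simp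
  set CK := ∫ σ in Ioi 0, heatWeight E s σ
  have hum : AEStronglyMeasurable (fun p : E × E => (u p.1 - u p.2) ^ 2)
      (volume.prod volume) :=
    (hu.aestronglyMeasurable.comp_fst.sub hu.aestronglyMeasurable.comp_snd).pow 2
  -- the energy as an integral over the semigroup parameter
  set Φ : ℝ × (E × E) → ℝ := fun q => q.1 ^ (-1 - s) *
    (heatKernel E q.1 (q.2.1 - q.2.2) * (u q.2.1 - u q.2.2) ^ 2) with hΦ
  have hΦm : AEStronglyMeasurable Φ
      ((volume.restrict (Ioi 0)).prod (volume.prod volume)) := by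
    refine AEStronglyMeasurable.mul (by fun_prop :
      Measurable fun q : ℝ × (E × E) => q.1 ^ (-1 - s)).aestronglyMeasurable ?_
    exact (measurable_heatKernel.comp (by fun_prop : Measurable fun q : ℝ × (E × E) =>
      (q.1, q.2.1 - q.2.2))).aestronglyMeasurable.mul hum.comp_snd
  have hΦe : ∀ p : E × E, (fun τ => Φ (τ, p)) = fun τ => (u p.1 - u p.2) ^ 2 *
      (τ ^ (-1 - s) * heatKernel E τ (p.1 - p.2)) := fun p => by
    ext τ; rw [hΦ]; simp only; ring
  have hΦI : ∀ p : E × E, ∫ τ in Ioi 0, Φ (τ, p) =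
      CK * ((u p.1 - u p.2) ^ 2 / ‖p.1 - p.2‖ ^ ((finrank ℝ E : ℝ) + 2 * s)) := by
    intro p
    rw [hΦe, integral_const_mul]
    rcases eq_or_ne p.1 p.2 with hp | hp
    · simp [hp]
    · rw [integral_Ioi_rpow_mul_heatKernel le_rfl (sub_ne_zero.2 hp), zero_div]
      ring
  have hΦi : Integrable Φ ((volume.restrict (Ioi 0)).prod (volume.prod volume)) := by
    refine (integrable_prod_iff' hΦm).2 ⟨ae_of_all _ fun p => ?_, ?_⟩
    · rw [hΦe]
      rcases eq_or_ne p.1 p.2 with hp | hp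
      · simp [hp]
      · exact (integrableOn_rpow_mul_heatKernel hs0 hs1 (sub_ne_zero.2 hp)).const_mul _
    · refine (hi.const_mul CK).congr (ae_of_all _ fun p => ?_)
      simp only
      rw [← hΦI]
      refine setIntegral_congr_fun measurableSet_Ioi fun τ hτ => ?_
      have hτ0 : 0 < τ := hτ
      refine (Real.norm_of_nonneg ?_).symm
      exact mul_nonneg (by positivity) (mul_nonneg (heatKernel_pos hτ0 _).le (sq_nonneg _))
  have hsw : ∫ τ in Ioi 0, ∫ p : E × E, Φ (τ, p) = CK * ∫ p : E × E,
      (u p.1 - u p.2) ^ 2 / ‖p.1 - p.2‖ ^ ((finrank ℝ E : ℝ) + 2 * s) := by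
    rw [integral_integral_swap hΦi, ← integral_const_mul]
    exact integral_congr_ae (ae_of_all _ hΦI)
  -- the tested supersolution as an integral over the semigroup parameter
  set Ψ : ℝ × E → ℝ := fun q => q.1 ^ (-1 - s) * (ψ q.2 * (W q.2 - heat q.1 W q.2)) with hΨ
  have hΨi : Integrable Ψ ((volume.restrict (Ioi 0)).prod volume) := by
    refine ((integrableOn_rpow_mul_min hs0 hs1).mul_prod (hψi.const_mul K)).mono' ?_ ?_
    · refine AEStronglyMeasurable.mul (by fun_prop :
        Measurable fun q : ℝ × E => q.1 ^ (-1 - s)).aestronglyMeasurable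
        (hψi.aestronglyMeasurable.comp_snd.mul (Measurable.aestronglyMeasurable ?_))
      exact (hWm.comp measurable_snd).sub (stronglyMeasurable_heat hWm).measurable
    · have : ∀ᵐ q : ℝ × E ∂((volume.restrict (Ioi 0)).prod volume), q.1 ∈ Ioi (0 : ℝ) :=
        Measure.quasiMeasurePreserving_fst.ae (ae_restrict_mem measurableSet_Ioi)
      filter_upwards [this] with q hq
      have hq0 : 0 < q.1 := hq
      rw [hΨ, norm_mul, norm_mul, Real.norm_of_nonneg (hψ0 _), Real.norm_of_nonneg (by positivity)]
      calc q.1 ^ (-1 - s) * (ψ q.2 * ‖W q.2 - heat q.1 W q.2‖) ≤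
            q.1 ^ (-1 - s) * (ψ q.2 * (K * min q.1 1)) := by
            have := hψ0 q.2
            gcongr
            exact hK _ hq0 _
        _ = _ := by ring
  have hΨsw : k * ∫ x, u x ^ 2 ≤ ∫ τ in Ioi 0, ∫ x, Ψ (τ, x) := by
    rw [integral_integral_swap hΨi, ← integral_congr_ae hψW, ← integral_const_mul]
    refine integral_mono ((hu.integrable_sq.congr hψW.symm).const_mul k)
      hΨi.integral_prod_right fun x => ?_
    simp only [hΨ]
    have e : ∀ τ : ℝ, τ ^ (-1 - s) * (ψ x * (W x - heat τ W x)) =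
        ψ x * (τ ^ (-1 - s) * (W x - heat τ W x)) := fun τ => by ring
    simp_rw [e]
    rw [integral_const_mul]
    by_cases hxB : x ∈ B
    · have := mul_le_mul_of_nonneg_left (h.le x hxB) (hψ0 x)
      linarith
    · have : ψ x = 0 := indicator_of_notMem hxB _
      rw [this]; simp
  rw [← hsw]
  refine (mul_le_mul_of_nonneg_left hΨsw two_pos.le).trans ?_
  rw [← integral_const_mul]
  refine setIntegral_mono_on (hΨi.integral_prod_left.const_mul 2) hΦi.integral_prod_left
    measurableSet_Ioi fun τ hτ => ?_
  have hτ0 : 0 < τ := hτ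
  simp only [hΨ, hΦ]
  rw [integral_const_mul, integral_const_mul, mul_left_comm]
  refine mul_le_mul_of_nonneg_left ?_ (by positivity)
  exact two_mul_integral_sub_heat_le hτ0 hWm h.nonneg hM hB hm hWB hu huB

end

noncomputable section

open MeasureTheory Filter Topology Set Module
open scoped Pointwise

set_option linter.unusedSectionVars false

variable {E : Type*} [NormedAddCommGroup E] [InnerProductSpace ℝ E] [FiniteDimensional ℝ E]
  [MeasurableSpace E] [BorelSpace E]

variable {s M c L r ε : ℝ} {w : E → ℝ}

theorem integrableOn_one_div_norm_sub_rpow [Nontrivial E] (hs : 0 < s) (x : E) (hε : 0 < ε) :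
    IntegrableOn (fun y : E => 1 / ‖x - y‖ ^ ((finrank ℝ E : ℝ) + 2 * s))
      (Metric.ball x ε)ᶜ := by
  have hm : MeasurableSet (Metric.ball x ε)ᶜ := Metric.isOpen_ball.measurableSet.compl
  rw [← integrable_indicator_iff hm]
  refine (((integrable_indicator_iff Metric.isOpen_ball.measurableSet.compl).2
    (integrableOn_inv_norm_rpow (E := E) hs hε)).comp_sub_left x).congr (ae_of_all _ fun y => ?_)
  simp [indicator, dist_eq_norm, norm_sub_rev y x]

theorem integrableOn_div_norm_sub_rpow [Nontrivial E] (hs : 0 < s) (hw : AEStronglyMeasurable w)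
    (hM : ∀ᵐ y, |w y| ≤ M) (x : E) (hε : 0 < ε) :
    IntegrableOn (fun y : E => w y / ‖x - y‖ ^ ((finrank ℝ E : ℝ) + 2 * s))
      (Metric.ball x ε)ᶜ := by
  refine ((integrableOn_one_div_norm_sub_rpow hs x hε).bdd_mul (c := M) hw.restrict
    (ae_restrict_of_ae hM)).congr (ae_of_all _ fun y => ?_)
  simp only
  rw [mul_one_div]

theorem tendsto_integral_one_div_norm_sub_rpow [Nontrivial E] (hs : 0 < s) (x : E) :
    Tendsto (fun ε => ∫ y in (Metric.ball x ε)ᶜ, 1 / ‖x - y‖ ^ ((finrank ℝ E : ℝ) + 2 * s))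
      (𝓝[>] 0) atTop := by
  set a := ∫ z in (Metric.ball (0 : E) 1)ᶜ, 1 / ‖z‖ ^ ((finrank ℝ E : ℝ) + 2 * s) with ha
  have hm1 : MeasurableSet (Metric.ball (0 : E) 1)ᶜ := Metric.isOpen_ball.measurableSet.compl
  have ha0 : 0 < a := by
    refine (setIntegral_pos_iff_support_of_nonneg_ae (ae_of_all _ fun z => by positivity)
      (integrableOn_inv_norm_rpow hs one_pos)).2 ?_
    obtain ⟨z, hz⟩ := NormedSpace.exists_lt_norm ℝ E 1
    refine (Metric.isClosed_closedBall.isOpen_compl.measure_pos volume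
      ⟨z, by simpa using hz⟩).trans_le
      (measure_mono (s := (Metric.closedBall (0 : E) 1)ᶜ) fun y hy => ?_)
    have hy1 : 1 < ‖y‖ := by simpa using hy
    have : ‖y‖ ^ ((finrank ℝ E : ℝ) + 2 * s) ≠ 0 := (Real.rpow_pos_of_pos (by linarith) _).ne'
    exact ⟨by simpa using this, by simpa using hy1.le⟩
  have hsc : ∀ ε ∈ Ioi (0 : ℝ), ε ^ (-(2 * s)) * a =
      ∫ y in (Metric.ball x ε)ᶜ, 1 / ‖x - y‖ ^ ((finrank ℝ E : ℝ) + 2 * s) := by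
    intro ε hε
    have hε0 : 0 < ε := hε
    have h1 : ∫ y in (Metric.ball x ε)ᶜ, 1 / ‖x - y‖ ^ ((finrank ℝ E : ℝ) + 2 * s) =
        ∫ z in (Metric.ball (0 : E) ε)ᶜ, 1 / ‖z‖ ^ ((finrank ℝ E : ℝ) + 2 * s) := by
      rw [← integral_indicator Metric.isOpen_ball.measurableSet.compl,
        ← integral_indicator Metric.isOpen_ball.measurableSet.compl,
        ← integral_sub_left_eq_self _ volume x]
      refine integral_congr_ae (ae_of_all _ fun y => ?_)
      simp [indicator, dist_eq_norm]
    have h2 := Measure.setIntegral_comp_smul_of_pos (volume : Measure E)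
      (fun z => 1 / ‖z‖ ^ ((finrank ℝ E : ℝ) + 2 * s)) (Metric.ball (0 : E) 1)ᶜ hε0
    have h3 : ε • (Metric.ball (0 : E) 1)ᶜ = (ε • Metric.ball (0 : E) 1)ᶜ :=
      Set.smul_set_compl (a := Units.mk0 ε hε0.ne')
    rw [h3, smul_unitBall_of_pos hε0, ← h1, smul_eq_mul] at h2
    rw [eq_inv_mul_iff_mul_eq₀ (by positivity)] at h2
    rw [← h2, ha, ← integral_const_mul, ← integral_const_mul]
    refine setIntegral_congr_fun hm1 fun z _ => ?_
    rw [norm_smul, Real.norm_of_nonneg hε0.le, Real.mul_rpow hε0.le (norm_nonneg _), Real.rpow_add hε0,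
      Real.rpow_natCast, Real.rpow_neg hε0.le]
    field_simp
  refine Tendsto.congr' (eventually_of_mem self_mem_nhdsWithin hsc) ?_
  exact (tendsto_rpow_neg_nhdsGT_zero (by linarith)).atTop_mul_const ha0

theorem setIntegral_sub_div_norm_sub_rpow [Nontrivial E] (hs : 0 < s)
    (hw : AEStronglyMeasurable w) (hM : ∀ᵐ y, |w y| ≤ M) (c : ℝ) (x : E) (hε : 0 < ε) :
    ∫ y in (Metric.ball x ε)ᶜ, (c - w y) / ‖x - y‖ ^ ((finrank ℝ E : ℝ) + 2 * s) =
      c * (∫ y in (Metric.ball x ε)ᶜ, 1 / ‖x - y‖ ^ ((finrank ℝ E : ℝ) + 2 * s)) -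
        ∫ y in (Metric.ball x ε)ᶜ, w y / ‖x - y‖ ^ ((finrank ℝ E : ℝ) + 2 * s) := by
  rw [← integral_const_mul, ← integral_sub
    ((integrableOn_one_div_norm_sub_rpow hs x hε).const_mul c)
    (integrableOn_div_norm_sub_rpow hs hw hM x hε)]
  refine integral_congr_ae (ae_of_all _ fun y => ?_)
  simp only
  ring

theorem setIntegral_div_norm_sub_rpow_nonneg (h0 : ∀ᵐ y, 0 ≤ w y) (S : Set E) (x : E) :
    0 ≤ ∫ y in S, w y / ‖x - y‖ ^ ((finrank ℝ E : ℝ) + 2 * s) :=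
  integral_nonneg_of_ae (ae_restrict_of_ae (h0.mono fun y hy => div_nonneg hy (by positivity)))

theorem nonneg_of_tendsto_setIntegral [Nontrivial E] (hs : 0 < s) (hw : AEStronglyMeasurable w)
    (hM : ∀ᵐ y, |w y| ≤ M) (h0 : ∀ᵐ y, 0 ≤ w y) {x : E}
    (hL : Tendsto (fun ε => ∫ y in (Metric.ball x ε)ᶜ,
      (c - w y) / ‖x - y‖ ^ ((finrank ℝ E : ℝ) + 2 * s)) (𝓝[>] 0) (𝓝 L)) : 0 ≤ c := by
  by_contra! hc
  refine not_tendsto_nhds_of_tendsto_atBot (tendsto_atBot_mono' _ ?_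
    ((tendsto_integral_one_div_norm_sub_rpow hs x).const_mul_atTop_of_neg hc)) L hL
  filter_upwards [self_mem_nhdsWithin] with ε hε
  rw [setIntegral_sub_div_norm_sub_rpow hs hw hM c x hε]
  have := setIntegral_div_norm_sub_rpow_nonneg (s := s) h0 (Metric.ball x ε)ᶜ x
  linarith

theorem setIntegral_compl_ball_eq {g : E → ℝ} {x : E} (hεr : ε ≤ r)
    (hg : ∀ᵐ y, y ∈ Metric.ball x r → g y = 0) :
    ∫ y in (Metric.ball x ε)ᶜ, g y = ∫ y in (Metric.ball x r)ᶜ, g y := by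
  rw [← integral_indicator Metric.isOpen_ball.measurableSet.compl,
    ← integral_indicator Metric.isOpen_ball.measurableSet.compl]
  refine integral_congr_ae ?_
  filter_upwards [hg] with y hy
  by_cases h : y ∈ Metric.ball x r
  · simp [indicator, hy h]
  · rw [indicator_of_mem (s := (Metric.ball x r)ᶜ) h,
      indicator_of_mem (s := (Metric.ball x ε)ᶜ) fun h' => h (Metric.ball_subset_ball hεr h')]

theorem eq_zero_of_tendsto_setIntegral [Nontrivial E] (hs : 0 < s) (hw : AEStronglyMeasurable w)
    (hM : ∀ᵐ y, |w y| ≤ M) (h0 : ∀ᵐ y, 0 ≤ w y) {x : E} (hr : 0 < r)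
    (hwr : ∀ᵐ y, y ∈ Metric.ball x r → w y = 0)
    (hL : Tendsto (fun ε => ∫ y in (Metric.ball x ε)ᶜ,
      (c - w y) / ‖x - y‖ ^ ((finrank ℝ E : ℝ) + 2 * s)) (𝓝[>] 0) (𝓝 L)) :
    c = 0 ∧ L = -∫ y in (Metric.ball x r)ᶜ, w y / ‖x - y‖ ^ ((finrank ℝ E : ℝ) + 2 * s) := by
  have hc := nonneg_of_tendsto_setIntegral hs hw hM h0 hL
  set b := ∫ y in (Metric.ball x r)ᶜ, w y / ‖x - y‖ ^ ((finrank ℝ E : ℝ) + 2 * s)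
  have hwr' : ∀ᵐ y, y ∈ Metric.ball x r →
      w y / ‖x - y‖ ^ ((finrank ℝ E : ℝ) + 2 * s) = 0 := by
    filter_upwards [hwr] with y hy h
    rw [hy h, zero_div]
  have he : ∀ᶠ ε in 𝓝[>] 0, ∫ y in (Metric.ball x ε)ᶜ,
      (c - w y) / ‖x - y‖ ^ ((finrank ℝ E : ℝ) + 2 * s) =
      c * (∫ y in (Metric.ball x ε)ᶜ, 1 / ‖x - y‖ ^ ((finrank ℝ E : ℝ) + 2 * s)) + -b := by
    filter_upwards [Ioc_mem_nhdsGT hr] with ε hε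
    rw [setIntegral_sub_div_norm_sub_rpow hs hw hM c x hε.1, ← sub_eq_add_neg,
      setIntegral_compl_ball_eq (g := fun y => w y / ‖x - y‖ ^ ((finrank ℝ E : ℝ) + 2 * s)) hε.2 hwr']
  have hL' := hL.congr' he
  have hc0 : c = 0 := by
    by_contra hne
    exact not_tendsto_nhds_of_tendsto_atTop (tendsto_atTop_add_const_right _ _
      ((tendsto_integral_one_div_norm_sub_rpow hs x).const_mul_atTop (hc.lt_of_ne' hne))) L hL'
  refine ⟨hc0, ?_⟩
  simp only [hc0, zero_mul, zero_add] at hL'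
  exact tendsto_nhds_unique hL' tendsto_const_nhds

/-- Cutting off a nonnegative function away from `x` increases its fractional Laplacian at `x`. -/
theorem exists_tendsto_setIntegral_of_eq_on_ball [Nontrivial E] (hs : 0 < s)
    (hw : AEStronglyMeasurable w) (hM : ∀ᵐ y, |w y| ≤ M) {v : E → ℝ}
    (hv : AEStronglyMeasurable v) (hMv : ∀ᵐ y, |v y| ≤ M) (hvw : ∀ᵐ y, v y ≤ w y)
    {x : E} (hr : 0 < r) (hwr : ∀ᵐ y, y ∈ Metric.ball x r → v y = w y)
    (hL : Tendsto (fun ε => ∫ y in (Metric.ball x ε)ᶜ,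
      (c - w y) / ‖x - y‖ ^ ((finrank ℝ E : ℝ) + 2 * s)) (𝓝[>] 0) (𝓝 L)) :
    ∃ F, L ≤ F ∧ Tendsto (fun ε => ∫ y in (Metric.ball x ε)ᶜ,
      (c - v y) / ‖x - y‖ ^ ((finrank ℝ E : ℝ) + 2 * s)) (𝓝[>] 0) (𝓝 F) := by
  set b := ∫ y in (Metric.ball x r)ᶜ, (w y - v y) / ‖x - y‖ ^ ((finrank ℝ E : ℝ) + 2 * s)
  have hb : 0 ≤ b := setIntegral_div_norm_sub_rpow_nonneg (w := fun y => w y - v y)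
    (hvw.mono fun y hy => sub_nonneg.2 hy) _ x
  refine ⟨L + b, by linarith, (hL.add_const b).congr' ?_⟩
  filter_upwards [Ioc_mem_nhdsGT hr] with ε hε
  have e : b = ∫ y in (Metric.ball x ε)ᶜ,
      (w y - v y) / ‖x - y‖ ^ ((finrank ℝ E : ℝ) + 2 * s) := by
    refine (setIntegral_compl_ball_eq hε.2 ?_).symm
    filter_upwards [hwr] with y hy h
    rw [hy h, sub_self, zero_div]
  rw [e, setIntegral_sub_div_norm_sub_rpow hs hw hM c x hε.1,
    setIntegral_sub_div_norm_sub_rpow hs hv hMv c x hε.1]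
  simp_rw [sub_div]
  rw [integral_sub (integrableOn_div_norm_sub_rpow hs hw hM x hε.1)
    (integrableOn_div_norm_sub_rpow hs hv hMv x hε.1)]
  ring

end

noncomputable section

open MeasureTheory Filter Topology Set Module

set_option linter.unusedSectionVars false

variable {E : Type*} [NormedAddCommGroup E] [InnerProductSpace ℝ E] [FiniteDimensional ℝ E]
  [MeasurableSpace E] [BorelSpace E]

variable {s R : ℝ}

/-- The tent function of the ball of radius `R`. -/
def tent (R : ℝ) (x : E) : ℝ := max (1 - ‖x‖ / R) 0

theorem continuous_tent (R : ℝ) : Continuous (tent R : E → ℝ) := by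
  unfold tent; fun_prop

theorem tent_nonneg (R : ℝ) (x : E) : 0 ≤ tent R x := le_max_right _ _

theorem tent_le_one (hR : 0 < R) (x : E) : tent R x ≤ 1 :=
  max_le (by have : 0 ≤ ‖x‖ / R := by positivity
             linarith) zero_le_one

theorem tent_eq_zero (hR : 0 < R) {x : E} (hx : x ∉ Metric.ball (0 : E) R) : tent R x = 0 := by
  refine max_eq_right ?_
  rw [mem_ball_zero_iff, not_lt] at hx
  rw [sub_nonpos, one_le_div hR]
  exact hx

theorem hasCompactSupport_tent (hR : 0 < R) : HasCompactSupport (tent R : E → ℝ) :=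
  HasCompactSupport.intro (isCompact_closedBall (0 : E) R) fun _ hx =>
    tent_eq_zero hR fun h => hx (Metric.ball_subset_closedBall h)

theorem memLp_tent (hR : 0 < R) : MemLp (tent R : E → ℝ) 2 :=
  (continuous_tent R).memLp_of_hasCompactSupport (hasCompactSupport_tent hR)

theorem integral_tent_sq (hR : 0 < R) :
    ∫ x : E, tent R x ^ 2 = R ^ finrank ℝ E * ∫ x : E, tent 1 x ^ 2 := by
  have h := Measure.integral_comp_inv_smul_of_nonneg (volume : Measure E)
    (fun x => tent 1 x ^ 2) hR.le
  rw [smul_eq_mul] at h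
  rw [← h]
  refine integral_congr_ae (ae_of_all _ fun x => ?_)
  simp only [tent, norm_smul, norm_inv, Real.norm_of_nonneg hR.le, div_one]
  rw [div_eq_inv_mul]

theorem integral_tent_one_sq_pos : 0 < ∫ x : E, tent 1 x ^ 2 :=
  integral_pos_of_integrable_nonneg_nonzero (x := 0) ((continuous_tent 1).pow 2)
    (memLp_tent one_pos).integrable_sq (fun _ => sq_nonneg _) (by simp [tent])

theorem sq_tent_sub_le (hR : 0 < R) (x y : E) :
    (tent R x - tent R y) ^ 2 ≤ min ((‖x - y‖ / R) ^ 2) 1 *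
      ((Metric.ball 0 R).indicator 1 x + (Metric.ball 0 R).indicator 1 y) := by
  have h0 : (tent R x - tent R y) ^ 2 ≤ min ((‖x - y‖ / R) ^ 2) 1 := by
    refine le_min ?_ ?_
    · refine sq_le_sq' ?_ ?_
      · have h1 := norm_sub_norm_le x y
        have h2 : ‖x‖ / R - ‖y‖ / R ≤ ‖x - y‖ / R := by rw [← sub_div]; gcongr
        have h3 : 0 ≤ ‖x - y‖ / R := by positivity
        unfold tent
        rcases max_cases (1 - ‖x‖ / R) 0 with h | h <;>
          rcases max_cases (1 - ‖y‖ / R) 0 with h' | h' <;> linarith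
      · have h1 := norm_sub_norm_le y x
        rw [norm_sub_rev] at h1
        have h2 : ‖y‖ / R - ‖x‖ / R ≤ ‖x - y‖ / R := by rw [← sub_div]; gcongr
        have h3 : 0 ≤ ‖x - y‖ / R := by positivity
        unfold tent
        rcases max_cases (1 - ‖x‖ / R) 0 with h | h <;>
          rcases max_cases (1 - ‖y‖ / R) 0 with h' | h' <;> linarith
    · have := tent_nonneg R x
      have := tent_nonneg R y
      have := tent_le_one hR x
      have := tent_le_one hR y
      nlinarith
  have hm : 0 ≤ min ((‖x - y‖ / R) ^ 2) 1 := by positivity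
  by_cases hx : x ∈ Metric.ball (0 : E) R
  · refine h0.trans (le_mul_of_one_le_right hm ?_)
    rw [indicator_of_mem hx, Pi.one_apply]
    exact le_add_of_nonneg_right (indicator_nonneg (fun _ _ => zero_le_one) _)
  · by_cases hy : y ∈ Metric.ball (0 : E) R
    · refine h0.trans (le_mul_of_one_le_right hm ?_)
      rw [indicator_of_mem hy, Pi.one_apply]
      exact le_add_of_nonneg_left (indicator_nonneg (fun _ _ => zero_le_one) _)
    · rw [tent_eq_zero hR hx, tent_eq_zero hR hy, indicator_of_notMem hx, indicator_of_notMem hy]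
      simp

theorem integrable_min_div_norm_rpow [Nontrivial E] (hs0 : 0 < s) (hs1 : s < 1) :
    Integrable fun z : E => min (‖z‖ ^ 2) 1 / ‖z‖ ^ ((finrank ℝ E : ℝ) + 2 * s) := by
  refine (integrable_fun_norm_addHaar (E := E) volume
    (f := fun r => min (r ^ 2) 1 / r ^ ((finrank ℝ E : ℝ) + 2 * s))).2 ?_
  have h1 : 1 ≤ finrank ℝ E := finrank_pos
  have e : ∀ r : ℝ, 0 < r → r ^ (finrank ℝ E - 1) •
      (min (r ^ 2) 1 / r ^ ((finrank ℝ E : ℝ) + 2 * s)) = r ^ (-1 - 2 * s) * min (r ^ 2) 1 := by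
    intro r hr
    rw [smul_eq_mul, div_eq_mul_inv, ← Real.rpow_neg hr.le, mul_left_comm,
      ← Real.rpow_natCast r (finrank ℝ E - 1), ← Real.rpow_add hr, Nat.cast_sub h1, mul_comm]
    congr 2; push_cast; ring
  rw [← Ioc_union_Ioi_eq_Ioi zero_le_one]
  refine IntegrableOn.union ?_ ?_
  · refine (integrableOn_Ioc_rpow (r := 1 - 2 * s) (by linarith) zero_le_one).congr_fun
      (fun r hr => ?_) measurableSet_Ioc
    simp only
    rw [e r hr.1, min_eq_left (pow_le_one₀ hr.1.le hr.2), ← Real.rpow_natCast,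
      ← Real.rpow_add hr.1]
    congr 1; push_cast; ring
  · refine (integrableOn_Ioi_rpow_of_lt (a := -1 - 2 * s) (by linarith) zero_lt_one).congr_fun
      (fun r hr => ?_) measurableSet_Ioi
    have hr1 : 1 < r := hr
    simp only
    rw [e r (by linarith), min_eq_right (one_le_pow₀ hr1.le), mul_one]

theorem min_div_norm_rpow_eq (hR : 0 < R) (z : E) :
    min ((‖z‖ / R) ^ 2) 1 / ‖z‖ ^ ((finrank ℝ E : ℝ) + 2 * s) =
      R ^ (-((finrank ℝ E : ℝ) + 2 * s)) * (min (‖R⁻¹ • z‖ ^ 2) 1 /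
        ‖R⁻¹ • z‖ ^ ((finrank ℝ E : ℝ) + 2 * s)) := by
  rw [norm_smul, norm_inv, Real.norm_of_nonneg hR.le, ← div_eq_inv_mul,
    Real.div_rpow (norm_nonneg _) hR.le, Real.rpow_neg hR.le]
  have : R ^ ((finrank ℝ E : ℝ) + 2 * s) ≠ 0 := (Real.rpow_pos_of_pos hR _).ne'
  field_simp

theorem integrable_min_div_norm_rpow' [Nontrivial E] (hs0 : 0 < s) (hs1 : s < 1) (hR : 0 < R) :
    Integrable fun z : E => min ((‖z‖ / R) ^ 2) 1 / ‖z‖ ^ ((finrank ℝ E : ℝ) + 2 * s) := by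
  simp_rw [min_div_norm_rpow_eq hR]
  exact ((integrable_min_div_norm_rpow hs0 hs1).comp_smul (inv_ne_zero hR.ne')).const_mul _

theorem integral_min_div_norm_rpow (hR : 0 < R) :
    ∫ z : E, min ((‖z‖ / R) ^ 2) 1 / ‖z‖ ^ ((finrank ℝ E : ℝ) + 2 * s) =
      R ^ (-(2 * s)) * ∫ z : E, min (‖z‖ ^ 2) 1 / ‖z‖ ^ ((finrank ℝ E : ℝ) + 2 * s) := by
  simp_rw [min_div_norm_rpow_eq hR]
  rw [integral_const_mul, Measure.integral_comp_inv_smul_of_nonneg (volume : Measure E)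
    (fun z => min (‖z‖ ^ 2) 1 / ‖z‖ ^ ((finrank ℝ E : ℝ) + 2 * s)) hR.le, smul_eq_mul, ← mul_assoc,
    ← Real.rpow_natCast, ← Real.rpow_add hR]
  congr 2; ring

theorem tent_energy [Nontrivial E] (hs0 : 0 < s) (hs1 : s < 1) (hR : 0 < R) :
    Integrable (fun p : E × E => (tent R p.1 - tent R p.2) ^ 2 /
      ‖p.1 - p.2‖ ^ ((finrank ℝ E : ℝ) + 2 * s)) ∧
    ∫ p : E × E, (tent R p.1 - tent R p.2) ^ 2 /
      ‖p.1 - p.2‖ ^ ((finrank ℝ E : ℝ) + 2 * s) ≤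
      2 * (R ^ finrank ℝ E * volume.real (Metric.ball (0 : E) 1)) * (R ^ (-(2 * s)) *
        ∫ z : E, min (‖z‖ ^ 2) 1 / ‖z‖ ^ ((finrank ℝ E : ℝ) + 2 * s)) := by
  set k : E → ℝ := fun z => min ((‖z‖ / R) ^ 2) 1 / ‖z‖ ^ ((finrank ℝ E : ℝ) + 2 * s) with hk
  have hki : Integrable k := integrable_min_div_norm_rpow' hs0 hs1 hR
  set χ : E → ℝ := (Metric.ball 0 R).indicator 1 with hχ
  have hχi : Integrable χ := (integrable_indicator_iff measurableSet_ball).2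
    (integrableOn_const measure_ball_lt_top.ne)
  have hχI : ∫ x, χ x = R ^ finrank ℝ E * volume.real (Metric.ball (0 : E) 1) := by
    rw [hχ, integral_indicator_one measurableSet_ball, Measure.real,
      Measure.addHaar_ball _ _ hR.le, ENNReal.toReal_mul, ENNReal.toReal_ofReal (by positivity),
      Measure.real]
  have i1 : Integrable (fun p : E × E => χ p.1 * k (p.1 - p.2)) (volume.prod volume) := by
    refine ((hχi.convolution_integrand (ContinuousLinearMap.mul ℝ ℝ) hki).swap).congr
      (ae_of_all _ fun p => ?_)
    simp only [Function.comp, Prod.swap, ContinuousLinearMap.mul_apply', hk]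
    rw [norm_sub_rev]
  have i2 := i1.swap
  have e1 : ∫ p : E × E, χ p.1 * k (p.1 - p.2) = (∫ x, χ x) * ∫ z, k z := by
    rw [Measure.volume_eq_prod, integral_prod _ i1]
    simp_rw [integral_const_mul, integral_sub_left_eq_self k]
    rw [integral_mul_const]
  have e2 : ∫ p : E × E, χ p.2 * k (p.2 - p.1) = (∫ x, χ x) * ∫ z, k z := by
    rw [← e1]
    exact integral_prod_swap (fun p : E × E => χ p.1 * k (p.1 - p.2))
  have hle : ∀ p : E × E, (tent R p.1 - tent R p.2) ^ 2 /
      ‖p.1 - p.2‖ ^ ((finrank ℝ E : ℝ) + 2 * s) ≤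
      χ p.1 * k (p.1 - p.2) + χ p.2 * k (p.2 - p.1) := by
    intro p
    have h1 : k (p.2 - p.1) = k (p.1 - p.2) := by simp only [hk]; rw [norm_sub_rev]
    rw [h1, ← add_mul, hk]
    simp only
    rw [mul_div_assoc', mul_comm (_ + _)]
    gcongr
    exact sq_tent_sub_le hR p.1 p.2
  have hm : AEStronglyMeasurable (fun p : E × E => (tent R p.1 - tent R p.2) ^ 2 /
      ‖p.1 - p.2‖ ^ ((finrank ℝ E : ℝ) + 2 * s)) := by
    have := (continuous_tent (E := E) R).measurable
    exact Measurable.aestronglyMeasurable (by fun_prop)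
  have hi : Integrable (fun p : E × E => (tent R p.1 - tent R p.2) ^ 2 /
      ‖p.1 - p.2‖ ^ ((finrank ℝ E : ℝ) + 2 * s)) := by
    refine (i1.add i2).mono' hm (ae_of_all _ fun p => ?_)
    rw [Real.norm_of_nonneg (by positivity)]
    exact hle p
  refine ⟨hi, (integral_mono hi (i1.add i2) hle).trans (le_of_eq ?_)⟩
  rw [Measure.volume_eq_prod, integral_add' i1 i2]
  simp only [Function.comp_apply, Prod.fst_swap, Prod.snd_swap]
  rw [← Measure.volume_eq_prod, e1, e2, hχI, hk, integral_min_div_norm_rpow hR]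
  ring

end

noncomputable section

open MeasureTheory Filter Topology Set Module

variable {N : ℕ} {s R : ℝ}

theorem fracLapConst_pos (hN : 2 ≤ N) (hs0 : 0 < s) (hs1 : s < 1) : 0 < fracLapConst N s := by
  unfold fracLapConst
  have h1 : 0 < Real.Gamma ((N : ℝ) / 2 + s) := Real.Gamma_pos_of_pos (by positivity)
  have h2 : 0 < Real.Gamma (2 - s) := Real.Gamma_pos_of_pos (by linarith)
  have h3 : 0 < 1 - s := by linarith
  have := Real.pi_pos
  positivity

theorem sq_div_rpow_eq {N : ℕ} {s : ℝ} (a : ℝ) {b : ℝ} (hb : 0 ≤ b) :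
    (a / b ^ ((N : ℝ) / 2 + s)) ^ 2 = a ^ 2 / b ^ ((N : ℝ) + 2 * s) := by
  rw [div_pow, ← Real.rpow_natCast (b ^ _) 2, ← Real.rpow_mul hb]
  congr 2
  push_cast; ring

theorem MemFracSobolev.integrable_energy {u : EuclideanSpace ℝ (Fin N) → ℝ}
    (hu : MemFracSobolev s u) :
    Integrable fun p : EuclideanSpace ℝ (Fin N) × EuclideanSpace ℝ (Fin N) =>
      (u p.1 - u p.2) ^ 2 / ‖p.1 - p.2‖ ^ ((N : ℝ) + 2 * s) := by
  refine hu.2.integrable_sq.congr (ae_of_all _ fun p => ?_)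
  simp only
  rw [sq_div_rpow_eq _ (norm_nonneg _)]

theorem memFracSobolevZero_tent (hN : 2 ≤ N) (hs0 : 0 < s) (hs1 : s < 1) (hR : 0 < R) :
    MemFracSobolevZero s (Metric.ball (0 : EuclideanSpace ℝ (Fin N)) R) (tent R) := by
  have hd : finrank ℝ (EuclideanSpace ℝ (Fin N)) = N := finrank_euclideanSpace_fin
  have : Nontrivial (EuclideanSpace ℝ (Fin N)) :=
    Module.nontrivial_of_finrank_pos (R := ℝ) (by omega)
  have hi := (tent_energy (E := EuclideanSpace ℝ (Fin N)) hs0 hs1 hR).1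
  rw [hd] at hi
  refine ⟨⟨memLp_tent hR, (memLp_two_iff_integrable_sq ?_).2 ?_⟩,
    ae_of_all _ fun x hx => tent_eq_zero hR hx⟩
  · have := (continuous_tent (E := EuclideanSpace ℝ (Fin N)) R).measurable
    exact Measurable.aestronglyMeasurable (by fun_prop)
  · simp_rw [sq_div_rpow_eq _ (norm_nonneg _)]
    exact hi

theorem tent_ne_zero (hR : 0 < R) :
    ¬ (tent R : EuclideanSpace ℝ (Fin N) → ℝ) =ᵐ[volume] 0 := by
  intro h
  have h1 : ∫ x : EuclideanSpace ℝ (Fin N), tent R x ^ 2 = 0 := by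
    refine integral_eq_zero_of_ae ?_
    filter_upwards [h] with x hx
    simp [hx]
  rw [integral_tent_sq hR] at h1
  have h2 := integral_tent_one_sq_pos (E := EuclideanSpace ℝ (Fin N))
  have : 0 < R ^ finrank ℝ (EuclideanSpace ℝ (Fin N)) := by positivity
  exact (mul_pos this h2).ne' h1

theorem rayleigh_nonneg (hN : 2 ≤ N) (hs0 : 0 < s) (hs1 : s < 1)
    (u : EuclideanSpace ℝ (Fin N) → ℝ) : 0 ≤ fracEnergy s u / ∫ x, u x ^ 2 := by
  have := fracLapConst_pos hN hs0 hs1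
  unfold fracEnergy
  exact div_nonneg (mul_nonneg (by positivity) (integral_nonneg fun p => by positivity))
    (integral_nonneg fun x => sq_nonneg _)

theorem firstFracEigenvalue_le (hN : 2 ≤ N) (hs0 : 0 < s) (hs1 : s < 1)
    {Ω : Set (EuclideanSpace ℝ (Fin N))} {u : EuclideanSpace ℝ (Fin N) → ℝ}
    (hu : MemFracSobolevZero s Ω u) (hne : ¬ u =ᵐ[volume] 0) :
    firstFracEigenvalue s Ω ≤ fracEnergy s u / ∫ x, u x ^ 2 := by
  refine csInf_le ⟨0, ?_⟩ ⟨u, hu, hne, rfl⟩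
  rintro r ⟨u, -, -, rfl⟩
  exact rayleigh_nonneg hN hs0 hs1 u

theorem exists_rayleigh_lt_one (hN : 2 ≤ N) (hs0 : 0 < s) (hs1 : s < 1) (hR : 0 < R)
    (h : firstFracEigenvalue s (Metric.ball (0 : EuclideanSpace ℝ (Fin N)) R) < 1) :
    ∃ u : EuclideanSpace ℝ (Fin N) → ℝ, MemFracSobolevZero s (Metric.ball 0 R) u ∧
      fracEnergy s u < ∫ x, u x ^ 2 := by
  unfold firstFracEigenvalue at h
  obtain ⟨r, ⟨u, hu, hne, rfl⟩, hr⟩ := exists_lt_of_csInf_lt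
    (by exact ⟨_, tent R, memFracSobolevZero_tent hN hs0 hs1 hR, tent_ne_zero hR, rfl⟩) h
  refine ⟨u, hu, ?_⟩
  have h0 : 0 ≤ ∫ x, u x ^ 2 := integral_nonneg fun x => sq_nonneg _
  refine (div_lt_one (h0.lt_of_ne fun h1 => hne ?_)).1 hr
  have := (integral_eq_zero_iff_of_nonneg (fun x => sq_nonneg (u x)) hu.1.1.integrable_sq).1 h1.symm
  filter_upwards [this] with x hx
  simpa using hx

theorem eventually_firstFracEigenvalue_lt_one (hN : 2 ≤ N) (hs0 : 0 < s) (hs1 : s < 1) :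
    ∀ᶠ R in atTop, firstFracEigenvalue s (Metric.ball (0 : EuclideanSpace ℝ (Fin N)) R) < 1 := by
  have hc := fracLapConst_pos hN hs0 hs1
  have hd : finrank ℝ (EuclideanSpace ℝ (Fin N)) = N := finrank_euclideanSpace_fin
  have : Nontrivial (EuclideanSpace ℝ (Fin N)) :=
    Module.nontrivial_of_finrank_pos (R := ℝ) (by omega)
  have hI := integral_tent_one_sq_pos (E := EuclideanSpace ℝ (Fin N))
  set I := ∫ x : EuclideanSpace ℝ (Fin N), tent 1 x ^ 2 with hIdef
  set v := volume.real (Metric.ball (0 : EuclideanSpace ℝ (Fin N)) 1)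
  set k := ∫ z : EuclideanSpace ℝ (Fin N), min (‖z‖ ^ 2) 1 / ‖z‖ ^ ((N : ℝ) + 2 * s)
  have ht : Tendsto (fun R : ℝ => fracLapConst N s * v * k / I * R ^ (-(2 * s))) atTop
      (𝓝 (fracLapConst N s * v * k / I * 0)) :=
    (tendsto_rpow_neg_atTop (by linarith)).const_mul _
  rw [mul_zero] at ht
  filter_upwards [ht.eventually (gt_mem_nhds one_pos), eventually_gt_atTop 0] with R h1 hR
  refine (firstFracEigenvalue_le hN hs0 hs1 (memFracSobolevZero_tent hN hs0 hs1 hR)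
    (tent_ne_zero hR)).trans_lt (lt_of_le_of_lt ?_ h1)
  have h2 := (tent_energy (E := EuclideanSpace ℝ (Fin N)) hs0 hs1 hR).2
  rw [hd] at h2
  rw [integral_tent_sq hR, hd, ← hIdef, div_le_iff₀ (by positivity)]
  calc fracEnergy s (tent R) ≤ fracLapConst N s / 2 *
        (2 * (R ^ N * v) * (R ^ (-(2 * s)) * k)) := by
        unfold fracEnergy
        gcongr
    _ = _ := by field_simp

/-- A positive bounded supersolution in `B_R(x₀)` forces the first eigenvalue of the ball to be at
least one. -/
theorem integral_sq_le_fracEnergy (hN : 2 ≤ N) (hs0 : 0 < s) (hs1 : s < 1) (hR : 0 < R) {M : ℝ}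
    {w f : EuclideanSpace ℝ (Fin N) → ℝ} (hw : BddIntegrable M w) (hw0 : ∀ x, 0 ≤ w x)
    (hne : ¬ w =ᵐ[volume] 0) {x₀ : EuclideanSpace ℝ (Fin N)}
    (hf0 : ∀ x ∈ Metric.ball x₀ R, 0 ≤ f x)
    (hfw : ∀ᵐ x, x ∈ Metric.ball x₀ R → f x = w x)
    (hpt : ∀ x ∈ Metric.ball x₀ R, ∃ F, (fracLapConst N s)⁻¹ * f x ≤ F ∧
      Tendsto (fun ε => ∫ y in (Metric.ball x ε)ᶜ,
        (f x - w y) / ‖x - y‖ ^ ((finrank ℝ (EuclideanSpace ℝ (Fin N)) : ℝ) + 2 * s))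
          (𝓝[>] 0) (𝓝 F))
    {u : EuclideanSpace ℝ (Fin N) → ℝ} (hu : MemFracSobolevZero s (Metric.ball 0 R) u) :
    ∫ x, u x ^ 2 ≤ fracEnergy s u := by
  have hc := fracLapConst_pos hN hs0 hs1
  have hd : finrank ℝ (EuclideanSpace ℝ (Fin N)) = N := finrank_euclideanSpace_fin
  have hE : 2 ≤ finrank ℝ (EuclideanSpace ℝ (Fin N)) := by omega
  have hCK := integral_heatWeight_pos (E := EuclideanSpace ℝ (Fin N)) hs0 hs1
  set CK := ∫ σ in Ioi 0, heatWeight (EuclideanSpace ℝ (Fin N)) s σ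
  have key : ∀ t ∈ Ioi (1 : ℝ), ((t ^ 2)⁻¹) ^ s * ∫ x, u x ^ 2 ≤ fracEnergy s u := by
    intro t ht
    have ht1 : 1 < t := ht
    have ht0 : 0 < t := by linarith
    have hRt : R / t < R := div_lt_self hR ht1
    have hρ : 0 < (R - R / t) / 2 := by linarith
    obtain ⟨V, hV⟩ := exists_isHeatSupersolution (s := s) (R := R) hE hs0 hs1 hw hw0 hne hρ
      (inv_nonneg.2 hc.le) hf0 hfw hpt
    have hW := hV.dilate ht1.le
    set W := fun x => V (x₀ + t⁻¹ • x)
    have hsub : Metric.closedBall (0 : EuclideanSpace ℝ (Fin N)) R ⊆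
        Metric.ball 0 (t * (R - (R - R / t) / 2)) := by
      refine Metric.closedBall_subset_ball ?_
      have : t * (R / t) = R := by field_simp
      nlinarith
    obtain ⟨z, hz, hmin⟩ := (isCompact_closedBall (0 : EuclideanSpace ℝ (Fin N)) R).exists_isMinOn
      ⟨0, Metric.mem_closedBall_self hR.le⟩ hW.continuous.continuousOn
    have hBs := Metric.ball_subset_closedBall.trans hsub
    have hW' : IsHeatSupersolution s (((t ^ 2)⁻¹) ^ s * (CK * (fracLapConst N s)⁻¹))
        (Metric.ball 0 R) W :=
      ⟨hW.continuous, hW.nonneg, hW.bound, hW.sub_heat, fun x hx => hW.pos x (hBs hx),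
        fun x hx => hW.le x (hBs hx)⟩
    have h1 := two_mul_integral_sq_le_energy hs0 hs1 hW' Metric.isOpen_ball.measurableSet
      (hW.pos z (hsub hz)) (fun x hx => hmin (Metric.ball_subset_closedBall hx)) hu.1.1 hu.2
      (by rw [hd]; exact hu.1.integrable_energy)
    rw [hd] at h1
    have h2 : CK * (2 * ((t ^ 2)⁻¹ ^ s * (fracLapConst N s)⁻¹ * ∫ x, u x ^ 2)) ≤
        CK * ∫ p : EuclideanSpace ℝ (Fin N) × EuclideanSpace ℝ (Fin N),
          (u p.1 - u p.2) ^ 2 / ‖p.1 - p.2‖ ^ ((N : ℝ) + 2 * s) := by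
      refine le_trans (le_of_eq ?_) h1
      ring
    have h3 := mul_le_mul_of_nonneg_left (le_of_mul_le_mul_left h2 hCK)
      (by positivity : 0 ≤ fracLapConst N s / 2)
    refine le_trans (le_of_eq ?_) h3
    field_simp
  have ht : Tendsto (fun t : ℝ => ((t ^ 2)⁻¹) ^ s * ∫ x, u x ^ 2) (𝓝[>] 1)
      (𝓝 ((((1 : ℝ) ^ 2)⁻¹) ^ s * ∫ x, u x ^ 2)) := by
    refine Tendsto.mono_left ?_ nhdsWithin_le_nhds
    refine (((tendsto_id.pow 2).inv₀ (by norm_num)).rpow_const (Or.inr hs0.le)).mul_const _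
  simp only [one_pow, inv_one, Real.one_rpow, one_mul] at ht
  exact le_of_tendsto ht (eventually_of_mem self_mem_nhdsWithin key)

theorem HasFracLaplacianAt.tendsto_setIntegral (hN : 2 ≤ N) (hs0 : 0 < s) (hs1 : s < 1)
    {w : EuclideanSpace ℝ (Fin N) → ℝ} {x : EuclideanSpace ℝ (Fin N)} {l : ℝ}
    (h : HasFracLaplacianAt s w x l) :
    Tendsto (fun ε => ∫ y in (Metric.ball x ε)ᶜ,
      (w x - w y) / ‖x - y‖ ^ ((finrank ℝ (EuclideanSpace ℝ (Fin N)) : ℝ) + 2 * s))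
      (𝓝[>] 0) (𝓝 ((fracLapConst N s)⁻¹ * l)) := by
  have hc := fracLapConst_pos hN hs0 hs1
  refine (h.2.const_mul (fracLapConst N s)⁻¹).congr fun ε => ?_
  rw [inv_mul_cancel_left₀ hc.ne', finrank_euclideanSpace_fin]

theorem exists_ae_abs_le {w : EuclideanSpace ℝ (Fin N) → ℝ} (hw : MemLp w ⊤ volume) :
    ∃ M, ∀ᵐ x, |w x| ≤ M := by
  refine ⟨(eLpNorm w ⊤ volume).toReal, ?_⟩
  filter_upwards [enorm_ae_le_eLpNormEssSup w volume] with x hx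
  rw [eLpNorm_exponent_top, ← Real.norm_eq_abs, ← toReal_enorm]
  exact ENNReal.toReal_mono (by rw [← eLpNorm_exponent_top]; exact hw.2.ne) hx

theorem exists_measurable_representative {w : EuclideanSpace ℝ (Fin N) → ℝ} {M : ℝ}
    (hw : AEStronglyMeasurable w volume) (hM : ∀ᵐ x, |w x| ≤ M) (h0 : ∀ᵐ x, 0 ≤ w x)
    (hM0 : 0 ≤ M) :
    ∃ v : EuclideanSpace ℝ (Fin N) → ℝ, Measurable v ∧ (∀ x, 0 ≤ v x) ∧ (∀ x, v x ≤ M) ∧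
      v =ᵐ[volume] w := by
  refine ⟨fun x => max 0 (min (hw.mk w x) M),
    measurable_const.max (hw.stronglyMeasurable_mk.measurable.min measurable_const),
    fun x => le_max_left _ _, fun x => max_le hM0 (min_le_right _ _), ?_⟩
  filter_upwards [hw.ae_eq_mk, hM, h0] with x h1 h2 h3
  rw [← h1, min_eq_left (abs_le.1 h2).2, max_eq_right h3]

theorem eq_zero_of_ae_eq_zero (hN : 2 ≤ N) (hs0 : 0 < s) (hs1 : s < 1)
    {w : EuclideanSpace ℝ (Fin N) → ℝ} (hw : MemLp w ⊤ volume) (h0 : ∀ᵐ x, 0 ≤ w x)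
    {x : EuclideanSpace ℝ (Fin N)} (hx : HasFracLaplacianAt s w x (w x)) {r : ℝ} (hr : 0 < r)
    (hwr : ∀ᵐ y, y ∈ Metric.ball x r → w y = 0) :
    w x = 0 ∧ w =ᵐ[volume] 0 := by
  have hd : finrank ℝ (EuclideanSpace ℝ (Fin N)) = N := finrank_euclideanSpace_fin
  have : Nontrivial (EuclideanSpace ℝ (Fin N)) :=
    Module.nontrivial_of_finrank_pos (R := ℝ) (by omega)
  obtain ⟨M, hM⟩ := exists_ae_abs_le hw
  have hl := hx.tendsto_setIntegral hN hs0 hs1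
  have hi := integrableOn_div_norm_sub_rpow hs0 hw.1 hM x hr
  obtain ⟨h1, h2⟩ := eq_zero_of_tendsto_setIntegral hs0 hw.1 hM h0 hr hwr hl
  refine ⟨h1, ?_⟩
  rw [h1, mul_zero, zero_eq_neg] at h2
  have h3 := (setIntegral_eq_zero_iff_of_nonneg_ae (ae_restrict_of_ae
    (h0.mono fun y hy => div_nonneg hy (by positivity))) hi).1 h2
  have h4 := (ae_restrict_iff' Metric.isOpen_ball.measurableSet.compl).1 h3
  filter_upwards [h4, hwr] with y hy1 hy2
  by_cases hy : y ∈ Metric.ball x r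
  · exact hy2 hy
  · have h5 : w y / ‖x - y‖ ^ ((finrank ℝ (EuclideanSpace ℝ (Fin N)) : ℝ) + 2 * s) = 0 := hy1 hy
    refine (div_eq_zero_iff.1 h5).resolve_right (Real.rpow_pos_of_pos ?_ _).ne'
    rw [Metric.mem_ball, not_lt, dist_comm, dist_eq_norm] at hy
    exact hr.trans_le hy

theorem ae_eq_zero_of_firstFracEigenvalue_lt_one (hN : 2 ≤ N) (hs0 : 0 < s) (hs1 : s < 1)
    (hR : 0 < R)
    (hlam : firstFracEigenvalue s (Metric.ball (0 : EuclideanSpace ℝ (Fin N)) R) < 1)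
    {x₀ : EuclideanSpace ℝ (Fin N)} {w : EuclideanSpace ℝ (Fin N) → ℝ}
    (hw : MemLp w ⊤ volume) (h0 : ∀ᵐ x, 0 ≤ w x)
    (hpde : ∀ x ∈ Metric.ball x₀ R, HasFracLaplacianAt s w x (w x)) :
    w =ᵐ[volume] 0 ∧ ∀ x ∈ Metric.ball x₀ R, w x = 0 := by
  have hd : finrank ℝ (EuclideanSpace ℝ (Fin N)) = N := finrank_euclideanSpace_fin
  have : Nontrivial (EuclideanSpace ℝ (Fin N)) :=
    Module.nontrivial_of_finrank_pos (R := ℝ) (by omega)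
  obtain ⟨M', hM'⟩ := exists_ae_abs_le hw
  set M := max M' 0
  have hM : ∀ᵐ x, |w x| ≤ M := hM'.mono fun x hx => hx.trans (le_max_left _ _)
  have hM0 : 0 ≤ M := le_max_right _ _
  obtain ⟨v, hvm, hv0, hvM, hvw⟩ := exists_measurable_representative hw.1 hM h0 hM0
  set B := Metric.ball x₀ R with hB
  have hBm : MeasurableSet B := Metric.isOpen_ball.measurableSet
  have h10 : ∀ x, 0 ≤ B.indicator v x := fun x => indicator_nonneg (fun x _ => hv0 x) x
  have h1M : ∀ x, |B.indicator v x| ≤ M := fun x => by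
    rw [abs_of_nonneg (h10 x)]
    exact indicator_le' (fun x _ => hvM x) (fun _ _ => hM0) x
  have hbi : BddIntegrable M (B.indicator v) := by
    refine ⟨hvm.indicator hBm, (integrable_indicator_iff hBm).2 ?_, h1M⟩
    refine Measure.integrableOn_of_bounded (M := M) measure_ball_lt_top.ne
      hvm.aestronglyMeasurable (ae_of_all _ fun x => ?_)
    rw [Real.norm_of_nonneg (hv0 x)]
    exact hvM x
  have hball : ∀ x ∈ B, 0 < R - dist x x₀ ∧ Metric.ball x (R - dist x x₀) ⊆ B := fun x hx =>
    ⟨sub_pos.2 hx, Metric.ball_subset_ball' (by linarith)⟩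
  have heq : ∀ᵐ x, x ∈ B → B.indicator v x = w x := by
    filter_upwards [hvw] with x hx hxB
    rw [indicator_of_mem hxB, hx]
  have hle : ∀ᵐ x, B.indicator v x ≤ w x := by
    filter_upwards [hvw] with x hx
    rw [← hx]
    exact indicator_le_self' (fun x _ => hv0 x) x
  have hpt : ∀ x ∈ B, ∃ F, (fracLapConst N s)⁻¹ * w x ≤ F ∧
      Tendsto (fun ε => ∫ y in (Metric.ball x ε)ᶜ,
        (w x - B.indicator v y) / ‖x - y‖ ^ ((finrank ℝ (EuclideanSpace ℝ (Fin N)) : ℝ) + 2 * s))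
          (𝓝[>] 0) (𝓝 F) := by
    intro x hx
    have hl := (hpde x hx).tendsto_setIntegral hN hs0 hs1
    exact exists_tendsto_setIntegral_of_eq_on_ball hs0 hw.1 hM hbi.measurable.aestronglyMeasurable
      (ae_of_all _ h1M) hle (hball x hx).1 (heq.mono fun y hy h => hy ((hball x hx).2 h)) hl
  have hf0 : ∀ x ∈ B, 0 ≤ w x := fun x hx => by
    have hl := (hpde x hx).tendsto_setIntegral hN hs0 hs1
    exact nonneg_of_tendsto_setIntegral hs0 hw.1 hM h0 hl
  have hz : B.indicator v =ᵐ[volume] 0 := by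
    by_contra hne
    obtain ⟨u, hu, hlt⟩ := exists_rayleigh_lt_one hN hs0 hs1 hR hlam
    exact hlt.not_ge (integral_sq_le_fracEnergy hN hs0 hs1 hR hbi h10 hne hf0
      (heq.mono fun x hx h => (hx h).symm) hpt hu)
  have hwB : ∀ᵐ x, x ∈ B → w x = 0 := by
    filter_upwards [hz, heq] with x h1 h2 hx
    rw [← h2 hx, h1]; rfl
  have hfin : ∀ x ∈ B, w x = 0 ∧ w =ᵐ[volume] 0 := fun x hx =>
    eq_zero_of_ae_eq_zero hN hs0 hs1 hw h0 (hpde x hx) (hball x hx).1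
      (hwB.mono fun y hy h => hy ((hball x hx).2 h))
  exact ⟨(hfin x₀ (Metric.mem_ball_self hR)).2, fun x hx => (hfin x hx).1⟩

end

theorem mainTheorem9 (N : ℕ) (hN : 2 ≤ N) (s : ℝ) (hs0 : 0 < s) (hs1 : s < 1) :
    (∀ R : ℝ, 0 < R →
      firstFracEigenvalue s (Metric.ball (0 : EuclideanSpace ℝ (Fin N)) R) < 1 →
      ∀ (x₀ : EuclideanSpace ℝ (Fin N)) (w : EuclideanSpace ℝ (Fin N) → ℝ),
        MemLp w ⊤ volume →
        (∀ᵐ x, 0 ≤ w x) →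
        (∀ x ∈ Metric.ball x₀ R, HasFracLaplacianAt s w x (w x)) →
        w =ᵐ[volume] 0 ∧ ∀ x ∈ Metric.ball x₀ R, w x = 0) ∧
    (∀ w : EuclideanSpace ℝ (Fin N) → ℝ,
        MemLp w ⊤ volume →
        (∀ᵐ x, 0 ≤ w x) →
        (∀ x, HasFracLaplacianAt s w x (w x)) →
        ∀ x, w x = 0) ∧
    (∀ w : EuclideanSpace ℝ (Fin N) → ℝ,
        MemLp w ⊤ volume →
        (∀ᵐ x, 0 ≤ w x) →
        (∀ x : EuclideanSpace ℝ (Fin N), 0 < x ⟨N - 1, by omega⟩ →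
          HasFracLaplacianAt s w x (w x)) →
        ∀ x : EuclideanSpace ℝ (Fin N), 0 < x ⟨N - 1, by omega⟩ → w x = 0) := by
  obtain ⟨R, hlam, hR⟩ := ((eventually_firstFracEigenvalue_lt_one hN hs0 hs1).and
    (eventually_gt_atTop 0)).exists
  refine ⟨fun R hR hlam x₀ w hw h0 hpde =>
    ae_eq_zero_of_firstFracEigenvalue_lt_one hN hs0 hs1 hR hlam hw h0 hpde,
    fun w hw h0 hpde x => ?_, fun w hw h0 hpde x hx => ?_⟩
  · exact (ae_eq_zero_of_firstFracEigenvalue_lt_one hN hs0 hs1 hR hlam (x₀ := x) hw h0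
      fun y _ => hpde y).2 x (Metric.mem_ball_self hR)
  · have hball : ∀ y ∈ Metric.ball (EuclideanSpace.single (⟨N - 1, by omega⟩ : Fin N) R) R,
        0 < y ⟨N - 1, by omega⟩ := by
      intro y hy
      rw [Metric.mem_ball, dist_eq_norm] at hy
      have h1 := PiLp.norm_apply_le (y - EuclideanSpace.single (⟨N - 1, by omega⟩ : Fin N) R)
        ⟨N - 1, by omega⟩
      rw [PiLp.sub_apply, PiLp.single_apply, if_pos rfl, Real.norm_eq_abs] at h1
      have h2 := (abs_le.1 (h1.trans hy.le)).1
      have h3 := (abs_lt.1 (h1.trans_lt hy)).1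
      linarith
    have hae := (ae_eq_zero_of_firstFracEigenvalue_lt_one hN hs0 hs1 hR hlam hw h0
      fun y hy => hpde y (hball y hy)).1
    exact (eq_zero_of_ae_eq_zero hN hs0 hs1 hw h0 (hpde x hx) one_pos
      (hae.mono fun y hy _ => hy)).1
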